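/- **Setting.** Let $G=(V,E,\omega)$ be an undirected graph with $n$ vertices, $m$ edges and positive edge weights (all equal to $1$ in the unweighted case), with distance $d_G$. Its arboricity is $\max_{U\subseteq V,\,|U|\ge 2}|E(U)|/(|U|-1)$ (and $0$ if $n\le 1$). Let $\lambda$ be either the arboricity of $G$ or $m/n$. In the first case every vertex $v$ has one virtual node, in the second case it has $\lceil\deg(v)/\lambda\rceil$ virtual nodes (none if $m=0$). **The oracle $\Lambda_h$, $h\ge1$.** For $i=1,\dots,h$ let $\rho_i=n^{\alpha_i}$ with $\alpha_i=1-(3/4)^{h-i+1}$. Independently for all levels $i$ and all virtual nodes, a virtual node is selected on level $i$ with probability $\rho_i/n$; the set $L_i$ of $i$-landmarks consists of the vertices with at least one selected virtual node on level $i$. Let $\ell_i(v)$ be the $i$-landmark closest to $v$ (ties broken consistently), $r_i(v)=d_G(v,\ell_i(v))$ (with $r_i(v)=\infty$ if no $i$-landmark is reachable from $v$), $\mathrm{Ball}_i(v)=\{x: d_G(v,x)<r_i(v)\}$ and $\mathcal B_i^{1/3}(v)=\{x: d_G(v,x)<r_i(v)/3\}$. For $i<h$ let $\mathcal P_i$ be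 the set of pairs of distinct $i$-landmarks $u,v$ with $v\in\mathcal B^{1/3}_{i+1}(u)$ or $u\in\mathcal B^{1/3}_{i+1}(v)$; let $\mathcal P_h$ be the set of all pairs of distinct mutually reachable $h$-landmarks. Fix a shortest path for every pair of mutually reachable vertices such that chosen paths share the whole subpath between any two common vertices. The oracle stores $G$ (adjacency lists sorted by weight) and, for each $i$, the forest of shortest path trees rooted at the $i$-landmarks and a distance-preserving oracle for $\mathcal P_i$. The latter consists of: the first and the last edge of the chosen path of each pair in $\mathcal P_i$; for each vertex that is internal on some chosen path of a pair in $\mathcal P_i$, the name of one such path and its two edges at this vertex; and, for each branching event (two distinct chosen paths of pairs in $\mathcal P_i$ and a common vertex at which their sets of predecessor and successor differ), the at most four edges of the two paths at this vertex. Tables allow lookup of a record in $O(1)$ time. **The query $(u,v)$.** If $u=v$, the trivial path is returned. Otherwise truncated Dijkstra searches confined to $\mathrm{Ball}_1(u)$ and $\mathrm{Ball}_1(v)$ test if $v\in\mathrm{Ball}_1(u)$ or $u\in\mathrm{Ball}_1(v)$; if so, the shortest path found is returned. Otherwise, with $u^{(0)}=u$, $u^{(j)}=\ell_j(u^{(j-1)})$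 and likewise $v^{(j)}$, let $p\ge1$ be the first level with $u^{(p)}=v^{(p)}$ or $(u^{(p)},v^{(p)})\in\mathcal P_p$. The concatenation of the stored paths $u^{(0)},\dots,u^{(1)},\dots,u^{(p)}$, the stored shortest path from $u^{(p)}$ to $v^{(p)}$, and the stored paths $v^{(p)},\dots,v^{(1)},\dots,v^{(0)}$ is returned. If no such $p$ exists, the answer is that there is no path. **Theorem.** For every $h\ge1$ and every $G$ and both choices of $\lambda$: 1. (Space) $\Lambda_h$ uses expected space at most $C\cdot n\cdot h$ words, in addition to the space required to store $G$, where $C$ is an absolute constant. 2. (Stretch) For every outcome of the sampling and all $u,v\in V$: if $u$ and $v$ are connected, the query returns a path (walk) $\Pi$ in $G$ from $u$ to $v$ of length at most $(6\cdot7^{h-1}-1)\,d_G(u,v)$; otherwise it reports that there is none. 3. (Query time) For every $c$ there is a constant $C$, depending only on $c$, such that with probability at least $1-n^{-c}$ all queries take time at most $$C\,n^{(3/4)^h}\,\lambda\,\log^2 n\;+\;C\,(|\Pi|+h),$$ where $|\Pi|$ is the number of edges of the returned path ($0$ if there is none). That is, up to the additive term $O(|\Pi|+h)$, the query time is with high probability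 $\tilde O(n^{(3/4)^h}\lambda)$. -/

import Mathlib

open scoped NNReal ENNReal
open MeasureTheory

noncomputable section

/-! ## Weighted graphs, distances, arboricity -/

/-- An undirected graph on `n` vertices with positive edge weights
(unweighted graphs are those with all weights equal to `1`). -/
structure WGraph (n : ℕ) where
  /-- the underlying simple graph -/
  graph : SimpleGraph (Fin n)
  /-- the weights; only the values on edges matter -/
  weight : Sym2 (Fin n) → ℝ≥0
  /-- edges have positive weight -/
  weight_pos : ∀ e ∈ graph.edgeSet, 0 < weight e

namespace WGraph

/-- The length of a walk: the sum of the weights of its edges. -/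
def len {n : ℕ} (G : WGraph n) {u v : Fin n} (p : G.graph.Walk u v) : ℝ≥0 :=
  (p.edges.map G.weight).sum

/-- The distance `d_G(u,v)`; it is `⊤` if `u` and `v` are not connected. -/
def dist {n : ℕ} (G : WGraph n) (u v : Fin n) : ℝ≥0∞ :=
  ⨅ p : G.graph.Walk u v, (G.len p : ℝ≥0∞)

/-- The number of edges of `G` with both endpoints in `U`. -/
def inducedEdges {n : ℕ} (G : WGraph n) (U : Finset (Fin n)) : ℕ :=
  {e ∈ G.graph.edgeSet | ∀ x ∈ e, x ∈ U}.ncard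

/-- The arboricity `max_{|U| ≥ 2} |E(U)| / (|U| - 1)` (and `0` if there is no such `U`). -/
def arboricity {n : ℕ} (G : WGraph n) : ℝ≥0 :=
  (Finset.univ.filter (fun U : Finset (Fin n) => 2 ≤ U.card)).sup
    (fun U => (G.inducedEdges U : ℝ≥0) / ((U.card - 1 : ℕ) : ℝ≥0))

/-- The number of edges. -/
def numEdges {n : ℕ} (G : WGraph n) : ℕ := G.graph.edgeSet.ncard

/-- The degree of a vertex. -/
def deg {n : ℕ} (G : WGraph n) (v : Fin n) : ℕ := (G.graph.neighborSet v).ncard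

open Classical in
/-- The neighbours of `v`, in nondecreasing order of the weight of the connecting edge. -/
def adjList {n : ℕ} (G : WGraph n) (v : Fin n) : List (Fin n) :=
  ((List.finRange n).filter (fun y => decide (G.graph.Adj v y))).mergeSort
    (fun a b => decide (G.weight s(v, a) ≤ G.weight s(v, b)))

/-! ### A consistent choice of shortest paths

Ties between walks of equal length are broken by a secondary additive weight under which distinct
edge sets have distinct totals. Hence shortest paths become unique and any two chosen paths that
contain two common vertices share the whole subpath between them. -/

/-- The secondary weight of an edge. -/
def tieWeight {n : ℕ} (e : Sym2 (Fin n)) : ℕ := 2 ^ ((e.inf : ℕ) * n + (e.sup : ℕ))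

/-- The secondary weight of a walk. -/
def tieLen {n : ℕ} (G : WGraph n) {u v : Fin n} (p : G.graph.Walk u v) : ℕ :=
  (p.edges.map tieWeight).sum

/-- `p` is at most as long as `q`, ties being broken by the secondary weight. -/
def LexLE {n : ℕ} (G : WGraph n) {u v x y : Fin n}
    (p : G.graph.Walk u v) (q : G.graph.Walk x y) : Prop :=
  G.len p < G.len q ∨ (G.len p = G.len q ∧ G.tieLen p ≤ G.tieLen q)

open Classical in
/-- The chosen shortest path from `x` to `y`, as a list of vertices (empty if there is none). -/
def route {n : ℕ} (G : WGraph n) (x y : Fin n) : List (Fin n) :=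
  if hp : ∃ p : G.graph.Walk x y, ∀ q : G.graph.Walk x y, G.LexLE p q then
    hp.choose.support
  else []

/-- The distance from `v` to the nearest vertex of `S` (`⊤` if no vertex of `S` is reachable). -/
def radius {n : ℕ} (G : WGraph n) (S : Finset (Fin n)) (v : Fin n) : ℝ≥0∞ :=
  ⨅ x ∈ S, G.dist v x

/-- The `c`-fraction ball of `v` with respect to the landmark set `S`. -/
def fracBall {n : ℕ} (G : WGraph n) (c : ℝ≥0∞) (S : Finset (Fin n)) (v : Fin n) :
    Set (Fin n) :=
  {u | G.dist v u < c * G.radius S v}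

open Classical in
/-- What is recorded at `v` for the landmark set `S`: the closest landmark `ℓ` of `v`,
the distance from `v` to `ℓ`, and the vertex that follows `v` on the chosen shortest path to `ℓ`,
i.e. the parent of `v` in the shortest path tree rooted at `ℓ` (`v` itself if `v = ℓ`).
Nothing is recorded if no landmark is reachable. -/
def nearest {n : ℕ} (G : WGraph n) (S : Finset (Fin n)) (v : Fin n) :
    Option (Fin n × ℝ≥0 × Fin n) :=
  if hp : ∃ a : Σ x : Fin n, G.graph.Walk v x, a.1 ∈ S ∧
      ∀ b : Σ x : Fin n, G.graph.Walk v x, b.1 ∈ S → G.LexLE a.2 b.2 then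
    some (hp.choose.1, G.len hp.choose.2, hp.choose.2.snd)
  else none

end WGraph

/-! ## The machine

A query algorithm runs on a unit-cost machine whose words hold vertices, levels, or weights. It has
access to the stored data only through `Prog.read`, which looks up one record in a table (an array,
or a hash table with constant lookup time). Each `read` and each `tick` costs one time unit. In the
programs below every pass through a loop and every call of a recursive procedure executes at least
one `read` or `tick`, and between two of them only a bounded number of elementary operations on
words is carried out: addition and comparison of two words, creation or inspection of one node of a
linked list or tree, one access to a working table. Working tables are initially empty, and setting one
up takes constant time. -/

/-- The addresses of the records of an `h`-level oracle on `n` vertices. The element `i : Fin h`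
stands for level `i + 1`. -/
inductive Key (n h : ℕ) : Type
  | adj (v : Fin n) (k : ℕ)
  | near (i : Fin h) (v : Fin n)
  | pair (i : Fin h) (x y : Fin n)
  | home (i : Fin h) (v : Fin n)
  | branch (i : Fin h) (p q : Fin n × Fin n) (v : Fin n)

/-- The contents of the records:
* `adj v k`: the `k`-th neighbour of `v` in order of weight, and the weight of the edge to it;
* `near i v`: the closest landmark of `v`, its distance, the parent of `v` in the forest;
* `pair i x y`: the second and the last but one vertex of the path of the pair `(x, y)`;
* `home i v`: the name (i.e. pair) of the home path of `v` and the two neighbours of `v` on it;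
* `branch i p q v`: the predecessor and the successor of `v` on the path of `p` and on
  the path of `q`. -/
abbrev Key.Val {n h : ℕ} : Key n h → Type
  | .adj _ _ => Fin n × ℝ≥0
  | .near _ _ => Fin n × ℝ≥0 × Fin n
  | .pair _ _ _ => Fin n × Fin n
  | .home _ _ => (Fin n × Fin n) × Fin n × Fin n
  | .branch _ _ _ _ => (Option (Fin n) × Option (Fin n)) × Option (Fin n) × Option (Fin n)

/-- The content of the memory; `none` means that there is no record with this address. -/
abbrev Memory (n h : ℕ) : Type := (k : Key n h) → Option k.Val

/-- The number of words of a record, including the words of its address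
(one of which tells the table). -/
def Key.words {n h : ℕ} : Key n h → ℕ
  | .adj _ _ => 5
  | .near _ _ => 6
  | .pair _ _ _ => 6
  | .home _ _ => 7
  | .branch _ _ _ _ => 11

/-- The number of words that the record with address `k` occupies. -/
def Memory.wordsAt {n h : ℕ} (M : Memory n h) (k : Key n h) : ℕ :=
  if (M k).isSome then k.words else 0

/-- The number of words used by the oracle, not counting those that store the graph. -/
def Memory.space {n h : ℕ} (M : Memory n h) : ℕ :=
  ∑ i : Fin h,
    ((∑ v : Fin n, M.wordsAt (.near i v)) +
      (∑ x : Fin n, ∑ y : Fin n, M.wordsAt (.pair i x y)) +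
      (∑ v : Fin n, M.wordsAt (.home i v)) +
      ∑ p : Fin n × Fin n, ∑ q : Fin n × Fin n, ∑ v : Fin n, M.wordsAt (.branch i p q v))

/-- Programs with access to a memory. -/
inductive Prog (n h : ℕ) (α : Type) : Type
  | done (a : α) : Prog n h α
  | tick (p : Prog n h α) : Prog n h α
  | read (k : Key n h) (f : Option k.Val → Prog n h α) : Prog n h α

namespace Prog

/-- Sequential composition. -/
def bind {n h : ℕ} {α β : Type} : Prog n h α → (α → Prog n h β) → Prog n h β
  | .done a, g => g a
  | .tick p, g => .tick (bind p g)
  | .read k f, g => .read k (fun r => bind (f r) g)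

instance {n h : ℕ} : Monad (Prog n h) where
  pure := Prog.done
  bind := Prog.bind

/-- Look up one record. -/
def get {n h : ℕ} (k : Key n h) : Prog n h (Option k.Val) := .read k .done

/-- Spend one time unit. -/
def charge {n h : ℕ} : Prog n h Unit := .tick (.done ())

/-- The output of a program on a given memory. -/
def eval {n h : ℕ} {α : Type} (M : Memory n h) : Prog n h α → α
  | .done a => a
  | .tick p => eval M p
  | .read k f => eval M (f (M k))

/-- The running time of a program on a given memory. -/
def time {n h : ℕ} {α : Type} (M : Memory n h) : Prog n h α → ℕ
  | .done _ => 0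
  | .tick p => time M p + 1
  | .read k f => time M (f (M k)) + 1

end Prog

/-! ## The data stored by the oracle -/

/-- The vertex after `z` in the list `l` (without repetitions). -/
def succIn {n : ℕ} (l : List (Fin n)) (z : Fin n) : Option (Fin n) := l[l.idxOf z + 1]?

/-- The vertex before `z` in the list `l` (without repetitions). -/
def predIn {n : ℕ} (l : List (Fin n)) (z : Fin n) : Option (Fin n) := succIn l.reverse z

namespace WGraph

/-- The pairs of level-`i` landmarks for which the oracle stores shortest paths: on the top level
all pairs (of distinct vertices with a path between them), on the other levels the pairs such that
one vertex lies in the one-third-ball of the other one with respect to the landmarks of the next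
level. -/
def pairs {n h : ℕ} (G : WGraph n) (L : Fin h → Finset (Fin n)) (i : Fin h) :
    Set (Fin n × Fin n) :=
  {p | p.1 ≠ p.2 ∧ p.1 ∈ L i ∧ p.2 ∈ L i ∧
    if hi : (i : ℕ) + 1 < h then
      p.2 ∈ G.fracBall (1 / 3) (L ⟨i + 1, hi⟩) p.1 ∨ p.1 ∈ G.fracBall (1 / 3) (L ⟨i + 1, hi⟩) p.2
    else G.graph.Reachable p.1 p.2}

/-- The chosen paths of two pairs are distinct, contain `z`, and branch at `z`: the (unordered) set
of the predecessor and the successor of `z` is not the same on both paths. -/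
def IsBranching {n : ℕ} (G : WGraph n) (p q : Fin n × Fin n) (z : Fin n) : Prop :=
  G.route p.1 p.2 ≠ G.route q.1 q.2 ∧ z ∈ G.route p.1 p.2 ∧ z ∈ G.route q.1 q.2 ∧
    s(predIn (G.route p.1 p.2) z, succIn (G.route p.1 p.2) z) ≠
      s(predIn (G.route q.1 q.2) z, succIn (G.route q.1 q.2) z)

/-- `a` and `b` are the vertices before and after `z` on the chosen path of the pair `p`;
in particular `z` is an internal vertex of this path. -/
def IsInternal {n : ℕ} (G : WGraph n) (p : Fin n × Fin n) (z a b : Fin n) : Prop :=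
  predIn (G.route p.1 p.2) z = some a ∧ succIn (G.route p.1 p.2) z = some b

open Classical in
/-- The home path of `z` among the chosen paths of the pairs in `P`: some path that contains `z` as
an internal vertex, with the two neighbours of `z` on it. -/
def homePath {n : ℕ} (G : WGraph n) (P : Set (Fin n × Fin n)) (z : Fin n) :
    Option ((Fin n × Fin n) × Fin n × Fin n) :=
  if hr : ∃ r : (Fin n × Fin n) × Fin n × Fin n, r.1 ∈ P ∧ G.IsInternal r.1 z r.2.1 r.2.2 then
    some hr.choose
  else none

open Classical in
/-- The memory of the `h`-level oracle for the hierarchy `L` of landmark sets: the graph, for each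
level the forest of shortest path trees rooted at the landmarks, and for each level the
distance-preserving path-reporting oracle for the pairs of this level. -/
def oracle {n h : ℕ} (G : WGraph n) (L : Fin h → Finset (Fin n)) : Memory n h
  | .adj v k => (G.adjList v)[k]?.map (fun y => (y, G.weight s(v, y)))
  | .near i v => G.nearest (L i) v
  | .pair i x y =>
      if (x, y) ∈ G.pairs L i then
        (succIn (G.route x y) x).bind fun a => (predIn (G.route x y) y).map fun b => (a, b)
      else none
  | .home i v => G.homePath (G.pairs L i) v
  | .branch i p q v =>
      if p ∈ G.pairs L i ∧ q ∈ G.pairs L i ∧ G.IsBranching p q v then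
        some ((predIn (G.route p.1 p.2) v, succIn (G.route p.1 p.2) v),
          (predIn (G.route q.1 q.2) v, succIn (G.route q.1 q.2) v))
      else none

end WGraph

/-! ## The query algorithm

Loops carry a bound on the number of their passes as their first natural number argument; it is
large enough never to take effect. -/

/-! ### Dijkstra's algorithm with a leftist heap -/

/-- Leftist heaps. A node holds its rank, a key, a vertex and the vertex from which this one has
been reached. -/
inductive Heap (n : ℕ) : Type
  | nil : Heap n
  | node (rank : ℕ) (key : ℝ≥0) (v pre : Fin n) (l r : Heap n) : Heap n

namespace Heap

/-- The rank of a heap. -/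
def rank {n : ℕ} : Heap n → ℕ
  | .nil => 0
  | .node k _ _ _ _ _ => k

/-- The number of nodes; it is not used by the algorithm. -/
def size {n : ℕ} : Heap n → ℕ
  | .nil => 0
  | .node _ _ _ _ l r => l.size + r.size + 1

/-- Build a heap from a root and two subheaps; the subheap with the smaller rank goes right. -/
def make {n : ℕ} (key : ℝ≥0) (v pre : Fin n) (a b : Heap n) : Heap n :=
  if b.rank ≤ a.rank then .node (b.rank + 1) key v pre a b else .node (a.rank + 1) key v pre b a

/-- Merge two heaps. -/
def merge {n h : ℕ} : Heap n → Heap n → Prog n h (Heap n)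
  | .nil, b => do
      Prog.charge
      pure b
  | .node k x v p l r, .nil => do
      Prog.charge
      pure (.node k x v p l r)
  | .node k₁ x₁ v₁ p₁ l₁ r₁, .node k₂ x₂ v₂ p₂ l₂ r₂ => do
      Prog.charge
      if x₁ ≤ x₂ then
        let m ← merge r₁ (.node k₂ x₂ v₂ p₂ l₂ r₂)
        pure (make x₁ v₁ p₁ l₁ m)
      else
        let m ← merge (.node k₁ x₁ v₁ p₁ l₁ r₁) r₂
        pure (make x₂ v₂ p₂ l₂ m)
termination_by a b => a.size + b.size
decreasing_by
  all_goals simp only [size]; omega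

end Heap

/-- Whether the tentative distance `d` is outside of the open ball of radius `r`
(`none` stands for an infinite radius). -/
def outside (r : Option ℝ≥0) (d : ℝ≥0) : Bool :=
  match r with
  | none => false
  | some a => decide (a ≤ d)

/-- Relax the edges at `x`, a vertex at distance `d` from the source, in order of their weights,
until a tentative distance reaches `r`. -/
def relax {n h : ℕ} (r : Option ℝ≥0) (x : Fin n) (d : ℝ≥0) :
    ℕ → ℕ → Heap n → Prog n h (Heap n)
  | 0, _, H => pure H
  | f + 1, k, H => do
      match ← Prog.get (.adj x k) with
      | none => pure H
      | some (y, a) =>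
          if outside r (d + a) then pure H
          else
            let H' ← Heap.merge (.node 1 (d + a) y x .nil .nil) H
            relax r x d f (k + 1) H'

/-- The main loop of Dijkstra's algorithm, confined to the open ball of radius `r` around the
source. The working table `pre` holds the predecessors of the vertices discovered so far. The search
ends when the target `t` is discovered, or (with output `none`) when the ball is exhausted. -/
def dijkstra {n h : ℕ} (r : Option ℝ≥0) (t : Fin n) :
    ℕ → Heap n → (Fin n → Option (Fin n)) → Prog n h (Option (Fin n → Option (Fin n)))
  | 0, _, _ => pure none
  | f + 1, H, pre => do
      Prog.charge
      match H with
      | .nil => pure none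
      | .node _ d x p l r' =>
          let H₁ ← Heap.merge l r'
          if (pre x).isSome then dijkstra r t f H₁ pre
          else
            let pre' := Function.update pre x (some p)
            if x = t then pure (some pre')
            else
              let H₂ ← relax r x d n 0 H₁
              dijkstra r t f H₂ pre'

/-- Follow the predecessors from `x` to the source `s`, and put the path from `s` to `x` in front
of `acc`. -/
def trace {n h : ℕ} (pre : Fin n → Option (Fin n)) (s : Fin n) :
    ℕ → Fin n → List (Fin n) → Prog n h (List (Fin n))
  | 0, _, acc => pure acc
  | f + 1, x, acc => do
      Prog.charge
      if x = s then pure (x :: acc)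
      else
        match pre x with
        | none => pure acc
        | some y => trace pre s f y (x :: acc)

/-- Test whether `t` is in the open ball of radius `r` around `s`; if it is, return a shortest path
from `s` to `t`. -/
def explore {n h : ℕ} (r : Option ℝ≥0) (s t : Fin n) : Prog n h (Option (List (Fin n))) := do
  match ← dijkstra r t (n * n + 2) (.node 1 0 s s .nil .nil) (fun _ => none) with
  | none => pure none
  | some pre =>
      let q ← trace pre s (n + 1) t []
      pure (some q)

/-- Put the reversal of a list in front of another list. -/
def revOnto {n h : ℕ} : List (Fin n) → List (Fin n) → Prog n h (List (Fin n))
  | [], acc => do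
      Prog.charge
      pure acc
  | x :: l, acc => do
      Prog.charge
      revOnto l (x :: acc)

/-! ### Retrieval of stored paths -/

/-- Put the stored path from `v` to its closest level-`i` landmark, without the latter, in front of
the list that `rest` is. -/
def climbPath {n h : ℕ} (i : Fin h) : ℕ → Fin n → List (Fin n) → Prog n h (List (Fin n))
  | 0, _, rest => pure rest
  | f + 1, v, rest => do
      match ← Prog.get (.near i v) with
      | none => pure rest
      | some (l, _, parent) =>
          if v = l then pure rest
          else
            let q ← climbPath i f parent rest
            pure (v :: q)

/-- Put the reversal of the stored path from `v` to its closest level-`i` landmark, without the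
latter, in front of `acc`. -/
def descendPath {n h : ℕ} (i : Fin h) : ℕ → Fin n → List (Fin n) → Prog n h (List (Fin n))
  | 0, _, acc => pure acc
  | f + 1, v, acc => do
      match ← Prog.get (.near i v) with
      | none => pure acc
      | some (l, _, parent) =>
          if v = l then pure acc
          else descendPath i f parent (v :: acc)

/-- The loop of the distance-preserving oracle of level `i` on the query `(x, y)`: the path has been
followed up to the edge from `prev` to `cur`, and `b` is its last but one vertex. -/
def followPath {n h : ℕ} (i : Fin h) (x y b : Fin n) (rest : List (Fin n)) :
    ℕ → Fin n → Fin n → Prog n h (List (Fin n))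
  | 0, _, _ => pure rest
  | f + 1, prev, cur => do
      Prog.charge
      if cur = b then pure (cur :: y :: rest)
      else
        match ← Prog.get (.home i cur) with
        | none => pure rest
        | some (name, s, t) =>
            match ← Prog.get (.branch i name (x, y) cur) with
            | none =>
                let q ← followPath i x y b rest f cur (if s = prev then t else s)
                pure (cur :: q)
            | some (_, _, next) =>
                match next with
                | none => pure rest
                | some z =>
                    let q ← followPath i x y b rest f cur z
                    pure (cur :: q)

/-- Put the path of the distance-preserving oracle of level `i` for the pair `(x, y)` in front of
`rest`. -/
def pairPath {n h : ℕ} (i : Fin h) (x y : Fin n) (rest : List (Fin n)) :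
    Prog n h (List (Fin n)) := do
  match ← Prog.get (.pair i x y) with
  | none => pure rest
  | some (a, b) =>
      if x = b then pure (x :: y :: rest)
      else
        let q ← followPath i x y b rest n x a
        pure (x :: q)

/-! ### The query algorithm of the multi-level oracle -/

/-- Starting with landmarks `u`, `v` of level `i`, climb until the pair of landmarks is trivial or
one of the stored pairs. The list `js` contains the levels above `i`; the output is the list of those
that have been climbed, or `none` if the search fails (which happens only if `u` and `v` are not
connected). -/
def locate {n h : ℕ} (i : Fin h) (js : List (Fin h)) (u v : Fin n) :
    Prog n h (Option (List (Fin h))) := do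
  if u = v then
    Prog.charge
    pure (some [])
  else
    match ← Prog.get (.pair i u v) with
    | some _ => pure (some [])
    | none =>
        match js with
        | [] => pure none
        | j :: js' =>
            match ← Prog.get (.near j u), ← Prog.get (.near j v) with
            | some (u', _, _), some (v', _, _) =>
                match ← locate j js' u' v' with
                | none => pure none
                | some l => pure (some (j :: l))
            | _, _ => pure none

/-- Assemble the path that consists of the paths from `u` up through the levels in the given list,
the path that connects the two topmost landmarks, and the paths from there down to `v`; it is put in
front of `acc`. Here `i` is the level of `u` and `v`. -/
def report {n h : ℕ} (i : Fin h) : List (Fin h) → Fin n → Fin n → List (Fin n) →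
    Prog n h (List (Fin n))
  | [], u, v, acc => do
      Prog.charge
      if u = v then pure (u :: acc) else pairPath i u v acc
  | j :: js, u, v, acc => do
      match ← Prog.get (.near j u), ← Prog.get (.near j v) with
      | some (u', _, _), some (v', _, _) =>
          let acc' ← descendPath j (n + 1) v acc
          let q ← report j js u' v' acc'
          climbPath j (n + 1) u q
      | _, _ => pure acc

/-- The query algorithm: it returns a path from `u` to `v` as a list of vertices, or `none` if there
is no path. -/
def query {n h : ℕ} (u v : Fin n) : Prog n h (Option (List (Fin n))) := do
  Prog.charge
  if u = v then pure (some [u])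
  else
    match List.finRange h with
    | [] => pure none
    | i :: js =>
        let ru ← Prog.get (.near i u)
        let rv ← Prog.get (.near i v)
        match ← explore (ru.map (fun a => a.2.1)) u v with
        | some l => pure (some l)
        | none =>
            match ← explore (rv.map (fun a => a.2.1)) v u with
            | some l =>
                let l' ← revOnto l []
                pure (some l')
            | none =>
                match ru, rv with
                | some (u', _, _), some (v', _, _) =>
                    match ← locate i js u' v' with
                    | none => pure none
                    | some ls =>
                        let q ← report i (i :: ls) u v []
                        pure (some q)
                | _, _ => pure none

/-- The number of edges of the returned path (`0` if no path is returned). -/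
def hops {n : ℕ} (out : Option (List (Fin n))) : ℕ := (out.getD []).length - 1

/-! ## Sampling of the landmarks -/

/-- The two sampling rules: in the first one each vertex is a single virtual node, in the second one
the number of virtual nodes of a vertex depends on its degree. -/
inductive Rule : Type
  | uniform
  | byDegree

/-- The parameter `λ`: the arboricity for the first rule, and `m / n` for the second one. -/
def Rule.density (R : Rule) {n : ℕ} (G : WGraph n) : ℝ≥0 :=
  match R with
  | .uniform => G.arboricity
  | .byDegree => (G.numEdges : ℝ≥0) / (n : ℝ≥0)

/-- The number of virtual nodes of the vertex `v`: `1` for the first rule, `⌈deg(v) / λ⌉` for the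
second one. -/
def Rule.copies (R : Rule) {n : ℕ} (G : WGraph n) (v : Fin n) : ℕ :=
  match R with
  | .uniform => 1
  | .byDegree => ⌈(G.deg v : ℝ≥0) / Rule.byDegree.density G⌉₊

/-- `ρ_i = n ^ α_i` with `α_i = 1 - (3/4) ^ (h - i + 1)`, where `i : Fin h` stands for the level
`i + 1`. -/
def rho (n h : ℕ) (i : Fin h) : ℝ := (n : ℝ) ^ (1 - (3 / 4 : ℝ) ^ (h - (i : ℕ)))

theorem rho_div_mem (n h : ℕ) (i : Fin h) : rho n h i / n ∈ unitInterval := by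
  unfold rho
  refine ⟨by positivity, ?_⟩
  have h1 : (3 / 4 : ℝ) ^ (h - (i : ℕ)) ≤ 1 := pow_le_one₀ (by norm_num) (by norm_num)
  have h0 : 0 < (3 / 4 : ℝ) ^ (h - (i : ℕ)) := by positivity
  rcases Nat.eq_zero_or_pos n with rfl | hn
  · simp
  · have hn1 : (1 : ℝ) ≤ n := by exact_mod_cast hn
    rw [div_le_one (by positivity)]
    calc (n : ℝ) ^ (1 - (3 / 4 : ℝ) ^ (h - (i : ℕ))) ≤ (n : ℝ) ^ (1 : ℝ) :=
          Real.rpow_le_rpow_of_exponent_le hn1 (by linarith)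
      _ = n := Real.rpow_one _

/-- The sampling probability `ρ_i / n` of a virtual node. -/
def sampleProb (n h : ℕ) (i : Fin h) : unitInterval := ⟨rho n h i / n, rho_div_mem n h i⟩

/-- The virtual nodes. -/
abbrev VNode (R : Rule) {n : ℕ} (G : WGraph n) : Type := Σ v : Fin n, Fin (R.copies G v)

/-- The outcomes of the sampling: on each level, which virtual nodes are selected. -/
abbrev Sample (R : Rule) {n : ℕ} (G : WGraph n) (h : ℕ) : Type := Fin h → VNode R G → Bool

/-- The distribution of the sample: all selections are independent, and on level `i` each virtual
node is selected with probability `ρ_i / n`. -/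
def sampleMeasure (R : Rule) {n : ℕ} (G : WGraph n) (h : ℕ) : Measure (Sample R G h) :=
  Measure.pi fun i => Measure.pi fun _ =>
    ProbabilityTheory.bernoulliMeasure true false (sampleProb n h i)

open Classical in
/-- The landmarks of each level: the vertices with at least one selected virtual node. -/
def landmarks {R : Rule} {n : ℕ} {G : WGraph n} {h : ℕ} (ω : Sample R G h) (i : Fin h) :
    Finset (Fin n) :=
  Finset.univ.filter fun v => ∃ c : Fin (R.copies G v), ω i ⟨v, c⟩ = true

/-- The `h`-level oracle `Λ_h` for the outcome `ω` of the sampling. -/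
def Lambda {R : Rule} {n : ℕ} {G : WGraph n} {h : ℕ} (ω : Sample R G h) : Memory n h :=
  G.oracle (landmarks ω)

end

/-! Ties between equally long paths are broken by sums of distinct powers of two, so the
lexicographically least walk from a vertex to a set is a unique path (`IsMinTo.unique`).
Lexicographic length is additive, hence pieces of least walks are least: parent pointers lead to one
landmark, and two chosen paths share everything between two common vertices. This makes path
retrieval correct (`climbPath_spec`, `followPath_spec`).

Stretch. If a pair of landmarks at distance `d` is not stored on a level below the top, neither is
in the one-third-ball of the other, so both are within `3d` of their next landmarks, which are at
distance at most `7d`. With `k` levels above, the stretch `F k` thus satisfies `F 0 = 1`, `F (k + 1)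
= 7 F k + 6`, i.e. `F k = 2 * 7 ^ k - 1` (`locate_spec`). On the first level full balls are
searched, so that failure gives radii at most `d` and total stretch `3 F (h - 1) + 2`
(`query_spec`).

Space. Two chosen paths branch at no more than two vertices, so it suffices to count crossing stored
pairs. If two of them cross, the longer one has an endpoint `a` with all four endpoints within twice
its length, hence inside the full ball of `a` for the next level; the factor `1/3` is there for
this. So crossings are bounded by quadruples of landmarks with the last three in the ball of the
first (`card_crossing_le`). Let `p` and `q` be the sampling probabilities of the level and of the
next one. The ball size has a geometric tail with parameter `q`, independent of the level itself, so
that one virtual node accounts for `O(p ^ 4 / q ^ 3)` expected quadruples. The exponents are chosen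
such that `p ^ 4 = q ^ 3`, and there are at most `3n` virtual nodes. On the top level the expected
number of selected nodes is `O(n ^ (1/4))`, and all their quadruples number `O(n)` in expectation.

Time. A search confined to a ball inserts only edges inside the ball into its heap, at most `2λ` per
virtual node of the ball (`searchSize_le_density_mul`). With high probability every first-level ball
has `O(n ^ ((3/4) ^ h) log n)` virtual nodes, and a heap operation costs `O(log n)`. The remaining
work is proportional to the output length and the number of levels. -/

noncomputable section

/-! ### Output and running time of composed programs -/

namespace Prog

variable {n h : ℕ} {α β : Type} (M : Memory n h)

@[simp] theorem eval_pure (a : α) : (pure a : Prog n h α).eval M = a := rfl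

@[simp] theorem time_pure (a : α) : (pure a : Prog n h α).time M = 0 := rfl

-- The type of a record depends on its address; there is one pair of rules per table, with this type
-- written out.
@[simp] theorem eval_get_adj (v : Fin n) (k : ℕ) :
    eval (α := Option (Fin n × ℝ≥0)) M (get (.adj v k)) = M (.adj v k) := rfl

@[simp] theorem time_get_adj (v : Fin n) (k : ℕ) :
    time (α := Option (Fin n × ℝ≥0)) M (get (.adj v k)) = 1 := rfl

@[simp] theorem eval_get_near (i : Fin h) (v : Fin n) :
    eval (α := Option (Fin n × ℝ≥0 × Fin n)) M (get (.near i v)) = M (.near i v) := rfl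

@[simp] theorem time_get_near (i : Fin h) (v : Fin n) :
    time (α := Option (Fin n × ℝ≥0 × Fin n)) M (get (.near i v)) = 1 := rfl

@[simp] theorem eval_get_pair (i : Fin h) (x y : Fin n) :
    eval (α := Option (Fin n × Fin n)) M (get (.pair i x y)) = M (.pair i x y) := rfl

@[simp] theorem time_get_pair (i : Fin h) (x y : Fin n) :
    time (α := Option (Fin n × Fin n)) M (get (.pair i x y)) = 1 := rfl

@[simp] theorem eval_get_home (i : Fin h) (v : Fin n) :
    eval (α := Option ((Fin n × Fin n) × Fin n × Fin n)) M (get (.home i v)) = M (.home i v) := rfl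

@[simp] theorem time_get_home (i : Fin h) (v : Fin n) :
    time (α := Option ((Fin n × Fin n) × Fin n × Fin n)) M (get (.home i v)) = 1 := rfl

@[simp] theorem eval_get_branch (i : Fin h) (p q : Fin n × Fin n) (v : Fin n) :
    eval (α := Option ((Option (Fin n) × Option (Fin n)) × Option (Fin n) × Option (Fin n))) M (get (.branch i p q v)) = M (.branch i p q v) := rfl

@[simp] theorem time_get_branch (i : Fin h) (p q : Fin n × Fin n) (v : Fin n) :
    time (α := Option ((Option (Fin n) × Option (Fin n)) × Option (Fin n) × Option (Fin n))) M (get (.branch i p q v)) = 1 := rfl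

@[simp] theorem time_charge : (charge : Prog n h Unit).time M = 1 := rfl

@[simp] theorem eval_bind (p : Prog n h α) (g : α → Prog n h β) :
    (p >>= g).eval M = (g (p.eval M)).eval M := by
  change (Prog.bind p g).eval M = _
  induction p with
  | done a => rfl
  | tick p ih => exact ih
  | read k f ih => exact ih _

@[simp] theorem time_bind (p : Prog n h α) (g : α → Prog n h β) :
    (p >>= g).time M = p.time M + (g (p.eval M)).time M := by
  change (Prog.bind p g).time M = _
  induction p with
  | done a => simp [Prog.bind, Prog.time, Prog.eval]
  | tick p ih => simp only [Prog.bind, Prog.time, Prog.eval, ih]; omega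
  | read k f ih => simp only [Prog.bind, Prog.time, Prog.eval, ih]; omega

end Prog

/-! ### Leftist heaps: correctness and logarithmic cost of merging -/

namespace Heap

variable {n h : ℕ}

/-- The entries of a heap. -/
def entries : Heap n → Multiset (ℝ≥0 × Fin n × Fin n)
  | .nil => 0
  | .node _ x v p l r => (x, v, p) ::ₘ (l.entries + r.entries)

/-- Heap order together with the rank conditions of a leftist heap. -/
def WF : Heap n → Prop
  | .nil => True
  | .node k x _ _ l r => l.WF ∧ r.WF ∧ r.rank ≤ l.rank ∧ k = r.rank + 1 ∧
      ∀ e ∈ l.entries + r.entries, x ≤ e.1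

theorem rank_node (k : ℕ) (x : ℝ≥0) (v p : Fin n) (l r : Heap n) : (node k x v p l r).rank = k :=
  rfl

theorem card_entries (a : Heap n) : a.entries.card = a.size := by
  induction a with
  | nil => rfl
  | node k x v p l r hl hr => simp [entries, size, hl, hr]

/-- Both subheaps have rank at least that of the right one, which is one less than the rank of the
node; so the bound doubles at every node. -/
theorem WF.two_pow_rank_le {a : Heap n} (ha : a.WF) : 2 ^ a.rank ≤ a.size + 1 := by
  induction a with
  | nil => simp [rank, size]
  | node k x v p l r hl hr =>
    obtain ⟨h1, h2, h3, h4, -⟩ := ha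
    have := hl h1
    have := hr h2
    have := Nat.pow_le_pow_right (show 0 < 2 by norm_num) h3
    simp only [rank_node, size, h4, pow_succ]
    omega

theorem WF.rank_le_log {a : Heap n} (ha : a.WF) : a.rank ≤ Nat.log 2 (a.size + 1) :=
  Nat.le_log_of_pow_le (by norm_num) ha.two_pow_rank_le

theorem entries_make (x : ℝ≥0) (v p : Fin n) (a b : Heap n) :
    (make x v p a b).entries = (x, v, p) ::ₘ (a.entries + b.entries) := by
  unfold make
  split_ifs <;> simp [entries, add_comm]

theorem WF.make {a b : Heap n} (ha : a.WF) (hb : b.WF) {x : ℝ≥0} (v p : Fin n)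
    (h : ∀ e ∈ a.entries + b.entries, x ≤ e.1) : (make x v p a b).WF := by
  unfold Heap.make
  split_ifs with hr
  · exact ⟨ha, hb, hr, rfl, h⟩
  · exact ⟨hb, ha, by omega, rfl, by rwa [add_comm]⟩

/-- Every recursive call descends one step along a right spine and so lowers one of the two ranks by
one. -/
theorem merge_spec (M : Memory n h) (a b : Heap n) (ha : a.WF) (hb : b.WF) :
    ((merge a b : Prog n h _).eval M).entries = a.entries + b.entries ∧
      ((merge a b : Prog n h _).eval M).WF ∧
      (merge a b : Prog n h _).time M ≤ a.rank + b.rank + 1 := by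
  induction a, b using merge.induct with
  | case1 b => simp [merge, entries, hb]
  | case2 k x v p l r => simp [merge, entries, ha]
  | case3 k₁ x₁ v₁ p₁ l₁ r₁ k₂ x₂ v₂ p₂ l₂ r₂ ih₁ ih₂ =>
    rw [merge]
    by_cases hx : x₁ ≤ x₂
    · obtain ⟨e, w, t⟩ := ih₁ ha.2.1 hb
      simp only [Prog.eval_bind, Prog.time_bind, if_pos hx, Prog.eval_pure, Prog.time_pure,
        Prog.time_charge, entries_make, e]
      refine ⟨by simp only [entries, Multiset.cons_add, add_assoc], WF.make ha.1 w _ _ ?_, ?_⟩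
      · have h1 := ha.2.2.2.2
        have h2 := hb.2.2.2.2
        intro f hf
        rw [e] at hf
        simp only [entries, Multiset.mem_add, Multiset.mem_cons] at hf h1 h2
        rcases hf with hf | hf | rfl | hf
        · exact h1 _ (Or.inl hf)
        · exact h1 _ (Or.inr hf)
        · exact hx
        · exact hx.trans (h2 _ hf)
      · have := ha.2.2.2.1
        simp only [rank_node] at t ⊢
        omega
    · obtain ⟨e, w, t⟩ := ih₂ ha hb.2.1
      simp only [Prog.eval_bind, Prog.time_bind, if_neg hx, Prog.eval_pure, Prog.time_pure,
        Prog.time_charge, entries_make, e]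
      refine ⟨?_, WF.make hb.1 w _ _ ?_, ?_⟩
      · simp only [entries, ← Multiset.singleton_add]
        abel
      · have h1 := ha.2.2.2.2
        have h2 := hb.2.2.2.2
        have hx' := (not_le.1 hx).le
        intro f hf
        rw [e] at hf
        simp only [entries, Multiset.mem_add, Multiset.mem_cons] at hf h1 h2
        rcases hf with hf | (rfl | hf) | hf
        · exact h2 _ (Or.inl hf)
        · exact hx'
        · exact hx'.trans (h1 _ hf)
        · exact h2 _ (Or.inr hf)
      · have := hb.2.2.2.1
        simp only [rank_node] at t ⊢
        omega

/-- The time of merging two heaps with at most `N` nodes in total. -/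
def mergeBound (N : ℕ) : ℕ := 2 * Nat.log 2 (N + 1) + 1

theorem merge_time_le (M : Memory n h) {a b : Heap n} (ha : a.WF) (hb : b.WF) {N : ℕ}
    (hN : a.entries.card + b.entries.card ≤ N) :
    (merge a b : Prog n h _).time M ≤ mergeBound N := by
  rw [card_entries, card_entries] at hN
  have h1 := ha.rank_le_log.trans (Nat.log_mono_right (b := 2) (show a.size + 1 ≤ N + 1 by omega))
  have h2 := hb.rank_le_log.trans (Nat.log_mono_right (b := 2) (show b.size + 1 ≤ N + 1 by omega))
  have := (merge_spec M a b ha hb).2.2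
  unfold mergeBound
  omega

theorem wf_singleton (x : ℝ≥0) (v p : Fin n) : (node 1 x v p nil nil).WF := by
  simp [WF, rank, entries]

end Heap

/-! ### Lexicographically least walks and their uniqueness -/

open SimpleGraph in
/-- Two paths that start at the same vertex and have the same edges are equal. -/
theorem sigma_eq_of_edges {V : Type*} {H : SimpleGraph V} {v x y : V}
    (p : H.Walk v x) (q : H.Walk v y) (hp : p.IsPath) (hq : q.IsPath)
    (h : ∀ e, e ∈ p.edges ↔ e ∈ q.edges) :
    (⟨x, p⟩ : Σ x, H.Walk v x) = ⟨y, q⟩ := by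
  induction p generalizing y with
  | nil =>
    cases q with
    | nil => rfl
    | cons hq' q => exact absurd ((h _).2 List.mem_cons_self) List.not_mem_nil
  | @cons a b c hab p ih =>
    cases q with
    | nil => exact absurd ((h _).1 List.mem_cons_self) List.not_mem_nil
    | @cons _ d _ had q =>
      have hp' := (Walk.cons_isPath_iff _ _).1 hp
      have hq' := (Walk.cons_isPath_iff _ _).1 hq
      -- The edge `s(a, b)` occurs on `q`; it must be its first edge, since otherwise the path `q`
      -- would return to `a`.
      have hbd : b = d := by
        have h1 := (h s(a, b)).1 (by simp)
        simp only [Walk.edges_cons, List.mem_cons] at h1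
        rcases h1 with h1 | h1
        · rcases Sym2.eq_iff.1 h1 with h1 | h1
          · exact h1.2
          · exact (had.ne h1.1).elim
        · exact (hq'.2 (Walk.fst_mem_support_of_mem_edges _ h1)).elim
      subst hbd
      have := ih q hp'.1 hq'.1 (fun e => by
        have := h e
        simp only [Walk.edges_cons, List.mem_cons] at this
        by_cases he : e = s(a, b)
        · subst he
          exact ⟨fun h1 => (hp'.2 (Walk.fst_mem_support_of_mem_edges _ h1)).elim,
            fun h1 => (hq'.2 (Walk.fst_mem_support_of_mem_edges _ h1)).elim⟩
        · simpa [he] using this)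
      cases this
      rfl

theorem List.Sublist.sum_lt_sum_of_pos {l₁ l₂ : List ℝ≥0} (h : l₁.Sublist l₂)
    (hlen : l₁.length < l₂.length) (hpos : ∀ x ∈ l₂, 0 < x) : l₁.sum < l₂.sum := by
  induction h with
  | slnil => simp at hlen
  | @cons l₁ l₂ a h ih =>
    rw [List.sum_cons]
    calc l₁.sum ≤ l₂.sum := h.sum_le_sum (fun _ _ => zero_le)
      _ < a + l₂.sum := lt_add_of_pos_left _ (hpos a (by simp))
  | @cons_cons l₁ l₂ a h ih =>
    rw [List.sum_cons, List.sum_cons]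
    exact add_lt_add_of_le_of_lt le_rfl
      (ih (by simpa using hlen) fun x hx => hpos x (List.mem_cons_of_mem _ hx))

namespace WGraph

open SimpleGraph

variable {n : ℕ} (G : WGraph n) {u v w x y z : Fin n}

@[simp] theorem len_nil : G.len (Walk.nil : G.graph.Walk u u) = 0 := rfl

@[simp] theorem len_cons (h : G.graph.Adj u v) (p : G.graph.Walk v w) :
    G.len (Walk.cons h p) = G.weight s(u, v) + G.len p := rfl

@[simp] theorem len_append (p : G.graph.Walk u v) (q : G.graph.Walk v w) :
    G.len (p.append q) = G.len p + G.len q := by simp [len]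

@[simp] theorem len_reverse (p : G.graph.Walk u v) : G.len p.reverse = G.len p := by
  simp [len]

@[simp] theorem tieLen_append (p : G.graph.Walk u v) (q : G.graph.Walk v w) :
    G.tieLen (p.append q) = G.tieLen p + G.tieLen q := by simp [tieLen]

@[simp] theorem tieLen_reverse (p : G.graph.Walk u v) : G.tieLen p.reverse = G.tieLen p := by
  simp [tieLen]

theorem LexLE.len_le {G : WGraph n} {p : G.graph.Walk u v} {q : G.graph.Walk x y}
    (h : G.LexLE p q) : G.len p ≤ G.len q := h.elim le_of_lt fun h => h.1.le

theorem lexLE_iff (p : G.graph.Walk u v) (q : G.graph.Walk x y) :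
    G.LexLE p q ↔ toLex (G.len p, G.tieLen p) ≤ toLex (G.len q, G.tieLen q) := by
  rw [Prod.Lex.toLex_le_toLex]
  rfl

theorem LexLE.trans {G : WGraph n} {a b c d e f : Fin n} {p : G.graph.Walk a b}
    {q : G.graph.Walk c d} {r : G.graph.Walk e f} (h : G.LexLE p q) (h' : G.LexLE q r) :
    G.LexLE p r := by
  rw [lexLE_iff] at *
  exact h.trans h'

theorem lexLE_bypass (p : G.graph.Walk u v) : G.LexLE p.bypass p := by
  have h := p.edges_bypass_sublist_edges
  have h1 : G.len p.bypass ≤ G.len p := (h.map G.weight).sum_le_sum (fun _ _ => zero_le)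
  have h2 : G.tieLen p.bypass ≤ G.tieLen p := (h.map tieWeight).sum_le_sum (fun _ _ => Nat.zero_le _)
  rcases h1.lt_or_eq with h1 | h1
  · exact Or.inl h1
  · exact Or.inr ⟨h1, h2⟩

/-- `p` is the chosen shortest walk from its first vertex to the set `S`. -/
def IsMinTo (S : Set (Fin n)) {v x : Fin n} (p : G.graph.Walk v x) : Prop :=
  x ∈ S ∧ ∀ (y : Fin n) (q : G.graph.Walk v y), y ∈ S → G.LexLE p q

/-- Cutting out cycles does not increase either component of the length, so it suffices to minimise
over paths, of which there are finitely many. -/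
theorem exists_isMinTo {S : Set (Fin n)} (hx : x ∈ S) (h : G.graph.Reachable v x) :
    ∃ (y : Fin n) (p : G.graph.Walk v y), G.IsMinTo S p := by
  classical
  obtain ⟨w⟩ := h
  have : Nonempty {a : Σ y, G.graph.Path v y // a.1 ∈ S} := ⟨⟨⟨x, w.toPath⟩, hx⟩⟩
  obtain ⟨⟨⟨y, p⟩, hy⟩, hmin⟩ := Finite.exists_min
    (fun a : {a : Σ y, G.graph.Path v y // a.1 ∈ S} =>
      toLex (G.len (a.1.2 : G.graph.Walk v a.1.1), G.tieLen (a.1.2 : G.graph.Walk v a.1.1)))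
  refine ⟨y, p, hy, fun z q hz => ?_⟩
  refine LexLE.trans ?_ (G.lexLE_bypass q)
  rw [lexLE_iff]
  exact hmin ⟨⟨z, q.toPath⟩, hz⟩

variable {G}

/-- Weights are positive, so cutting out a cycle would make the walk strictly shorter. -/
theorem IsMinTo.isPath {S : Set (Fin n)} {p : G.graph.Walk v x} (h : G.IsMinTo S p) :
    p.IsPath := by
  by_contra hp
  have hlt : p.bypass.length < p.length := by
    by_contra hlt
    exact hp (p.bypass_eq_self_of_length_le_length_bypass (not_lt.1 hlt) ▸ p.bypass_isPath)
  have h1 : G.len p.bypass < G.len p :=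
    (p.edges_bypass_sublist_edges.map G.weight).sum_lt_sum_of_pos (by simpa using hlt) (by
      simp only [List.mem_map]
      rintro _ ⟨e, he, rfl⟩
      exact G.weight_pos e (p.edges_subset_edgeSet he))
  exact absurd (h.2 _ p.bypass h.1).len_le (not_le.2 h1)

/-- The exponent in the secondary weight. -/
def tieIndex (e : Sym2 (Fin n)) : ℕ := (e.inf : ℕ) * n + (e.sup : ℕ)

theorem tieIndex_injective : Function.Injective (tieIndex (n := n)) := by
  intro e f h
  have he : (e.sup : ℕ) < n := e.sup.2
  have hf : (f.sup : ℕ) < n := f.sup.2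
  unfold tieIndex at h
  have hn : 0 < n := by omega
  have h1 : (e.sup : ℕ) = f.sup := by
    have := congrArg (· % n) h
    simpa [Nat.add_mod, Nat.mod_eq_of_lt he, Nat.mod_eq_of_lt hf] using this
  have h2 : (e.inf : ℕ) = f.inf := by
    rw [h1] at h
    exact Nat.eq_of_mul_eq_mul_right hn (Nat.add_right_cancel h)
  exact (Sym2.inf_eq_inf_and_sup_eq_sup).1 ⟨Fin.ext h2, Fin.ext h1⟩

/-- The secondary length of a path is a sum of distinct powers of two, whose binary expansion
determines the set of edges. -/
theorem mem_edges_iff_of_tieLen_eq {p : G.graph.Walk v x} {q : G.graph.Walk w y}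
    (hp : p.IsPath) (hq : q.IsPath) (h : G.tieLen p = G.tieLen q) (e : Sym2 (Fin n)) :
    e ∈ p.edges ↔ e ∈ q.edges := by
  have key : ∀ {a b : Fin n} (r : G.graph.Walk a b), r.IsPath →
      G.tieLen r = ∑ i ∈ r.edges.toFinset.image tieIndex, 2 ^ i := by
    intro a b r hr
    rw [Finset.sum_image (fun _ _ _ _ h => tieIndex_injective h),
      List.sum_toFinset _ hr.isTrail.edges_nodup]
    rfl
  rw [key p hp, key q hq] at h
  have h1 := Finset.geomSum_injective (n := 2) le_rfl h
  have h2 := Finset.image_injective tieIndex_injective h1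
  rw [← List.mem_toFinset, h2, List.mem_toFinset]

/-- Two least walks have the same secondary length, hence the same edges, and a path is determined
by its start and its edges. For a set of landmarks this also makes the nearest landmark unique. -/
theorem IsMinTo.unique {S : Set (Fin n)} {p : G.graph.Walk v x} {q : G.graph.Walk v y}
    (hp : G.IsMinTo S p) (hq : G.IsMinTo S q) :
    (⟨x, p⟩ : Σ x, G.graph.Walk v x) = ⟨y, q⟩ := by
  refine sigma_eq_of_edges p q hp.isPath hq.isPath
    (mem_edges_iff_of_tieLen_eq hp.isPath hq.isPath ?_)
  have h1 := hp.2 _ q hq.1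
  have h2 := hq.2 _ p hp.1
  rw [lexLE_iff] at h1 h2
  have := le_antisymm h1 h2
  exact (Prod.ext_iff.1 (toLex.injective this)).2

theorem isMinTo_singleton_iff {p : G.graph.Walk x y} :
    G.IsMinTo {y} p ↔ ∀ q : G.graph.Walk x y, G.LexLE p q := by
  constructor
  · exact fun h q => h.2 _ q rfl
  · refine fun h => ⟨rfl, fun z q hz => ?_⟩
    cases hz
    exact h q

/-- Both components of the length are additive, so a better suffix would improve the whole walk.
This works for any target set, whereas prefixes below need a fixed endpoint. -/
theorem IsMinTo.of_append {S : Set (Fin n)} {p : G.graph.Walk v w} {q : G.graph.Walk w x}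
    (h : G.IsMinTo S (p.append q)) : G.IsMinTo S q := by
  refine ⟨h.1, fun y r hy => ?_⟩
  have := h.2 y (p.append r) hy
  simpa [LexLE] using this

theorem IsMinTo.of_cons {S : Set (Fin n)} {hvw : G.graph.Adj v w} {q : G.graph.Walk w x}
    (h : G.IsMinTo S (Walk.cons hvw q)) : G.IsMinTo S q :=
  IsMinTo.of_append (p := Walk.cons hvw .nil) h

theorem IsMinTo.append_left {p : G.graph.Walk v w} {q : G.graph.Walk w x}
    (h : G.IsMinTo {x} (p.append q)) : G.IsMinTo {w} p := by
  rw [isMinTo_singleton_iff] at *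
  intro r
  have := h (r.append q)
  simpa [LexLE] using this

theorem IsMinTo.reverse {p : G.graph.Walk x y} (h : G.IsMinTo {y} p) :
    G.IsMinTo {x} p.reverse := by
  rw [isMinTo_singleton_iff] at *
  intro r
  have := h r.reverse
  simpa [LexLE] using this

/-! ### Distances -/

theorem dist_le_len (p : G.graph.Walk u v) : G.dist u v ≤ G.len p := iInf_le _ p

theorem IsMinTo.dist_eq {S : Set (Fin n)} {p : G.graph.Walk v x} (h : G.IsMinTo S p) :
    G.dist v x = G.len p :=
  le_antisymm (dist_le_len p) (le_iInf fun q => by exact_mod_cast (h.2 x q h.1).len_le)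

theorem exists_isMinTo_singleton (h : G.graph.Reachable u v) :
    ∃ p : G.graph.Walk u v, G.IsMinTo {v} p := by
  obtain ⟨y, p, hp⟩ := G.exists_isMinTo (S := {v}) rfl h
  cases hp.1
  exact ⟨p, hp⟩

theorem dist_ne_top_iff : G.dist u v ≠ ⊤ ↔ G.graph.Reachable u v := by
  constructor
  · intro h
    by_contra hr
    have : IsEmpty (G.graph.Walk u v) := not_nonempty_iff.1 hr
    exact h (by simp [dist])
  · rintro ⟨p⟩
    exact ((dist_le_len p).trans_lt ENNReal.coe_lt_top).ne

theorem exists_len_eq_dist (h : G.graph.Reachable u v) :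
    ∃ p : G.graph.Walk u v, G.dist u v = G.len p := by
  obtain ⟨p, hp⟩ := exists_isMinTo_singleton h
  exact ⟨p, hp.dist_eq⟩

variable (G) in
theorem dist_comm (u v : Fin n) : G.dist u v = G.dist v u := by
  have : ∀ a b : Fin n, G.dist a b ≤ G.dist b a := fun a b => le_iInf fun p => by
    simpa using dist_le_len p.reverse
  exact le_antisymm (this u v) (this v u)

variable (G) in
@[simp] theorem dist_self (u : Fin n) : G.dist u u = 0 := by
  simpa using dist_le_len (Walk.nil : G.graph.Walk u u)

variable (G) in
theorem dist_triangle (u v w : Fin n) : G.dist u w ≤ G.dist u v + G.dist v w := by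
  by_cases h1 : G.graph.Reachable u v
  swap
  · rw [(not_iff_comm.1 dist_ne_top_iff).1 h1]; simp
  by_cases h2 : G.graph.Reachable v w
  swap
  · rw [(not_iff_comm.1 dist_ne_top_iff).1 h2]; simp
  obtain ⟨p, hp⟩ := exists_len_eq_dist h1
  obtain ⟨q, hq⟩ := exists_len_eq_dist h2
  rw [hp, hq]
  simpa using dist_le_len (p.append q)

theorem dist_le_of_adj (h : G.graph.Adj u v) : G.dist u v ≤ G.weight s(u, v) := by
  simpa using dist_le_len (Walk.cons h .nil)

theorem IsMinTo.radius_eq {S : Finset (Fin n)} {p : G.graph.Walk v x}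
    (h : G.IsMinTo (S : Set (Fin n)) p) : G.radius S v = G.len p := by
  apply le_antisymm
  · exact (iInf₂_le x h.1).trans (dist_le_len p)
  · refine le_iInf₂ fun y hy => le_iInf fun q => ?_
    exact_mod_cast (h.2 y q hy).len_le

theorem exists_isMinTo_of_radius_ne_top {S : Finset (Fin n)} (h : G.radius S v ≠ ⊤) :
    ∃ (x : Fin n) (p : G.graph.Walk v x), G.IsMinTo (S : Set (Fin n)) p := by
  have : ∃ x ∈ S, G.dist v x ≠ ⊤ := by
    by_contra! hc
    exact h (by simp only [radius, iInf_eq_top]; exact hc)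
  obtain ⟨x, hx, hr⟩ := this
  exact G.exists_isMinTo (S := (S : Set (Fin n))) hx (dist_ne_top_iff.1 hr)

/-! ### Chosen paths and the data stored about them -/

theorem IsMinTo.route_eq {p : G.graph.Walk x y} (h : G.IsMinTo {y} p) :
    G.route x y = p.support := by
  have hp := isMinTo_singleton_iff.1 h
  have hex : ∃ p : G.graph.Walk x y, ∀ q : G.graph.Walk x y, G.LexLE p q := ⟨p, hp⟩
  have := IsMinTo.unique h (isMinTo_singleton_iff.2 hex.choose_spec)
  rw [route, dif_pos hex]
  cases (Sigma.mk.inj_iff.1 this).2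
  rfl

theorem exists_route_eq (h : G.graph.Reachable x y) :
    ∃ p : G.graph.Walk x y, G.IsMinTo {y} p ∧ G.route x y = p.support := by
  obtain ⟨p, hp⟩ := exists_isMinTo_singleton h
  exact ⟨p, hp, hp.route_eq⟩

theorem route_eq_nil (h : ¬ G.graph.Reachable x y) : G.route x y = [] := by
  rw [route, dif_neg]
  rintro ⟨p, -⟩
  exact h ⟨p⟩

theorem nodup_route : (G.route x y).Nodup := by
  by_cases h : G.graph.Reachable x y
  · obtain ⟨p, hp, hr⟩ := exists_route_eq h
    rw [hr]
    exact hp.isPath.support_nodup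
  · rw [route_eq_nil h]
    exact List.nodup_nil

theorem IsMinTo.nearest_eq {S : Finset (Fin n)} {p : G.graph.Walk v x}
    (h : G.IsMinTo (S : Set (Fin n)) p) : G.nearest S v = some (x, G.len p, p.snd) := by
  have hex : ∃ a : Σ x : Fin n, G.graph.Walk v x, a.1 ∈ S ∧
      ∀ b : Σ x : Fin n, G.graph.Walk v x, b.1 ∈ S → G.LexLE a.2 b.2 :=
    ⟨⟨x, p⟩, h.1, fun b hb => h.2 _ b.2 hb⟩
  have hm : G.IsMinTo (S : Set (Fin n)) hex.choose.2 :=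
    ⟨hex.choose_spec.1, fun y q hy => hex.choose_spec.2 ⟨y, q⟩ hy⟩
  have := IsMinTo.unique h hm
  rw [nearest, dif_pos hex]
  exact congrArg (fun a : Σ x : Fin n, G.graph.Walk v x => some (a.1, G.len a.2, a.2.snd)) this.symm

theorem nearest_cases (G : WGraph n) (S : Finset (Fin n)) (v : Fin n) :
    (∃ (x : Fin n) (p : G.graph.Walk v x), G.IsMinTo (S : Set (Fin n)) p) ∨
      (G.nearest S v = none ∧ G.radius S v = ⊤) := by
  by_cases hr : G.radius S v = ⊤
  · right
    refine ⟨?_, hr⟩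
    rw [nearest, dif_neg]
    rintro ⟨⟨x, p⟩, hx, -⟩
    exact absurd hr (((iInf₂_le x hx).trans (dist_le_len p)).trans_lt ENNReal.coe_lt_top).ne
  · exact Or.inl (exists_isMinTo_of_radius_ne_top hr)

/-- Any two vertices of a chosen path are joined by the chosen path between them, traversed in one
of the two directions. -/
theorem IsMinTo.route_infix {p : G.graph.Walk x y} (hp : G.IsMinTo {y} p)
    (hu : u ∈ p.support) (hv : v ∈ p.support) :
    G.route u v <:+: p.support ∨ (G.route u v).reverse <:+: p.support := by
  rw [← p.take_spec hu] at hp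
  rw [← p.take_spec hu, Walk.mem_support_append_iff] at hv
  rcases hv with hv | hv
  · right
    have h1 := hp.append_left
    rw [← (p.takeUntil u hu).take_spec hv] at h1
    have h2 := h1.of_append.reverse
    rw [h2.route_eq, Walk.support_reverse, List.reverse_reverse]
    exact ((Walk.support_dropUntil_suffix_support _ hv).isInfix).trans
      (Walk.support_takeUntil_prefix_support _ hu).isInfix
  · left
    have h1 := hp.of_append
    rw [← (p.dropUntil u hu).take_spec hv] at h1
    rw [h1.append_left.route_eq]
    exact ((Walk.support_takeUntil_prefix_support _ hv).isInfix).trans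
      (Walk.support_dropUntil_suffix_support _ hu).isInfix

end WGraph

/-! ### Dijkstra's algorithm confined to a ball -/

theorem List.takeWhile_eq_filter_of_pairwise {α : Type*} {R : α → α → Prop} {p : α → Bool}
    {l : List α} (hl : l.Pairwise R) (h : ∀ a b, R a b → p b = true → p a = true) :
    l.takeWhile p = l.filter p := by
  induction l with
  | nil => rfl
  | cons a l ih =>
    rw [List.pairwise_cons] at hl
    by_cases ha : p a = true
    · rw [List.takeWhile_cons_of_pos ha, List.filter_cons_of_pos ha, ih hl.2]
    · rw [List.takeWhile_cons_of_neg ha, List.filter_cons_of_neg ha, eq_comm,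
        List.filter_eq_nil_iff]
      exact fun b hb hpb => ha (h a b (hl.1 b hb) hpb)

theorem outside_mono {r : Option ℝ≥0} {a b : ℝ≥0} (hab : a ≤ b) (h : outside r b = false) :
    outside r a = false := by
  cases r with
  | none => rfl
  | some c =>
    simp only [outside, decide_eq_false_iff_not, not_le] at h ⊢
    exact hab.trans_lt h

theorem exists_of_outside {r : Option ℝ≥0} {a : ℝ≥0} (h : outside r a = true) :
    ∃ c, r = some c ∧ c ≤ a := by
  cases r with
  | none => simp [outside] at h
  | some c => exact ⟨c, rfl, by simpa [outside] using h⟩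

namespace WGraph

open SimpleGraph

variable {n h : ℕ} (G : WGraph n)

theorem mem_adjList {x y : Fin n} : y ∈ G.adjList x ↔ G.graph.Adj x y := by
  simp [adjList]

theorem nodup_adjList (x : Fin n) : (G.adjList x).Nodup := by
  unfold adjList
  rw [(List.mergeSort_perm _ _).nodup_iff]
  exact (List.nodup_finRange n).filter _

theorem length_adjList_le (x : Fin n) : (G.adjList x).length ≤ n := by
  simpa using (G.nodup_adjList x).length_le_card

theorem pairwise_adjList (x : Fin n) :
    (G.adjList x).Pairwise (fun a b => G.weight s(x, a) ≤ G.weight s(x, b)) := by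
  have := List.pairwise_mergeSort
    (le := fun a b : Fin n => decide (G.weight s(x, a) ≤ G.weight s(x, b)))
    (fun a b c h1 h2 => by simp only [decide_eq_true_eq] at *; exact h1.trans h2)
    (fun a b => by simpa using le_total _ _)
    ((List.finRange n).filter (fun y => @decide (G.graph.Adj x y) (Classical.propDecidable _)))
  unfold adjList
  simpa using this

/-- The neighbours that are inserted into the heap when `x` is settled at distance `d`. -/
def relaxed (r : Option ℝ≥0) (x : Fin n) (d : ℝ≥0) : List (Fin n) :=
  (G.adjList x).takeWhile (fun y => !outside r (d + G.weight s(x, y)))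

theorem mem_relaxed {r : Option ℝ≥0} {x y : Fin n} {d : ℝ≥0} :
    y ∈ G.relaxed r x d ↔ G.graph.Adj x y ∧ outside r (d + G.weight s(x, y)) = false := by
  unfold relaxed
  rw [List.takeWhile_eq_filter_of_pairwise (G.pairwise_adjList x), List.mem_filter, mem_adjList]
  · simp
  · intro a b hab hb
    simp only [Bool.not_eq_true'] at hb ⊢
    exact outside_mono (by gcongr) hb

theorem nodup_relaxed {r : Option ℝ≥0} {x : Fin n} {d : ℝ≥0} : (G.relaxed r x d).Nodup :=
  (G.nodup_adjList x).sublist (List.takeWhile_sublist _)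

/-- `P` is what is still to be inserted and `N` bounds the heap size throughout. Each element of `P`
costs one read and one merge; the last summand pays for the read that ends the loop. -/
theorem relax_spec (L : Fin h → Finset (Fin n)) (r : Option ℝ≥0) (x : Fin n) (d : ℝ≥0) (N : ℕ)
    (f k : ℕ) (H : Heap n) (hH : H.WF) (hf : (G.adjList x).length ≤ k + f) (P : List (Fin n))
    (hP : P = ((G.adjList x).drop k).takeWhile (fun y => !outside r (d + G.weight s(x, y))))
    (hN : H.entries.card + P.length ≤ N) :
    ((relax r x d f k H : Prog n h _).eval (G.oracle L)).entries =
        H.entries + ((P.map fun y => (d + G.weight s(x, y), y, x) : List _) : Multiset _) ∧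
      ((relax r x d f k H : Prog n h _).eval (G.oracle L)).WF ∧
      (relax r x d f k H : Prog n h _).time (G.oracle L) ≤
        P.length * (1 + Heap.mergeBound N) + 1 := by
  induction f generalizing k H P with
  | zero =>
    rw [List.drop_eq_nil_of_le (by simpa using hf)] at hP
    subst hP
    simp [relax, hH]
  | succ f ih =>
    by_cases hk : k < (G.adjList x).length
    swap
    · rw [List.drop_eq_nil_of_le (not_lt.1 hk)] at hP
      have hm : G.oracle (h := h) L (.adj x k) = none := by
        simp [oracle, List.getElem?_eq_none (not_lt.1 hk)]
      subst hP
      simp [relax, hm, hH]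
    · set y := (G.adjList x)[k] with hy
      have hm : G.oracle (h := h) L (.adj x k) = some (y, G.weight s(x, y)) := by
        simp [oracle, List.getElem?_eq_getElem hk, hy]
      rw [List.drop_eq_getElem_cons hk, ← hy] at hP
      cases ho : outside r (d + G.weight s(x, y)) with
      | true =>
        rw [List.takeWhile_cons_of_neg (by simp [ho])] at hP
        subst hP
        simp [relax, hm, hH, ho]
      | false =>
        rw [List.takeWhile_cons_of_pos (by simp [ho])] at hP
        subst hP
        obtain ⟨e, w, -⟩ := Heap.merge_spec (G.oracle L)
          (.node 1 (d + G.weight s(x, y)) y x .nil .nil) H (Heap.wf_singleton _ _ _) hH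
        have t := Heap.merge_time_le (G.oracle L)
          (Heap.wf_singleton (d + G.weight s(x, y)) y x) hH (N := N) (by
            simp only [Heap.entries, List.length_cons] at hN ⊢
            simp
            omega)
        simp only [Heap.entries, add_zero] at e
        obtain ⟨e', w', t'⟩ := ih (k + 1) _ w (by omega) _ rfl (by
          rw [e]
          simp only [List.length_cons] at hN
          simp
          omega)
        simp only [relax, Prog.eval_bind, Prog.time_bind, Prog.eval_get_adj, Prog.time_get_adj, hm, ho,
          Bool.false_eq_true, if_false]
        refine ⟨?_, w', ?_⟩
        · rw [e', e]
          simp only [List.map_cons, ← Multiset.cons_coe, Multiset.cons_add, Multiset.add_cons,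
            zero_add]
        · simp only [List.length_cons]
          nlinarith

/-- Every walk that leaves a set of vertices does so through some edge. -/
theorem exists_cut_edge (P : Fin n → Prop) {y x : Fin n} (q : G.graph.Walk y x) (hy : P y)
    (hx : ¬ P x) : ∃ a b, P a ∧ ¬ P b ∧ G.graph.Adj a b ∧
      G.dist y a + G.weight s(a, b) ≤ (G.len q : ℝ≥0∞) := by
  induction q with
  | nil => exact absurd hy hx
  | @cons u v w huv q ih =>
    by_cases hv : P v
    · obtain ⟨a, b, ha, hb, hab, hle⟩ := ih hv hx
      refine ⟨a, b, ha, hb, hab, ?_⟩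
      rw [len_cons, ENNReal.coe_add]
      calc G.dist u a + G.weight s(a, b)
          ≤ (G.dist u v + G.dist v a) + G.weight s(a, b) := by gcongr; exact G.dist_triangle _ _ _
        _ = G.dist u v + (G.dist v a + G.weight s(a, b)) := add_assoc _ _ _
        _ ≤ _ := add_le_add (dist_le_of_adj huv) hle
    · exact ⟨u, v, hy, hv, huv, by simp⟩

/-- The table `pre` describes shortest paths from `s`. -/
def IsTree (s : Fin n) (pre : Fin n → Option (Fin n)) : Prop :=
  ∀ x y, x ≠ s → pre x = some y → pre y ≠ none ∧ G.graph.Adj y x ∧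
    G.dist s x = G.dist s y + G.weight s(y, x)

/-- The invariant of Dijkstra's algorithm. -/
structure SearchInv (r : Option ℝ≥0) (s : Fin n) (H : Heap n) (pre : Fin n → Option (Fin n)) :
    Prop where
  wf : H.WF
  entry : ∀ d x p, (d, x, p) ∈ H.entries → (d = 0 ∧ x = s ∧ p = s) ∨
    (pre p ≠ none ∧ G.graph.Adj p x ∧ (d : ℝ≥0∞) = G.dist s p + G.weight s(p, x) ∧
      outside r d = false)
  -- The second alternative describes the state before the first vertex, the source, is settled.
  start : pre s ≠ none ∨ ((0, s, s) ∈ H.entries ∧ ∀ x, pre x = none)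
  tree : G.IsTree s pre
  edge : ∀ x y (d : ℝ≥0), pre x ≠ none → G.graph.Adj x y → G.dist s x = d →
    outside r (d + G.weight s(x, y)) = false →
      pre y ≠ none ∨ (d + G.weight s(x, y), y, x) ∈ H.entries
  reach : ∀ x, pre x ≠ none → G.dist s x ≠ ⊤

variable {G}

/-- A walk to an unsettled vertex is at least as long as the smallest key, or leaves the ball. -/
theorem SearchInv.exists_le_len {r : Option ℝ≥0} {s : Fin n} {H : Heap n}
    {pre : Fin n → Option (Fin n)} (I : G.SearchInv r s H pre) {x : Fin n} (hs : pre s ≠ none)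
    (hx : pre x = none) (q : G.graph.Walk s x) :
    (∃ d y p, (d, y, p) ∈ H.entries ∧ d ≤ G.len q) ∨ outside r (G.len q) = true := by
  obtain ⟨a, b, ha, hb, hab, hle⟩ := G.exists_cut_edge (fun z => pre z ≠ none) q hs (by simpa)
  simp only [ne_eq, not_not] at hb
  lift G.dist s a to ℝ≥0 using I.reach a ha with da hda
  have hle' : da + G.weight s(a, b) ≤ G.len q := by exact_mod_cast hle
  cases ho : outside r (da + G.weight s(a, b)) with
  | false =>
    rcases I.edge a b da ha hab hda.symm ho with h1 | h1
    · exact absurd hb h1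
    · exact Or.inl ⟨_, _, _, h1, hle'⟩
  | true =>
    right
    obtain ⟨c, rfl, hc⟩ := exists_of_outside ho
    simpa [outside] using hc.trans hle'

/-- The key is the length of an actual walk, a shortest one to `p` followed by an edge. Conversely,
any walk to `x` leaves the settled set through an edge that is in the heap, with key at least `d`,
or is so long that it lies outside the ball, while `d` is inside. If nothing is settled yet, the
root is the source entry. -/
theorem SearchInv.dist_eq {r : Option ℝ≥0} {s : Fin n} {k : ℕ} {d : ℝ≥0} {x p : Fin n}
    {l r' : Heap n} {pre : Fin n → Option (Fin n)}
    (I : G.SearchInv r s (.node k d x p l r') pre) (hx : pre x = none) : G.dist s x = d := by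
  have hent := I.entry d x p (by simp [Heap.entries])
  have hmin : ∀ e ∈ (Heap.node k d x p l r').entries, d ≤ e.1 := by
    intro e he
    rw [Heap.entries, Multiset.mem_cons] at he
    rcases he with rfl | he
    · exact le_rfl
    · exact I.wf.2.2.2.2 e he
  by_cases hs : pre s = none
  · rcases I.start with h1 | ⟨-, h1⟩
    · exact absurd hs h1
    · rcases hent with ⟨rfl, rfl, -⟩ | ⟨h2, -⟩
      · simp
      · exact absurd (h1 p) h2
  · apply le_antisymm
    · rcases hent with ⟨rfl, rfl, -⟩ | ⟨-, h1, h2, -⟩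
      · simp
      · rw [h2]
        exact (G.dist_triangle s p x).trans (by gcongr; exact dist_le_of_adj h1)
    · refine le_iInf fun q => ?_
      rcases I.exists_le_len hs hx q with ⟨d', y, p', hm, hle⟩ | ho
      · exact_mod_cast (hmin _ hm).trans hle
      · obtain ⟨c, rfl, hc⟩ := exists_of_outside ho
        rcases hent with ⟨rfl, -, -⟩ | ⟨-, -, -, h2⟩
        · simp
        · simp only [outside, decide_eq_false_iff_not, not_le] at h2
          exact_mod_cast h2.le.trans hc

/-- With an empty heap, a shortest walk to an unsettled vertex can leave the settled set only by
reaching the boundary of the ball. -/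
theorem SearchInv.outside_of_nil {r : Option ℝ≥0} {s t : Fin n} {pre : Fin n → Option (Fin n)}
    (I : G.SearchInv r s .nil pre) (ht : pre t = none) (d : ℝ≥0) (hd : G.dist s t = d) :
    outside r d = true := by
  have hs : pre s ≠ none := by
    rcases I.start with h1 | ⟨h1, -⟩
    · exact h1
    · simp [Heap.entries] at h1
  have hr : G.graph.Reachable s t := dist_ne_top_iff.1 (by simp [hd])
  obtain ⟨q, hq⟩ := exists_len_eq_dist hr
  rw [hd, ENNReal.coe_inj] at hq
  rcases I.exists_le_len hs ht q with ⟨_, _, _, hm, -⟩ | ho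
  · simp [Heap.entries] at hm
  · rwa [hq]

theorem SearchInv.skip {r : Option ℝ≥0} {s : Fin n} {k : ℕ} {d : ℝ≥0} {x p : Fin n}
    {l r' H : Heap n} {pre : Fin n → Option (Fin n)}
    (I : G.SearchInv r s (.node k d x p l r') pre) (hx : pre x ≠ none) (hH : H.WF)
    (hE : H.entries = l.entries + r'.entries) : G.SearchInv r s H pre where
  wf := hH
  entry d' x' p' hm := I.entry d' x' p' (by
    rw [Heap.entries, Multiset.mem_cons, ← hE]; exact Or.inr hm)
  start := I.start.imp_right fun h1 => absurd (h1.2 x) hx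
  tree := I.tree
  reach := I.reach
  edge a b da ha hab hda ho := by
    rcases I.edge a b da ha hab hda ho with h1 | h1
    · exact Or.inl h1
    · rw [Heap.entries, Multiset.mem_cons, ← hE] at h1
      rcases h1 with h1 | h1
      · left
        simp only [Prod.mk.injEq] at h1
        rwa [h1.2.1]
      · exact Or.inr h1

theorem SearchInv.tree_update {r : Option ℝ≥0} {s : Fin n} {k : ℕ} {d : ℝ≥0} {x p : Fin n}
    {l r' : Heap n} {pre : Fin n → Option (Fin n)}
    (I : G.SearchInv r s (.node k d x p l r') pre) (hx : pre x = none) :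
    G.IsTree s (Function.update pre x (some p)) := by
  have hmono : ∀ y, pre y ≠ none → Function.update pre x (some p) y ≠ none := by
    intro y hy
    by_cases h1 : y = x
    · subst h1; simp
    · rwa [Function.update_of_ne h1]
  intro a b ha hab
  by_cases h1 : a = x
  · subst h1
    rw [Function.update_self] at hab
    cases hab
    rcases I.entry d a p (by simp [Heap.entries]) with ⟨-, h2, -⟩ | ⟨h2, h3, h4, -⟩
    · exact absurd h2 ha
    · exact ⟨hmono _ h2, h3, by rw [I.dist_eq hx, h4]⟩
  · rw [Function.update_of_ne h1] at hab
    obtain ⟨h2, h3⟩ := I.tree a b ha hab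
    exact ⟨hmono _ h2, h3⟩

/-- The vertex is settled at its exact distance, so the new keys have the required form, and
`relaxed` lists exactly the edges at `x` that stay in the ball. Older edges lose only the entry of
`x`, which is settled now. -/
theorem SearchInv.settle {r : Option ℝ≥0} {s : Fin n} {k : ℕ} {d : ℝ≥0} {x p : Fin n}
    {l r' H : Heap n} {pre : Fin n → Option (Fin n)}
    (I : G.SearchInv r s (.node k d x p l r') pre) (hx : pre x = none) (hH : H.WF)
    (hE : H.entries = l.entries + r'.entries +
      (((G.relaxed r x d).map fun y => (d + G.weight s(x, y), y, x) : List _) : Multiset _)) :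
    G.SearchInv r s H (Function.update pre x (some p)) where
  wf := hH
  entry d' x' p' hm := by
    rw [hE, Multiset.mem_add] at hm
    rcases hm with hm | hm
    · rcases I.entry d' x' p' (by rw [Heap.entries, Multiset.mem_cons]; exact Or.inr hm) with
        h1 | ⟨h1, h2⟩
      · exact Or.inl h1
      · refine Or.inr ⟨?_, h2⟩
        rwa [Function.update_of_ne (by rintro rfl; exact h1 hx)]
    · simp only [Multiset.mem_coe, List.mem_map, Prod.mk.injEq] at hm
      obtain ⟨y, hy, rfl, rfl, rfl⟩ := hm
      rw [mem_relaxed] at hy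
      exact Or.inr ⟨by simp, hy.1, by rw [I.dist_eq hx, ENNReal.coe_add], hy.2⟩
  start := by
    left
    by_cases h1 : s = x
    · subst h1; simp
    · rw [Function.update_of_ne h1]
      rcases I.start with h2 | ⟨-, h2⟩
      · exact h2
      · rcases I.entry d x p (by simp [Heap.entries]) with ⟨-, h3, -⟩ | ⟨h3, -⟩
        · exact absurd h3.symm h1
        · exact absurd (h2 p) h3
  tree := I.tree_update hx
  reach y hy := by
    by_cases h1 : y = x
    · subst h1
      simp [I.dist_eq hx]
    · rw [Function.update_of_ne h1] at hy
      exact I.reach y hy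
  edge a b da ha hab hda ho := by
    rw [hE, Multiset.mem_add]
    by_cases h1 : a = x
    · subst h1
      rw [I.dist_eq hx, ENNReal.coe_inj] at hda
      subst hda
      refine Or.inr (Or.inr ?_)
      rw [Multiset.mem_coe, List.mem_map]
      exact ⟨b, G.mem_relaxed.2 ⟨hab, ho⟩, rfl⟩
    · rw [Function.update_of_ne h1] at ha
      by_cases h2 : b = x
      · subst h2; simp
      · rw [Function.update_of_ne h2]
        rcases I.edge a b da ha hab hda ho with h3 | h3
        · exact Or.inl h3
        · rw [Heap.entries, Multiset.mem_cons] at h3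
          rcases h3 with h3 | h3
          · exact absurd (Prod.ext_iff.1 (Prod.ext_iff.1 h3).2).1 h2
          · exact Or.inr (Or.inl h3)

variable (G)

/-- The number of heap insertions caused by `x` in a search from `s` confined to radius `r`. -/
def insertions (r : Option ℝ≥0) (s x : Fin n) : ℕ :=
  if G.dist s x = ⊤ then 0 else (G.relaxed r x (G.dist s x).toNNReal).length

/-- The number of heap insertions still to come. -/
def pending (r : Option ℝ≥0) (s : Fin n) (pre : Fin n → Option (Fin n)) : ℕ :=
  ∑ x, if pre x = none then G.insertions r s x else 0

theorem pending_update {r : Option ℝ≥0} {s x p : Fin n} {pre : Fin n → Option (Fin n)}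
    (hx : pre x = none) :
    G.pending r s pre = G.insertions r s x + G.pending r s (Function.update pre x (some p)) := by
  unfold pending
  rw [← Finset.add_sum_erase _ _ (Finset.mem_univ x), ← Finset.add_sum_erase Finset.univ
    (fun y => if Function.update pre x (some p) y = none then G.insertions r s y else 0)
    (Finset.mem_univ x)]
  simp only [hx, if_true, Function.update_self, reduceCtorEq, if_false, zero_add]
  congr 1
  refine Finset.sum_congr rfl fun y hy => ?_
  rw [Function.update_of_ne (Finset.ne_of_mem_erase hy)]

/-- Heap size plus pending insertions is a potential: settling moves insertions from pending into
the heap, and every pass removes one entry. It controls both the number of passes and the heap size.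
A heap entry pays for its extraction and the closing read of `relax`; a pending insertion pays for
that and for its own insertion. -/
theorem dijkstra_spec (L : Fin h → Finset (Fin n)) (r : Option ℝ≥0) (s t : Fin n) (N : ℕ)
    (f : ℕ) (H : Heap n) (pre : Fin n → Option (Fin n)) (I : G.SearchInv r s H pre)
    (ht : pre t = none) (hf : H.entries.card + G.pending r s pre + 1 ≤ f)
    (hN : H.entries.card + G.pending r s pre ≤ N) :
    ((dijkstra r t f H pre : Prog n h _).eval (G.oracle L) = none →
        ∀ d : ℝ≥0, G.dist s t = d → outside r d = true) ∧
      (∀ pre', (dijkstra r t f H pre : Prog n h _).eval (G.oracle L) = some pre' →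
        pre' t ≠ none ∧ G.IsTree s pre' ∧ G.dist s t ≠ ⊤) ∧
      (dijkstra r t f H pre : Prog n h _).time (G.oracle L) ≤
        H.entries.card * (Heap.mergeBound N + 2) +
          G.pending r s pre * (2 * Heap.mergeBound N + 3) + 1 := by
  induction f generalizing H pre with
  | zero => omega
  | succ f ih =>
    cases H with
    | nil =>
      simp only [dijkstra, Prog.eval_bind, Prog.time_bind, Prog.eval_pure, Prog.time_pure,
        Prog.time_charge]
      refine ⟨fun _ => I.outside_of_nil ht, by simp, by omega⟩
    | node k d x p l r' =>
      obtain ⟨e, w, -⟩ := Heap.merge_spec (G.oracle (h := h) L) l r' I.wf.1 I.wf.2.1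
      have hcard : (Heap.node k d x p l r').entries.card =
          l.entries.card + r'.entries.card + 1 := by
        rw [Heap.entries, Multiset.card_cons, Multiset.card_add]
      rw [hcard] at hf hN ⊢
      have t1 := Heap.merge_time_le (G.oracle (h := h) L) I.wf.1 I.wf.2.1 (N := N) (by omega)
      simp only [dijkstra, Prog.eval_bind, Prog.time_bind, Prog.time_charge]
      by_cases hx : (pre x).isSome
      · obtain ⟨i1, i2, i3⟩ := ih _ pre (I.skip (Option.isSome_iff_ne_none.1 hx) w e) ht
          (by rw [e, Multiset.card_add]; omega) (by rw [e, Multiset.card_add]; omega)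
        simp only [hx, if_true]
        refine ⟨i1, i2, ?_⟩
        rw [e, Multiset.card_add] at i3
        nlinarith
      · have hx' : pre x = none := by simpa using hx
        rw [G.pending_update (p := p) hx'] at hf hN ⊢
        simp only [hx, Bool.false_eq_true, if_false]
        by_cases hxt : x = t
        · subst hxt
          simp only [if_true, Prog.eval_pure, Prog.time_pure, reduceCtorEq, false_imp_iff, true_and,
            Option.some.injEq, forall_eq']
          refine ⟨⟨by simp, I.tree_update hx', by simp [I.dist_eq hx']⟩, ?_⟩
          nlinarith [Nat.zero_le ((G.insertions r s x +
            G.pending r s (Function.update pre x (some p))) * (2 * Heap.mergeBound N + 3)),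
            Nat.zero_le ((l.entries.card + r'.entries.card) * (Heap.mergeBound N + 2))]
        · simp only [hxt, if_false, Prog.eval_bind, Prog.time_bind]
          have hlen : (G.relaxed r x d).length = G.insertions r s x := by
            rw [insertions, I.dist_eq hx', ENNReal.toNNReal_coe, if_neg ENNReal.coe_ne_top]
          obtain ⟨e2, w2, t2⟩ := G.relax_spec L r x d N n 0 _ w
            (by simpa using G.length_adjList_le x) (G.relaxed r x d) rfl
            (by rw [e, Multiset.card_add, hlen]; omega)
          rw [e] at e2
          rw [hlen] at t2
          have hc2 := congrArg Multiset.card e2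
          simp only [Multiset.card_add, Multiset.coe_card, List.length_map, hlen] at hc2
          obtain ⟨i1, i2, i3⟩ := ih _ _ (I.settle hx' w2 e2)
            (by rw [Function.update_of_ne (Ne.symm hxt)]; exact ht)
            (by rw [hc2]; omega) (by rw [hc2]; omega)
          refine ⟨i1, i2, ?_⟩
          rw [hc2] at i3
          nlinarith

/-- Positive weights make predecessors strictly closer to `s`, so the number of vertices closer than
`x` bounds the number of steps left. -/
theorem trace_spec (L : Fin h → Finset (Fin n)) (s : Fin n) (pre : Fin n → Option (Fin n))
    (hpre : G.IsTree s pre) (f : ℕ) (x : Fin n) (acc : List (Fin n)) (hx : pre x ≠ none)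
    (hd : G.dist s x ≠ ⊤) (hf : (Finset.univ.filter fun y => G.dist s y < G.dist s x).card < f) :
    ∃ p : G.graph.Walk s x, G.dist s x = G.len p ∧
      (trace pre s f x acc : Prog n h _).eval (G.oracle L) = p.support ++ acc ∧
      (trace pre s f x acc : Prog n h _).time (G.oracle L) = p.length + 1 := by
  induction f generalizing x acc with
  | zero => omega
  | succ f ih =>
    by_cases hxs : x = s
    · subst hxs
      exact ⟨.nil, by simp, by simp [trace], by simp [trace]⟩
    · obtain ⟨y, hy⟩ := Option.ne_none_iff_exists'.1 hx
      obtain ⟨h1, h2, h3⟩ := hpre x y hxs hy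
      have hdy : G.dist s y ≠ ⊤ := fun hc => hd (by rw [h3, hc, top_add])
      have hlt : G.dist s y < G.dist s x := by
        rw [h3]
        refine ENNReal.lt_add_right hdy ?_
        have := G.weight_pos s(y, x) h2
        exact_mod_cast this.ne'
      obtain ⟨p, p1, p2, p3⟩ := ih y (x :: acc) h1 hdy (by
        refine (Nat.lt_of_lt_of_le (Finset.card_lt_card ?_) (Nat.lt_succ_iff.1 hf))
        refine Finset.ssubset_iff_of_subset (fun z hz => ?_) |>.2 ⟨y, by simpa using hlt, by simp⟩
        simp only [Finset.mem_filter, Finset.mem_univ, true_and] at hz ⊢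
        exact hz.trans hlt)
      refine ⟨p.append (Walk.cons h2 .nil), ?_, ?_, ?_⟩
      · rw [h3, p1]; simp
      · simp [trace, hxs, hy, p2, Walk.support_append]
      · simp [trace, hxs, hy, p3]; omega

/-- The total number of heap insertions of a search. -/
def searchSize (r : Option ℝ≥0) (s : Fin n) : ℕ := ∑ x, G.insertions r s x

/-- Justifies the bound `n * n + 2` on the passes of the search: these insertions, the source entry,
and one pass that finds the heap empty. -/
theorem searchSize_le (r : Option ℝ≥0) (s : Fin n) : G.searchSize r s ≤ n * n := by
  calc G.searchSize r s ≤ ∑ _x : Fin n, n := Finset.sum_le_sum fun x _ => by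
        unfold insertions
        split_ifs
        · exact Nat.zero_le _
        · exact (List.takeWhile_sublist _).length_le.trans (G.length_adjList_le x)
    _ = n * n := by simp

/-- The time of an unsuccessful search with `K` heap insertions. -/
def searchTime (K : ℕ) : ℕ :=
  Heap.mergeBound (K + 1) + 2 + K * (2 * Heap.mergeBound (K + 1) + 3) + 1

theorem explore_spec (L : Fin h → Finset (Fin n)) (r : Option ℝ≥0) (s t : Fin n) :
    ((explore r s t : Prog n h _).eval (G.oracle L) = none →
        ∀ d : ℝ≥0, G.dist s t = d → outside r d = true) ∧
      (∀ l, (explore r s t : Prog n h _).eval (G.oracle L) = some l →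
        ∃ p : G.graph.Walk s t, l = p.support ∧ G.dist s t = G.len p) ∧
      (explore r s t : Prog n h _).time (G.oracle L) ≤
        searchTime (G.searchSize r s) + hops ((explore r s t : Prog n h _).eval (G.oracle L)) +
          1 := by
  have hpend : G.pending r s (fun _ => none) = G.searchSize r s := by simp [pending, searchSize]
  have hcard : (Heap.node 1 0 s s .nil .nil : Heap n).entries.card = 1 := by simp [Heap.entries]
  obtain ⟨h1, h2, h3⟩ := G.dijkstra_spec L r s t (G.searchSize r s + 1) (n * n + 2)
    (.node 1 0 s s .nil .nil) (fun _ => none)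
    { wf := Heap.wf_singleton _ _ _
      entry := by
        intro d x p hm
        left
        simpa [Heap.entries] using hm
      start := Or.inr ⟨by simp [Heap.entries], fun _ => rfl⟩
      tree := by intro x y _ hxy; cases hxy
      edge := fun _ _ _ ha => absurd rfl ha
      reach := fun _ ha => absurd rfl ha }
    rfl (by rw [hcard, hpend]; have := G.searchSize_le r s; omega)
    (by rw [hcard, hpend]; omega)
  rw [hcard, hpend, one_mul] at h3
  cases hd : (dijkstra r t (n * n + 2) (.node 1 0 s s .nil .nil) (fun _ => none) :
      Prog n h _).eval (G.oracle L) with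
  | none =>
    have he : (explore r s t : Prog n h _).eval (G.oracle L) = none := by simp [explore, hd]
    refine ⟨fun _ => h1 hd, by simp [he], ?_⟩
    simp only [explore, Prog.time_bind, hd, Prog.time_pure]
    unfold searchTime
    omega
  | some pre =>
    obtain ⟨i1, i2, i3⟩ := h2 pre hd
    obtain ⟨p, p1, p2, p3⟩ := G.trace_spec L s pre i2 (n + 1) t [] i1 i3
      (Nat.lt_succ_of_le ((Finset.card_le_univ _).trans (by simp)))
    have he : (explore r s t : Prog n h _).eval (G.oracle L) = some p.support := by
      simp [explore, hd, p2]
    refine ⟨by simp [he], ?_, ?_⟩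
    · intro l hl
      rw [he] at hl
      cases hl
      exact ⟨p, rfl, p1⟩
    · rw [he]
      simp only [explore, Prog.time_bind, hd, Prog.time_pure, p3]
      simp only [hops, Option.getD_some, Walk.length_support]
      unfold searchTime
      omega

theorem revOnto_spec (M : Memory n h) (l acc : List (Fin n)) :
    (revOnto l acc : Prog n h _).eval M = l.reverse ++ acc ∧
      (revOnto l acc : Prog n h _).time M = l.length + 1 := by
  induction l generalizing acc with
  | nil => simp [revOnto]
  | cons x l ih => simp [revOnto, ih]; omega

end WGraph

/-! ### Retrieval of stored paths -/

section Lists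

variable {n : ℕ} {l : List (Fin n)} {a b z : Fin n}

theorem succIn_eq_some_iff (hl : l.Nodup) :
    succIn l z = some b ↔ ∃ A B, l = A ++ z :: b :: B := by
  unfold succIn
  constructor
  · intro h
    obtain ⟨hi, hb⟩ := List.getElem?_eq_some_iff.1 h
    have hz : l.idxOf z < l.length := by omega
    refine ⟨l.take (l.idxOf z), l.drop (l.idxOf z + 2), ?_⟩
    conv_lhs => rw [← List.take_append_drop (l.idxOf z) l]
    rw [List.drop_eq_getElem_cons hz, List.drop_eq_getElem_cons hi, hb, List.getElem_idxOf]
  · rintro ⟨A, B, rfl⟩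
    have hz : z ∉ A := fun hz =>
      (List.nodup_append.1 hl).2.2 z hz z (by simp) rfl
    rw [List.idxOf_append_of_notMem hz]
    simp

theorem predIn_eq_some_iff (hl : l.Nodup) :
    predIn l z = some a ↔ ∃ A B, l = A ++ a :: z :: B := by
  unfold predIn
  rw [succIn_eq_some_iff (List.nodup_reverse.2 hl)]
  constructor
  · rintro ⟨A, B, h⟩
    refine ⟨B.reverse, A.reverse, ?_⟩
    rw [← List.reverse_reverse l, h]
    simp
  · rintro ⟨A, B, rfl⟩
    exact ⟨B.reverse, A.reverse, by simp⟩

theorem mem_of_succIn_eq_some (h : succIn l z = some b) : z ∈ l := by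
  obtain ⟨hi, -⟩ := List.getElem?_eq_some_iff.1 h
  exact List.idxOf_lt_length_iff.1 (by omega)

end Lists

namespace WGraph

open SimpleGraph

variable {n h : ℕ} {G : WGraph n} {L : Fin h → Finset (Fin n)} {i : Fin h}

/-- The tail of a least walk to the landmarks is the least walk from its own start, so the landmark
recorded along the way is constant and the parents follow a single path. -/
theorem IsMinTo.climbPath_spec {v x : Fin n} {p : G.graph.Walk v x}
    (hp : G.IsMinTo (L i : Set (Fin n)) p) {f : ℕ} (hf : p.length < f) (rest : List (Fin n)) :
    (climbPath i f v rest : Prog n h _).eval (G.oracle L) = p.support.dropLast ++ rest ∧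
      (climbPath i f v rest : Prog n h _).time (G.oracle L) = p.length + 1 := by
  induction p generalizing f with
  | nil =>
    obtain ⟨f, rfl⟩ := Nat.exists_eq_succ_of_ne_zero (by omega : f ≠ 0)
    have hm : G.oracle L (.near i _) = _ := hp.nearest_eq
    simp [climbPath, hm]
  | @cons u w x huw p ih =>
    obtain ⟨f, rfl⟩ := Nat.exists_eq_succ_of_ne_zero (by omega : f ≠ 0)
    have hm : G.oracle L (.near i _) = _ := hp.nearest_eq
    have hux : u ≠ x := by
      rintro rfl
      exact ((Walk.cons_isPath_iff _ _).1 hp.isPath).2 p.end_mem_support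
    obtain ⟨h1, h2⟩ := ih hp.of_cons (f := f) (by simpa using hf)
    constructor
    · simp [climbPath, hm, hux, h1, List.dropLast_cons_of_ne_nil]
    · simp [climbPath, hm, hux, h2]
      omega

theorem IsMinTo.descendPath_spec {v x : Fin n} {p : G.graph.Walk v x}
    (hp : G.IsMinTo (L i : Set (Fin n)) p) {f : ℕ} (hf : p.length < f) (acc : List (Fin n)) :
    (descendPath i f v acc : Prog n h _).eval (G.oracle L) = p.support.dropLast.reverse ++ acc ∧
      (descendPath i f v acc : Prog n h _).time (G.oracle L) = p.length + 1 := by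
  induction p generalizing f acc with
  | nil =>
    obtain ⟨f, rfl⟩ := Nat.exists_eq_succ_of_ne_zero (by omega : f ≠ 0)
    have hm : G.oracle L (.near i _) = _ := hp.nearest_eq
    simp [descendPath, hm]
  | @cons u w x huw p ih =>
    obtain ⟨f, rfl⟩ := Nat.exists_eq_succ_of_ne_zero (by omega : f ≠ 0)
    have hm : G.oracle L (.near i _) = _ := hp.nearest_eq
    have hux : u ≠ x := by
      rintro rfl
      exact ((Walk.cons_isPath_iff _ _).1 hp.isPath).2 p.end_mem_support
    obtain ⟨h1, h2⟩ := ih hp.of_cons (f := f) (by simpa using hf) (u :: acc)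
    constructor
    · simp [descendPath, hm, hux, h1, List.dropLast_cons_of_ne_nil]
    · simp [descendPath, hm, hux, h2]
      omega

theorem reachable_of_mem_pairs {x y : Fin n} (hp : (x, y) ∈ G.pairs L i) :
    G.graph.Reachable x y := by
  obtain ⟨-, -, -, h4⟩ := hp
  split_ifs at h4 with hi
  · rcases h4 with h4 | h4
    · exact dist_ne_top_iff.1 (ne_top_of_lt h4)
    · exact (dist_ne_top_iff.1 (ne_top_of_lt h4)).symm
  · exact h4

theorem exists_isInternal_homePath {P : Set (Fin n × Fin n)} {q : Fin n × Fin n} {z a b : Fin n}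
    (hq : q ∈ P) (hz : G.IsInternal q z a b) :
    ∃ r : (Fin n × Fin n) × Fin n × Fin n, G.homePath P z = some r ∧ r.1 ∈ P ∧
      G.IsInternal r.1 z r.2.1 r.2.2 := by
  have hr : ∃ r : (Fin n × Fin n) × Fin n × Fin n, r.1 ∈ P ∧ G.IsInternal r.1 z r.2.1 r.2.2 :=
    ⟨(q, a, b), hq, hz⟩
  exact ⟨hr.choose, by rw [homePath, dif_pos hr], hr.choose_spec⟩

/-- At each inner vertex the home path either branches from the route, and then the branching record
holds the successor, or it has the same two neighbours, and the successor is the one that is not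
`prev`. Each vertex costs one tick and two reads. -/
theorem followPath_spec {x y b : Fin n} (hxy : (x, y) ∈ G.pairs L i) {C : List (Fin n)}
    (hC : G.route x y = C ++ [b, y]) (rest : List (Fin n)) (f : ℕ) (A B : List (Fin n))
    (prev cur : Fin n) (hB : B ≠ []) (hAB : G.route x y = A ++ prev :: cur :: B)
    (hf : B.length ≤ f) :
    (followPath i x y b rest f prev cur : Prog n h _).eval (G.oracle L) = cur :: B ++ rest ∧
      (followPath i x y b rest f prev cur : Prog n h _).time (G.oracle L) ≤ 3 * B.length := by
  induction B generalizing A prev cur f with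
  | nil => exact absurd rfl hB
  | cons c B ih =>
    obtain ⟨f, rfl⟩ := Nat.exists_eq_succ_of_ne_zero
      (by rw [List.length_cons] at hf; omega : f ≠ 0)
    have hnd : (G.route x y).Nodup := nodup_route
    have hsucc : succIn (G.route x y) cur = some c :=
      (succIn_eq_some_iff hnd).2 ⟨A ++ [prev], B, by rw [hAB]; simp⟩
    have hpred : predIn (G.route x y) cur = some prev :=
      (predIn_eq_some_iff hnd).2 ⟨A, c :: B, hAB⟩
    cases B with
    | nil =>
      have h1 : A ++ [prev] ++ [cur, c] = C ++ [b, y] := by rw [← hC, hAB]; simp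
      obtain ⟨-, h2⟩ := List.append_inj' h1 rfl
      simp only [List.cons.injEq, and_true] at h2
      obtain ⟨rfl, rfl⟩ := h2
      simp [followPath]
    | cons c' B =>
      have hcb : cur ≠ b := by
        rintro rfl
        have h1 : succIn (G.route x y) cur = some y :=
          (succIn_eq_some_iff hnd).2 ⟨C, [], hC⟩
        rw [h1] at hsucc
        cases hsucc
        have h2 := congrArg List.getLast? (hC.symm.trans hAB)
        rw [show C ++ [cur, y] = (C ++ [cur]) ++ [y] by simp, List.getLast?_concat,
          show A ++ prev :: cur :: y :: c' :: B = (A ++ [prev, cur, y]) ++ (c' :: B) by simp,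
          List.getLast?_append_of_ne_nil _ (by simp)] at h2
        have h3 : y ∈ c' :: B := List.mem_of_getLast? h2.symm
        rw [hAB, show A ++ prev :: cur :: y :: c' :: B = (A ++ [prev, cur]) ++ (y :: c' :: B) by
          simp] at hnd
        exact (List.nodup_cons.1 (List.nodup_append.1 hnd).2.1).1 h3
      have hpc : prev ≠ c := by
        rintro rfl
        rw [hAB] at hnd
        have := (List.nodup_append.1 hnd).2.1
        simp at this
      obtain ⟨⟨name, s, t⟩, hr, hname, hint⟩ :=
        exists_isInternal_homePath hxy (z := cur) ⟨hpred, hsucc⟩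
      have hhome : G.oracle L (.home i cur) = some (name, s, t) := hr
      have ih' := ih f (A ++ [prev]) cur c (by simp) (by rw [hAB]; simp)
        (by simp only [List.length_cons] at hf ⊢; omega)
      by_cases hbr : G.IsBranching name (x, y) cur
      · have hb : G.oracle L (.branch i name (x, y) cur) =
            some ((some s, some t), (some prev, some c)) := by
          simp only [oracle]
          rw [if_pos ⟨hname, hxy, hbr⟩, hpred, hsucc, hint.1, hint.2]
        simp only [followPath, Prog.eval_bind, Prog.time_bind, Prog.time_charge, hcb, if_false,
          Prog.eval_get_home, Prog.time_get_home, hhome, Prog.eval_get_branch,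
          Prog.time_get_branch, hb, Prog.eval_pure, Prog.time_pure, ih'.1]
        refine ⟨by simp, ?_⟩
        have := ih'.2
        simp only [List.length_cons] at this ⊢
        omega
      · have hb : G.oracle L (.branch i name (x, y) cur) = none := by
          simp only [oracle]
          rw [if_neg fun hc => hbr hc.2.2]
        -- A missing record means that the routes are equal or agree in their unordered pair of
        -- neighbours; in the latter case the home path may pass `cur` in the opposite direction,
        -- where `prev ≠ c` decides.
        have hnext : (if s = prev then t else s) = c := by
          by_cases hroute : G.route name.1 name.2 = G.route x y
          · have h1 := hint.1
            have h2 := hint.2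
            rw [hroute, hpred] at h1
            rw [hroute, hsucc] at h2
            cases h1
            cases h2
            simp
          · have hset : s(predIn (G.route name.1 name.2) cur, succIn (G.route name.1 name.2) cur) =
                s(predIn (G.route x y) cur, succIn (G.route x y) cur) := by
              by_contra hne
              exact hbr ⟨hroute, mem_of_succIn_eq_some hint.2, mem_of_succIn_eq_some hsucc, hne⟩
            rw [hint.1, hint.2, hpred, hsucc, Sym2.eq_iff] at hset
            rcases hset with ⟨h1, h2⟩ | ⟨h1, h2⟩
            · cases h1; cases h2; simp
            · cases h1; cases h2; simp [hpc.symm]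
        simp only [followPath, Prog.eval_bind, Prog.time_bind, Prog.time_charge, hcb, if_false,
          Prog.eval_get_home, Prog.time_get_home, hhome, Prog.eval_get_branch,
          Prog.time_get_branch, hb, Prog.eval_pure, Prog.time_pure, hnext, ih'.1]
        refine ⟨by simp, ?_⟩
        have := ih'.2
        simp only [List.length_cons] at this ⊢
        omega

theorem oracle_pair_eq_none {x y : Fin n} (hxy : (x, y) ∉ G.pairs L i) :
    G.oracle L (.pair i x y) = none := by
  simp only [oracle]
  rw [if_neg hxy]

theorem oracle_pair_eq_some {x y : Fin n} (hxy : (x, y) ∈ G.pairs L i) :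
    ∃ a b A C, G.oracle L (.pair i x y) = some (a, b) ∧ G.route x y = x :: a :: A ∧
      G.route x y = C ++ [b, y] := by
  obtain ⟨p, hp, hr⟩ := exists_route_eq (reachable_of_mem_pairs hxy)
  have hne : x ≠ y := hxy.1
  have h1 : ∃ a A, G.route x y = x :: a :: A := by
    rw [hr]
    cases p with
    | nil => exact absurd rfl hne
    | cons h p => cases p <;> exact ⟨_, _, rfl⟩
  have h2 : ∃ b C, G.route x y = C ++ [b, y] := by
    have h3 : ∃ b B, p.reverse.support = y :: b :: B := by
      cases p.reverse with
      | nil => exact absurd rfl hne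
      | cons h p => cases p <;> exact ⟨_, _, rfl⟩
    obtain ⟨b, B, h3⟩ := h3
    refine ⟨b, B.reverse, ?_⟩
    rw [Walk.support_reverse] at h3
    rw [hr, ← List.reverse_reverse p.support, h3]
    simp
  obtain ⟨a, A, h1⟩ := h1
  obtain ⟨b, C, h2⟩ := h2
  have hs : succIn (G.route x y) x = some a := (succIn_eq_some_iff nodup_route).2 ⟨[], A, h1⟩
  have hb : predIn (G.route x y) y = some b := (predIn_eq_some_iff nodup_route).2 ⟨C, [], h2⟩
  refine ⟨a, b, A, C, ?_, h1, h2⟩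
  simp only [oracle]
  rw [if_pos hxy, hs, hb]
  rfl

theorem pairPath_spec {x y : Fin n} (hxy : (x, y) ∈ G.pairs L i) (rest : List (Fin n)) :
    (pairPath i x y rest : Prog n h _).eval (G.oracle L) = G.route x y ++ rest ∧
      (pairPath i x y rest : Prog n h _).time (G.oracle L) ≤ 3 * (G.route x y).length := by
  obtain ⟨a, b, A, C, hm, h1, h2⟩ := oracle_pair_eq_some hxy
  have hnd : (G.route x y).Nodup := nodup_route
  -- This is the case of a path with a single edge.
  by_cases hxb : x = b
  · subst hxb
    have hC : C = [] := by
      rw [h1] at h2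
      cases C with
      | nil => rfl
      | cons c C =>
        simp only [List.cons_append, List.cons.injEq] at h2
        rw [h1] at hnd
        exact absurd (by rw [h2.2]; simp) (List.nodup_cons.1 hnd).1
    subst hC
    rw [h2]
    simp [pairPath, hm]
  · have hA : A ≠ [] := by
      rintro rfl
      rw [h1] at h2
      have := List.append_inj' (s₁ := []) (t₁ := [x, a]) h2 rfl
      simp at this
      exact hxb this.2.1
    have hlen : A.length ≤ n := by
      have := hnd.length_le_card
      rw [h1, Fintype.card_fin] at this
      simp only [List.length_cons] at this
      omega
    obtain ⟨i1, i2⟩ := followPath_spec hxy h2 rest n [] A x a hA h1 hlen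
    simp only [pairPath, Prog.eval_bind, Prog.time_bind, Prog.eval_get_pair, Prog.time_get_pair, hm,
      hxb, if_false, Prog.eval_pure, Prog.time_pure, i1]
    rw [h1]
    refine ⟨by simp, ?_⟩
    simp only [List.length_cons]
    omega

end WGraph

/-! ### Climbing the levels: correctness, stretch and cost of a query -/

namespace WGraph

open SimpleGraph

variable {n h : ℕ} {G : WGraph n} {L : Fin h → Finset (Fin n)} {i : Fin h}

/-- One step up, used with different distance estimates on the first level and above. The `4` stands
for two reads of `near` and the closing reads of the two tree paths; all other work is charged to
edges. -/
theorem report_cons_spec {j : Fin h} {js : List (Fin h)} {u v u' v' : Fin n}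
    {pu : G.graph.Walk u u'} {pv : G.graph.Walk v v'}
    (hu : G.IsMinTo (L j : Set (Fin n)) pu) (hv : G.IsMinTo (L j : Set (Fin n)) pv)
    {ℓ : ℝ≥0∞} {T : ℕ}
    (hrec : ∀ acc, ∃ p : G.graph.Walk u' v',
      (report j js u' v' acc : Prog n h _).eval (G.oracle L) = p.support ++ acc ∧
      (G.len p : ℝ≥0∞) ≤ ℓ ∧
      (report j js u' v' acc : Prog n h _).time (G.oracle L) ≤ 3 * p.length + T)
    (acc : List (Fin n)) :
    ∃ p : G.graph.Walk u v,
      (report i (j :: js) u v acc : Prog n h _).eval (G.oracle L) = p.support ++ acc ∧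
      (G.len p : ℝ≥0∞) ≤ G.len pu + ℓ + G.len pv ∧
      (report i (j :: js) u v acc : Prog n h _).time (G.oracle L) ≤ 3 * p.length + (T + 4) := by
  have hlt : ∀ {a b : Fin n} (p : G.graph.Walk a b), p.IsPath → p.length < n + 1 := by
    intro a b p hp
    have := hp.length_lt
    rw [Fintype.card_fin] at this
    omega
  have hmu : G.oracle L (.near j u) = _ := hu.nearest_eq
  have hmv : G.oracle L (.near j v) = _ := hv.nearest_eq
  obtain ⟨d1, d2⟩ := hv.descendPath_spec (hlt pv hv.isPath) acc
  obtain ⟨p, r1, r2, r3⟩ := hrec (pv.support.dropLast.reverse ++ acc)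
  obtain ⟨c1, c2⟩ := hu.climbPath_spec (hlt pu hu.isPath)
    (p.support ++ (pv.support.dropLast.reverse ++ acc))
  refine ⟨pu.append (p.append pv.reverse), ?_, ?_, ?_⟩
  · simp only [report, Prog.eval_bind, Prog.eval_get_near, hmu, hmv, d1, r1, c1]
    rw [Walk.support_append_eq_support_dropLast_append, Walk.support_append,
      Walk.support_reverse, List.tail_reverse]
    simp
  · simp only [len_append, len_reverse, ENNReal.coe_add]
    rw [← add_assoc]
    gcongr
  · simp only [report, Prog.time_bind, Prog.eval_get_near, Prog.time_get_near, hmu,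
      hmv, d1, d2, r1, c2]
    simp only [Walk.length_append, Walk.length_reverse]
    omega

theorem drop_finRange_eq_cons {k : ℕ} {j : Fin h} {js : List (Fin h)}
    (hjs : j :: js = (List.finRange h).drop k) :
    (j : ℕ) = k ∧ js = (List.finRange h).drop (j + 1) := by
  have hk : k < (List.finRange h).length := by
    by_contra hk
    rw [List.drop_eq_nil_of_le (not_lt.1 hk)] at hjs
    cases hjs
  rw [List.drop_eq_getElem_cons hk, List.cons.injEq] at hjs
  have h1 : (j : ℕ) = k := by rw [hjs.1]; simp
  exact ⟨h1, by rw [h1]; exact hjs.2⟩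

theorem radius_le_of_notMem_fracBall {S : Finset (Fin n)} {u v : Fin n}
    (hv : v ∉ G.fracBall (1 / 3) S u) : G.radius S u ≤ 3 * G.dist u v := by
  simp only [fracBall, Set.mem_ofPred_eq, not_lt] at hv
  calc G.radius S u = 3 * (1 / 3 * G.radius S u) := by
        rw [← mul_assoc, one_div, ENNReal.mul_inv_cancel (by norm_num) (by norm_num), one_mul]
    _ ≤ 3 * G.dist u v := by gcongr

/-- For a pair at distance `d` that is not stored, both radii to the next level are at most `3d`; in
particular they are finite, so the next landmarks exist. These have distance at most `7d`, and the
way up and down adds `6d`. -/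
theorem locate_spec (js : List (Fin h)) (i : Fin h)
    (hjs : js = (List.finRange h).drop (i + 1)) (u v : Fin n) (hu : u ∈ L i) (hv : v ∈ L i)
    (hr : G.graph.Reachable u v) :
    ∃ ls, (locate i js u v : Prog n h _).eval (G.oracle L) = some ls ∧
      (locate i js u v : Prog n h _).time (G.oracle L) ≤ 3 * js.length + 1 ∧
      ∀ acc, ∃ p : G.graph.Walk u v,
        (report i ls u v acc : Prog n h _).eval (G.oracle L) = p.support ++ acc ∧
        (G.len p : ℝ≥0∞) ≤ ((2 * 7 ^ js.length - 1 : ℕ) : ℝ≥0∞) * G.dist u v ∧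
        (report i ls u v acc : Prog n h _).time (G.oracle L) ≤
          3 * p.length + (4 * js.length + 4) := by
  induction js generalizing i u v with
  | nil =>
    by_cases huv : u = v
    · subst huv
      refine ⟨[], ?_, ?_, fun acc => ⟨.nil, ?_, ?_, ?_⟩⟩ <;> simp [locate, report]
    · have hih : ¬ (i : ℕ) + 1 < h := by
        intro hc
        have := congrArg List.length hjs
        rw [List.length_drop, List.length_finRange, List.length_nil] at this
        omega
      have hp : (u, v) ∈ G.pairs L i := ⟨huv, hu, hv, by rwa [dif_neg hih]⟩
      obtain ⟨a, b, -, -, hm, -⟩ := oracle_pair_eq_some hp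
      obtain ⟨p, hpm, hroute⟩ := exists_route_eq hr
      refine ⟨[], by simp [locate, huv, hm], by simp [locate, huv, hm], fun acc => ⟨p, ?_, ?_, ?_⟩⟩
      · simp [report, huv, (pairPath_spec hp acc).1, hroute]
      · simp [hpm.dist_eq]
      · have := (pairPath_spec hp acc).2
        rw [hroute, Walk.length_support] at this
        simp [report, huv]
        omega
  | cons j js ih =>
    obtain ⟨hji, hjs'⟩ := drop_finRange_eq_cons hjs
    -- The recurrence for the stretch, in natural numbers.
    have h7 : 2 * 7 ^ (j :: js).length - 1 = 7 * (2 * 7 ^ js.length - 1) + 6 := by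
      have : 0 < 7 ^ js.length := by positivity
      rw [List.length_cons, pow_succ]
      omega
    by_cases huv : u = v
    · subst huv
      refine ⟨[], ?_, ?_, fun acc => ⟨.nil, ?_, ?_, ?_⟩⟩ <;> simp [locate, report]
    by_cases hp : (u, v) ∈ G.pairs L i
    · obtain ⟨a, b, -, -, hm, -⟩ := oracle_pair_eq_some hp
      obtain ⟨p, hpm, hroute⟩ := exists_route_eq hr
      refine ⟨[], by simp [locate, huv, hm], by simp [locate, huv, hm], fun acc => ⟨p, ?_, ?_, ?_⟩⟩
      · simp [report, huv, (pairPath_spec hp acc).1, hroute]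
      · rw [hpm.dist_eq, h7]
        have : 1 ≤ 7 * (2 * 7 ^ js.length - 1) + 6 := by omega
        calc (G.len p : ℝ≥0∞) = ((1 : ℕ) : ℝ≥0∞) * G.len p := by simp
          _ ≤ _ := by gcongr
      · have := (pairPath_spec hp acc).2
        rw [hroute, Walk.length_support] at this
        simp [report, huv]
        omega
    · have hih : (i : ℕ) + 1 < h := hji ▸ j.2
      have hj : (⟨i + 1, hih⟩ : Fin h) = j := Fin.ext hji.symm
      have hball : ¬ (v ∈ G.fracBall (1 / 3) (L j) u ∨ u ∈ G.fracBall (1 / 3) (L j) v) := by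
        intro hc
        refine hp ⟨huv, hu, hv, ?_⟩
        rw [dif_pos hih, hj]
        exact hc
      rw [not_or] at hball
      have hru := radius_le_of_notMem_fracBall hball.1
      have hrv := radius_le_of_notMem_fracBall hball.2
      rw [G.dist_comm v u] at hrv
      have hfin : 3 * G.dist u v < ⊤ :=
        ENNReal.mul_lt_top (by norm_num) (dist_ne_top_iff.2 hr).lt_top
      obtain ⟨u', pu, hpu⟩ := exists_isMinTo_of_radius_ne_top (hru.trans_lt hfin).ne
      obtain ⟨v', pv, hpv⟩ := exists_isMinTo_of_radius_ne_top (hrv.trans_lt hfin).ne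
      have hr' : G.graph.Reachable u' v' := (pu.reachable.symm.trans hr).trans pv.reachable
      rw [hpu.radius_eq] at hru
      rw [hpv.radius_eq] at hrv
      have hd : G.dist u' v' ≤ 7 * G.dist u v := by
        calc G.dist u' v' ≤ G.dist u' u + G.dist u v' := G.dist_triangle _ _ _
          _ ≤ G.dist u' u + (G.dist u v + G.dist v v') := by gcongr; exact G.dist_triangle _ _ _
          _ ≤ 3 * G.dist u v + (G.dist u v + 3 * G.dist u v) := by
            rw [G.dist_comm u' u, hpu.dist_eq, hpv.dist_eq]
            gcongr
          _ = 7 * G.dist u v := by ring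
      obtain ⟨ls, l1, l2, l3⟩ := ih j hjs' u' v' hpu.1 hpv.1 hr'
      have hmu : G.oracle L (.near j u) = _ := hpu.nearest_eq
      have hmv : G.oracle L (.near j v) = _ := hpv.nearest_eq
      have hmp : G.oracle L (.pair i u v) = none := oracle_pair_eq_none hp
      refine ⟨j :: ls, ?_, ?_, fun acc => ?_⟩
      · simp [locate, huv, hmp, hmu, hmv, l1]
      · simp only [locate, huv, if_false, Prog.time_bind, Prog.eval_get_pair,
          Prog.time_get_pair, hmp, Prog.eval_get_near, Prog.time_get_near, hmu, hmv, l1,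
          Prog.time_pure, List.length_cons]
        omega
      · obtain ⟨p, p1, p2, p3⟩ := report_cons_spec (i := i) hpu hpv l3 acc
        refine ⟨p, p1, p2.trans ?_, ?_⟩
        · rw [h7]
          calc (G.len pu : ℝ≥0∞) + ((2 * 7 ^ js.length - 1 : ℕ) : ℝ≥0∞) * G.dist u' v' + G.len pv
              ≤ 3 * G.dist u v + ((2 * 7 ^ js.length - 1 : ℕ) : ℝ≥0∞) * (7 * G.dist u v) +
                  3 * G.dist u v := by gcongr
            _ = ((7 * (2 * 7 ^ js.length - 1) + 6 : ℕ) : ℝ≥0∞) * G.dist u v := by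
              rw [Nat.cast_add, Nat.cast_mul]
              push_cast
              ring
        · rw [List.length_cons]
          omega

/-- Climbing stays in the components of `u` and `v`, so the landmarks never coincide or form a
stored pair. -/
theorem locate_eq_none (js : List (Fin h)) (i : Fin h) (u v : Fin n)
    (hr : ¬ G.graph.Reachable u v) :
    (locate i js u v : Prog n h _).eval (G.oracle L) = none ∧
      (locate i js u v : Prog n h _).time (G.oracle L) ≤ 3 * js.length + 1 := by
  have huv : u ≠ v := by
    rintro rfl
    exact hr (Reachable.refl _)
  induction js generalizing i u v with
  | nil =>
    have hmp : G.oracle L (.pair i u v) = none :=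
      oracle_pair_eq_none fun hp => hr (reachable_of_mem_pairs hp)
    simp [locate, huv, hmp]
  | cons j js ih =>
    have hmp : G.oracle L (.pair i u v) = none :=
      oracle_pair_eq_none fun hp => hr (reachable_of_mem_pairs hp)
    rcases G.nearest_cases (L j) u with ⟨u', pu, hpu⟩ | ⟨hu, -⟩
    swap
    · have hmu : G.oracle L (.near j u) = none := hu
      simp [locate, huv, hmp, hmu]
      omega
    have hmu : G.oracle L (.near j u) = _ := hpu.nearest_eq
    rcases G.nearest_cases (L j) v with ⟨v', pv, hpv⟩ | ⟨hv, -⟩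
    swap
    · have hmv : G.oracle L (.near j v) = none := hv
      simp [locate, huv, hmp, hmu, hmv]
      omega
    have hmv : G.oracle L (.near j v) = _ := hpv.nearest_eq
    have hr' : ¬ G.graph.Reachable u' v' := fun hc =>
      hr ((pu.reachable.trans hc).trans pv.reachable.symm)
    obtain ⟨l1, l2⟩ := ih j u' v' hr' (by rintro rfl; exact hr' (Reachable.refl _))
    simp [locate, huv, hmp, hmu, hmv, l1]
    omega

/-- The radius of the search from `u`, as it is recorded in the memory. -/
def searchRadius (G : WGraph n) (S : Finset (Fin n)) (u : Fin n) : Option ℝ≥0 :=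
  (G.nearest S u).map (fun a => a.2.1)

theorem outside_searchRadius {S : Finset (Fin n)} {u : Fin n} {d : ℝ≥0} :
    outside (G.searchRadius S u) d = true ↔ G.radius S u ≤ d := by
  rcases G.nearest_cases S u with ⟨u', pu, hpu⟩ | ⟨hu, hu'⟩
  · rw [searchRadius, hpu.nearest_eq, hpu.radius_eq]
    simp [outside]
  · rw [searchRadius, hu, hu', Option.map_none]
    simp [outside]

section QueryCases

variable {M : Memory n h} {js : List (Fin h)} {u v : Fin n} {nu nv : Option (Fin n × ℝ≥0 × Fin n)}

/-- There is one lemma for each way in which a query with `u ≠ v` can end. Times are left as plain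
sums, to be combined with the bounds on the parts. -/
theorem query_of_explore_left (hjs : List.finRange h = i :: js) (huv : u ≠ v)
    (hu : M (.near i u) = nu) {l : List (Fin n)}
    (hE : (explore (nu.map (fun a => a.2.1)) u v : Prog n h _).eval M = some l) :
    (query u v : Prog n h _).eval M = some l ∧
      (query u v : Prog n h _).time M =
        1 + (1 + (1 + ((explore (nu.map (fun a => a.2.1)) u v : Prog n h _).time M + 0))) := by
  subst hu
  constructor
  · simp only [query, huv, hjs, if_false, Prog.eval_bind, Prog.eval_get_near, hE, Prog.eval_pure]
  · simp only [query, huv, hjs, if_false, Prog.time_bind, Prog.eval_get_near,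
      Prog.time_get_near, Prog.time_charge, hE, Prog.time_pure]

theorem query_of_explore_right (hjs : List.finRange h = i :: js) (huv : u ≠ v)
    (hu : M (.near i u) = nu) (hv : M (.near i v) = nv) {l : List (Fin n)}
    (hE : (explore (nu.map (fun a => a.2.1)) u v : Prog n h _).eval M = none)
    (hF : (explore (nv.map (fun a => a.2.1)) v u : Prog n h _).eval M = some l) :
    (query u v : Prog n h _).eval M = some l.reverse ∧
      (query u v : Prog n h _).time M =
        1 + (1 + (1 + ((explore (nu.map (fun a => a.2.1)) u v : Prog n h _).time M +
          ((explore (nv.map (fun a => a.2.1)) v u : Prog n h _).time M +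
            ((l.length + 1) + 0))))) := by
  subst hu hv
  constructor
  · simp only [query, huv, hjs, if_false, Prog.eval_bind, Prog.eval_get_near, hE, hF,
      Prog.eval_pure, (revOnto_spec _ _ _).1, List.append_nil]
  · simp only [query, huv, hjs, if_false, Prog.time_bind, Prog.eval_get_near,
      Prog.time_get_near, Prog.time_charge, hE, hF, Prog.time_pure, (revOnto_spec _ _ _).2]

theorem query_of_nearest_none (hjs : List.finRange h = i :: js) (huv : u ≠ v)
    (hu : M (.near i u) = nu) (hv : M (.near i v) = nv) (hn : nu = none ∨ nv = none)
    (hE : (explore (nu.map (fun a => a.2.1)) u v : Prog n h _).eval M = none)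
    (hF : (explore (nv.map (fun a => a.2.1)) v u : Prog n h _).eval M = none) :
    (query u v : Prog n h _).eval M = none ∧
      (query u v : Prog n h _).time M =
        1 + (1 + (1 + ((explore (nu.map (fun a => a.2.1)) u v : Prog n h _).time M +
          ((explore (nv.map (fun a => a.2.1)) v u : Prog n h _).time M + 0)))) := by
  rcases nu with _ | nu <;> rcases nv with _ | nv <;> [skip; skip; skip; simp at hn] <;>
  · constructor
    · simp only [query, huv, hjs, if_false, Prog.eval_bind, Prog.eval_get_near, hE, hF, hu, hv,
        Prog.eval_pure]
    · simp only [query, huv, hjs, if_false, Prog.time_bind, Prog.eval_get_near,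
        Prog.time_get_near, Prog.time_charge, hE, hF, hu, hv, Prog.time_pure]

variable {u' v' a b : Fin n} {c d : ℝ≥0}

theorem query_of_locate_none (hjs : List.finRange h = i :: js) (huv : u ≠ v)
    (hu : M (.near i u) = nu) (hv : M (.near i v) = nv)
    (hu' : nu = some (u', c, a)) (hv' : nv = some (v', d, b))
    (hE : (explore (nu.map (fun a => a.2.1)) u v : Prog n h _).eval M = none)
    (hF : (explore (nv.map (fun a => a.2.1)) v u : Prog n h _).eval M = none)
    (hl : (locate i js u' v' : Prog n h _).eval M = none) :
    (query u v : Prog n h _).eval M = none ∧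
      (query u v : Prog n h _).time M =
        1 + (1 + (1 + ((explore (nu.map (fun a => a.2.1)) u v : Prog n h _).time M +
          ((explore (nv.map (fun a => a.2.1)) v u : Prog n h _).time M +
            ((locate i js u' v' : Prog n h _).time M + 0))))) := by
  subst hu' hv'
  constructor
  · simp only [query, huv, hjs, if_false, Prog.eval_bind, Prog.eval_get_near, hE, hF, hu, hv, hl,
      Prog.eval_pure]
  · simp only [query, huv, hjs, if_false, Prog.time_bind, Prog.eval_get_near,
      Prog.time_get_near, Prog.time_charge, hE, hF, hu, hv, hl, Prog.time_pure]

theorem query_of_locate_some (hjs : List.finRange h = i :: js) (huv : u ≠ v)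
    (hu : M (.near i u) = nu) (hv : M (.near i v) = nv)
    (hu' : nu = some (u', c, a)) (hv' : nv = some (v', d, b))
    (hE : (explore (nu.map (fun a => a.2.1)) u v : Prog n h _).eval M = none)
    (hF : (explore (nv.map (fun a => a.2.1)) v u : Prog n h _).eval M = none) {ls : List (Fin h)}
    (hl : (locate i js u' v' : Prog n h _).eval M = some ls) :
    (query u v : Prog n h _).eval M =
        some ((report i (i :: ls) u v [] : Prog n h _).eval M) ∧
      (query u v : Prog n h _).time M =
        1 + (1 + (1 + ((explore (nu.map (fun a => a.2.1)) u v : Prog n h _).time M +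
          ((explore (nv.map (fun a => a.2.1)) v u : Prog n h _).time M +
            ((locate i js u' v' : Prog n h _).time M +
              ((report i (i :: ls) u v [] : Prog n h _).time M + 0)))))) := by
  subst hu' hv'
  constructor
  · simp only [query, huv, hjs, if_false, Prog.eval_bind, Prog.eval_get_near, hE, hF, hu, hv, hl,
      Prog.eval_pure]
  · simp only [query, huv, hjs, if_false, Prog.time_bind, Prog.eval_get_near,
      Prog.time_get_near, Prog.time_charge, hE, hF, hu, hv, hl, Prog.time_pure]

end QueryCases

/-- If both searches fail, both first-level radii are at most the distance `d` of `u` and `v`, so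
the first landmarks are at distance at most `3d`. `locate` costs 3 units per level and `report`
costs 4, whence `7 * h`. -/
theorem query_spec (L : Fin h → Finset (Fin n)) (hh : 0 < h) (u v : Fin n) :
    (G.graph.Reachable u v → ∃ p : G.graph.Walk u v,
      (query u v : Prog n h _).eval (G.oracle L) = some p.support ∧
      (G.len p : ℝ≥0∞) ≤ ((6 * 7 ^ (h - 1) - 1 : ℕ) : ℝ≥0∞) * G.dist u v) ∧
    (¬ G.graph.Reachable u v → (query u v : Prog n h _).eval (G.oracle L) = none) ∧
    (query u v : Prog n h _).time (G.oracle L) ≤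
      searchTime (G.searchSize (G.searchRadius (L ⟨0, hh⟩) u) u) +
      searchTime (G.searchSize (G.searchRadius (L ⟨0, hh⟩) v) v) +
      3 * hops ((query u v : Prog n h _).eval (G.oracle L)) + 7 * h + 20 := by
  have hone : 1 ≤ 6 * 7 ^ (h - 1) - 1 := by
    have : 0 < 7 ^ (h - 1) := by positivity
    omega
  by_cases huv : u = v
  · subst huv
    refine ⟨fun _ => ⟨.nil, by simp [query], by simp⟩, fun hc => absurd (Reachable.refl _) hc, ?_⟩
    simp [query]
  set i : Fin h := ⟨0, hh⟩
  obtain ⟨js, hjs⟩ : ∃ js, List.finRange h = i :: js :=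
    ⟨(List.finRange h).drop 1, by
      have := List.drop_eq_getElem_cons (l := List.finRange h) (i := 0) (by simpa using hh)
      rw [List.drop_zero] at this
      rw [this]
      congr 1
      simp [i]⟩
  have hjs' : js = (List.finRange h).drop (i + 1) := by rw [hjs]; simp [i]
  have hlen : js.length = h - 1 := by
    have := congrArg List.length hjs
    rw [List.length_finRange, List.length_cons] at this
    omega
  have hshort : ∀ p : G.graph.Walk u v, G.dist u v = G.len p →
      (G.len p : ℝ≥0∞) ≤ ((6 * 7 ^ (h - 1) - 1 : ℕ) : ℝ≥0∞) * G.dist u v := by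
    intro p hp
    rw [hp]
    calc (G.len p : ℝ≥0∞) = ((1 : ℕ) : ℝ≥0∞) * G.len p := by simp
      _ ≤ _ := by gcongr
  have hmu : G.oracle L (.near i u) = G.nearest (L i) u := rfl
  have hmv : G.oracle L (.near i v) = G.nearest (L i) v := rfl
  obtain ⟨e1, e2, e3⟩ := G.explore_spec L (G.searchRadius (L i) u) u v
  obtain ⟨f1, f2, f3⟩ := G.explore_spec L (G.searchRadius (L i) v) v u
  cases hE : (explore (G.searchRadius (L i) u) u v : Prog n h _).eval (G.oracle L) with
  | some l =>
    obtain ⟨p, rfl, hp⟩ := e2 l hE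
    obtain ⟨hq, ht⟩ := query_of_explore_left hjs huv hmu hE
    refine ⟨fun _ => ⟨p, hq, hshort p hp⟩, fun hc => absurd p.reachable hc, ?_⟩
    rw [hq, ht]
    rw [hE] at e3
    simp only [searchRadius] at e3 ⊢
    omega
  | none =>
  rw [hE] at e3
  cases hF : (explore (G.searchRadius (L i) v) v u : Prog n h _).eval (G.oracle L) with
  | some l =>
    obtain ⟨p, rfl, hp⟩ := f2 l hF
    obtain ⟨hq, ht⟩ := query_of_explore_right hjs huv hmu hmv hE hF
    rw [← Walk.support_reverse] at hq
    refine ⟨fun _ => ⟨p.reverse, hq, hshort _ ?_⟩, fun hc => absurd p.reachable.symm hc, ?_⟩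
    · rw [G.dist_comm, hp, len_reverse]
    · rw [hq, ht]
      rw [hF] at f3
      simp only [searchRadius, hops, Option.getD_some, Option.getD_none, List.length_nil,
        Walk.length_support, Walk.length_reverse] at *
      omega
  | none =>
  rw [hF] at f3
  simp only [hops, Option.getD_none, List.length_nil] at e3 f3
  -- Consequently an infinite radius on either side proves that `u` and `v` are not connected.
  have hrad : G.graph.Reachable u v →
      G.radius (L i) u ≤ G.dist u v ∧ G.radius (L i) v ≤ G.dist u v := by
    intro hr
    obtain ⟨p, hp⟩ := exists_len_eq_dist hr
    rw [hp]
    exact ⟨outside_searchRadius.1 (e1 hE _ hp),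
      outside_searchRadius.1 (f1 hF _ (by rw [G.dist_comm, hp]))⟩
  rcases G.nearest_cases (L i) u with ⟨u', pu, hpu⟩ | ⟨hu, hu'⟩
  swap
  · have hr : ¬ G.graph.Reachable u v := fun hr =>
      absurd (top_le_iff.1 (hu' ▸ (hrad hr).1)) (dist_ne_top_iff.2 hr)
    obtain ⟨hq, ht⟩ := query_of_nearest_none hjs huv hmu hmv (by simp [hu]) hE hF
    refine ⟨fun hc => absurd hc hr, fun _ => hq, ?_⟩
    rw [hq, ht]
    rw [searchRadius] at e3 f3
    simp only [searchRadius]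
    omega
  rcases G.nearest_cases (L i) v with ⟨v', pv, hpv⟩ | ⟨hv, hv'⟩
  swap
  · have hr : ¬ G.graph.Reachable u v := fun hr =>
      absurd (top_le_iff.1 (hv' ▸ (hrad hr).2)) (dist_ne_top_iff.2 hr)
    obtain ⟨hq, ht⟩ := query_of_nearest_none hjs huv hmu hmv (by simp [hv]) hE hF
    refine ⟨fun hc => absurd hc hr, fun _ => hq, ?_⟩
    rw [hq, ht]
    rw [searchRadius] at e3 f3
    simp only [searchRadius]
    omega
  by_cases hr : G.graph.Reachable u v
  swap
  · have hr' : ¬ G.graph.Reachable u' v' := fun hc =>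
      hr ((pu.reachable.trans hc).trans pv.reachable.symm)
    obtain ⟨l1, l2⟩ := locate_eq_none (L := L) js i u' v' hr'
    obtain ⟨hq, ht⟩ := query_of_locate_none hjs huv hmu hmv hpu.nearest_eq hpv.nearest_eq hE hF l1
    refine ⟨fun hc => absurd hc hr, fun _ => hq, ?_⟩
    rw [hq, ht]
    rw [searchRadius] at e3 f3
    simp only [searchRadius]
    omega
  · have hr' : G.graph.Reachable u' v' := (pu.reachable.symm.trans hr).trans pv.reachable
    obtain ⟨hru, hrv⟩ := hrad hr
    rw [hpu.radius_eq] at hru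
    rw [hpv.radius_eq] at hrv
    have hd : G.dist u' v' ≤ 3 * G.dist u v := by
      calc G.dist u' v' ≤ G.dist u' u + G.dist u v' := G.dist_triangle _ _ _
        _ ≤ G.dist u' u + (G.dist u v + G.dist v v') := by gcongr; exact G.dist_triangle _ _ _
        _ ≤ G.dist u v + (G.dist u v + G.dist u v) := by
          rw [G.dist_comm u' u, hpu.dist_eq, hpv.dist_eq]
          gcongr
        _ = 3 * G.dist u v := by ring
    obtain ⟨ls, l1, l2, l3⟩ := locate_spec js i hjs' u' v' hpu.1 hpv.1 hr'
    obtain ⟨p, p1, p2, p3⟩ := report_cons_spec (i := i) hpu hpv l3 []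
    rw [List.append_nil] at p1
    obtain ⟨hq, ht⟩ := query_of_locate_some hjs huv hmu hmv hpu.nearest_eq hpv.nearest_eq hE hF l1
    rw [p1] at hq
    refine ⟨fun _ => ⟨p, hq, p2.trans ?_⟩, fun hc => absurd hr hc, ?_⟩
    -- Three times the stretch from the first landmarks on, plus the way from `u` and `v` to them.
    · have h7 : 6 * 7 ^ (h - 1) - 1 = 3 * (2 * 7 ^ js.length - 1) + 2 := by
        have : 0 < 7 ^ (h - 1) := by positivity
        rw [hlen]
        omega
      rw [h7]
      calc (G.len pu : ℝ≥0∞) + ((2 * 7 ^ js.length - 1 : ℕ) : ℝ≥0∞) * G.dist u' v' + G.len pv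
          ≤ G.dist u v + ((2 * 7 ^ js.length - 1 : ℕ) : ℝ≥0∞) * (3 * G.dist u v) +
              G.dist u v := by gcongr
        _ = ((3 * (2 * 7 ^ js.length - 1) + 2 : ℕ) : ℝ≥0∞) * G.dist u v := by
          rw [Nat.cast_add, Nat.cast_mul]
          push_cast
          ring
    · rw [hq, ht]
      rw [searchRadius] at e3 f3
      simp only [searchRadius, hops, Option.getD_some, Walk.length_support]
      omega

end WGraph

/-! ### Selections of virtual nodes on one level -/

section Level

variable {ι : Type*} [Fintype ι]

/-- The distribution of the selection on one level. -/
def levelMeasure (ι : Type*) [Fintype ι] (p : unitInterval) : Measure (ι → Bool) :=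
  Measure.pi fun _ => ProbabilityTheory.bernoulliMeasure true false p

instance (p : unitInterval) : IsProbabilityMeasure (levelMeasure ι p) := by
  unfold levelMeasure; infer_instance

theorem levelMeasure_forall_true (p : unitInterval) (S : Finset ι) :
    levelMeasure ι p {y | ∀ a ∈ S, y a = true} = ENNReal.ofReal p ^ S.card := by
  have h1 : {y : ι → Bool | ∀ a ∈ S, y a = true} = (S : Set ι).pi fun _ => {true} := by
    ext y; simp
  rw [h1, levelMeasure, Measure.pi_pi_finset, Finset.prod_const,
    ProbabilityTheory.bernoulliMeasure_apply p (measurableSet_singleton _)]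
  simp [ENNReal.ofReal, unitInterval.toNNReal, Real.toNNReal_of_nonneg p.2.1]
  rfl

theorem levelMeasure_forall_false (p : unitInterval) (S : Finset ι) :
    levelMeasure ι p {y | ∀ a ∈ S, y a = false} = ENNReal.ofReal (1 - p) ^ S.card := by
  have h1 : {y : ι → Bool | ∀ a ∈ S, y a = false} = (S : Set ι).pi fun _ => {false} := by
    ext y; simp
  rw [h1, levelMeasure, Measure.pi_pi_finset, Finset.prod_const,
    ProbabilityTheory.bernoulliMeasure_apply p (measurableSet_singleton _)]
  simp [ENNReal.ofReal, unitInterval.toNNReal, Real.toNNReal_of_nonneg (sub_nonneg.2 p.2.2)]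
  rfl

/-- The number of nodes closer than every selected node is unlikely to be large. -/
theorem levelMeasure_card_below_le (p : unitInterval) (D : ι → ℝ≥0∞) (k : ℕ)
    (B : (ι → Bool) → Finset ι)
    (hB : ∀ y, ∃ t : ℝ≥0∞, B y = Finset.univ.filter fun a => D a < t)
    (hfalse : ∀ y, ∀ a ∈ B y, y a = false) :
    levelMeasure ι p {y | k ≤ (B y).card} ≤ ENNReal.ofReal (1 - p) ^ k := by
  classical
  by_cases hex : ∃ y, k ≤ (B y).card
  swap
  · push Not at hex
    have : {y | k ≤ (B y).card} = ∅ := by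
      ext y
      simpa using hex y
    simp [this]
  -- The sets `B y` form a chain. The smallest one with at least `k` elements is a fixed set
  -- contained in every larger one, so the event forces all its nodes to be unselected.
  obtain ⟨y₀, hy₀, hmin⟩ := Set.exists_min_image {y | k ≤ (B y).card} (fun y => (B y).card)
    (Set.toFinite _) hex
  have hsub : {y | k ≤ (B y).card} ⊆ {y | ∀ a ∈ B y₀, y a = false} := by
    intro y hy a ha
    apply hfalse y
    obtain ⟨t, ht⟩ := hB y
    obtain ⟨t₀, ht₀⟩ := hB y₀
    have hcard := hmin y hy
    rcases le_total t₀ t with h | h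
    · rw [ht]
      rw [ht₀] at ha
      simp only [Finset.mem_filter, Finset.mem_univ, true_and] at ha ⊢
      exact ha.trans_le h
    · have : B y ⊆ B y₀ := by
        rw [ht, ht₀]
        intro b hb
        simp only [Finset.mem_filter, Finset.mem_univ, true_and] at hb ⊢
        exact hb.trans_le h
      rwa [Finset.eq_of_subset_of_card_le this hcard]
  calc levelMeasure ι p {y | k ≤ (B y).card} ≤ levelMeasure ι p {y | ∀ a ∈ B y₀, y a = false} :=
        measure_mono hsub
    _ = ENNReal.ofReal (1 - p) ^ (B y₀).card := levelMeasure_forall_false p _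
    _ ≤ _ := pow_le_pow_right_of_le_one' (by
        rw [ENNReal.ofReal_le_one]; linarith [p.2.1]) hy₀

end Level

section Nodes

variable {R : Rule} {n : ℕ} {G : WGraph n} {h : ℕ}

open Classical in
/-- The vertices with a selected virtual node. -/
def selectedVertices (y : VNode R G → Bool) : Finset (Fin n) :=
  Finset.univ.filter fun v => ∃ c : Fin (R.copies G v), y ⟨v, c⟩ = true

theorem landmarks_eq (ω : Sample R G h) (i : Fin h) : landmarks ω i = selectedVertices (ω i) :=
  rfl

/-- The virtual nodes in the ball of `u`. -/
def ballNodes (y : VNode R G → Bool) (u : Fin n) : Finset (VNode R G) :=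
  Finset.univ.filter fun a => G.dist u a.1 < G.radius (selectedVertices y) u

theorem eq_false_of_mem_ballNodes {y : VNode R G → Bool} {u : Fin n} {a : VNode R G}
    (ha : a ∈ ballNodes y u) : y a = false := by
  simp only [ballNodes, Finset.mem_filter, Finset.mem_univ, true_and] at ha
  by_contra hc
  have hmem : a.1 ∈ selectedVertices y := by
    simp only [selectedVertices, Finset.mem_filter, Finset.mem_univ, true_and]
    exact ⟨a.2, by simpa using hc⟩
  exact absurd ha (not_lt.2 (iInf₂_le a.1 hmem))

theorem levelMeasure_ballNodes_le (p : unitInterval) (u : Fin n) (k : ℕ) :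
    levelMeasure (VNode R G) p {y | k ≤ (ballNodes y u).card} ≤ ENNReal.ofReal (1 - p) ^ k :=
  levelMeasure_card_below_le p (fun a : VNode R G => G.dist u a.1) k (fun y => ballNodes y u)
    (fun _ => ⟨_, rfl⟩) (fun _ _ => eq_false_of_mem_ballNodes)

theorem sampleMeasure_eq (R : Rule) (G : WGraph n) (h : ℕ) :
    sampleMeasure R G h = Measure.pi fun i => levelMeasure (VNode R G) (sampleProb n h i) := rfl

instance : IsProbabilityMeasure (sampleMeasure R G h) := by
  rw [sampleMeasure_eq]; infer_instance

theorem measurableSet_of_level {ι : Type*} [Fintype ι] (s : Set (ι → Bool)) : MeasurableSet s :=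
  (Set.toFinite s).measurableSet

theorem measurableSet_of_sample (s : Set (Sample R G h)) : MeasurableSet s :=
  (Set.toFinite s).measurableSet

theorem sampleMeasure_level (i : Fin h) (s : Set (VNode R G → Bool)) :
    sampleMeasure R G h {ω | ω i ∈ s} = levelMeasure (VNode R G) (sampleProb n h i) s := by
  rw [sampleMeasure_eq]
  exact (measurePreserving_eval (fun i => levelMeasure (VNode R G) (sampleProb n h i))
    i).measure_preimage (measurableSet_of_level s).nullMeasurableSet

end Nodes

/-! ### The size of a search -/

namespace WGraph

variable {R : Rule} {n : ℕ} {G : WGraph n}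

theorem card_ballNodes (y : VNode R G → Bool) (u : Fin n) :
    (ballNodes y u).card =
      ∑ x with G.dist u x < G.radius (selectedVertices y) u, R.copies G x := by
  have : ballNodes y u = (Finset.univ.filter fun x : Fin n =>
      G.dist u x < G.radius (selectedVertices y) u).sigma fun x => Finset.univ := by
    ext a
    simp [ballNodes]
  rw [this, Finset.card_sigma]
  simp

-- An edge is inserted only if `d(u, x)` plus its weight is below the radius, which puts both of its
-- endpoints into the ball.
open Classical in
theorem searchSize_le_sum (S : Finset (Fin n)) (u : Fin n) :
    G.searchSize (G.searchRadius S u) u ≤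
      ∑ x with G.dist u x < G.radius S u,
        (Finset.univ.filter fun y => G.graph.Adj x y ∧ G.dist u y < G.radius S u).card := by
  have hin : ∀ x y (d : ℝ≥0), G.dist u x = d → y ∈ G.relaxed (G.searchRadius S u) x d →
      G.graph.Adj x y ∧ G.dist u x < G.radius S u ∧ G.dist u y < G.radius S u := by
    intro x y d hd hy
    rw [mem_relaxed] at hy
    have h1 : (↑(d + G.weight s(x, y)) : ℝ≥0∞) < G.radius S u := by
      rw [← not_le, ← outside_searchRadius, hy.2]
      simp
    rw [ENNReal.coe_add, ← hd] at h1
    exact ⟨hy.1, le_self_add.trans_lt h1,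
      ((G.dist_triangle u x y).trans (by gcongr; exact dist_le_of_adj hy.1)).trans_lt h1⟩
  rw [searchSize, Finset.sum_filter]
  refine Finset.sum_le_sum fun x _ => ?_
  unfold insertions
  split_ifs with h1 h2 h2
  · exact Nat.zero_le _
  · exact Nat.zero_le _
  · rw [← List.toFinset_card_of_nodup G.nodup_relaxed]
    refine Finset.card_le_card fun y hy => ?_
    rw [List.mem_toFinset] at hy
    have := hin x y _ (ENNReal.coe_toNNReal h1).symm hy
    simp [this]
  · rw [Nat.le_zero, List.length_eq_zero_iff, List.eq_nil_iff_forall_not_mem]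
    exact fun y hy => h2 (hin x y _ (ENNReal.coe_toNNReal h1).symm hy).2.1

/-- Apart from rounding up, only density zero needs care: division by zero then yields no copies,
but the graph has no edges either. -/
theorem deg_le_density_mul_copies (x : Fin n) :
    (G.deg x : ℝ≥0) ≤ Rule.byDegree.density G * (Rule.byDegree.copies G x : ℝ≥0) := by
  by_cases h0 : Rule.byDegree.density G = 0
  · have h1 : G.numEdges = 0 := by
      have hn : (n : ℝ≥0) ≠ 0 := by
        have := x.pos
        exact_mod_cast this.ne'
      simp only [Rule.density, div_eq_zero_iff, hn, or_false] at h0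
      exact_mod_cast h0
    have h2 : G.deg x = 0 := by
      rw [numEdges, Set.ncard_eq_zero] at h1
      rw [deg, Set.ncard_eq_zero]
      ext y
      simp only [SimpleGraph.mem_neighborSet, Set.mem_empty_iff_false, iff_false]
      intro hxy
      have : s(x, y) ∈ G.graph.edgeSet := hxy
      rw [h1] at this
      exact this
    simp [h2]
  · have := Nat.le_ceil ((G.deg x : ℝ≥0) / Rule.byDegree.density G)
    rw [div_le_iff₀' (pos_iff_ne_zero.2 h0)] at this
    exact this

open Classical in
theorem sum_card_adj_le (B : Finset (Fin n)) :
    ∑ x ∈ B, (Finset.univ.filter fun y => G.graph.Adj x y ∧ y ∈ B).card ≤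
      2 * G.inducedEdges B := by
  rw [← Finset.card_sigma]
  have hfin : {e ∈ G.graph.edgeSet | ∀ x ∈ e, x ∈ B}.Finite := Set.toFinite _
  rw [inducedEdges, Set.ncard_eq_toFinset_card _ hfin]
  refine Finset.card_le_mul_card_image_of_maps_to
    (f := fun a : Σ _ : Fin n, Fin n => s(a.1, a.2)) (fun a ha => ?_) 2 (fun e _ => ?_)
  · simp only [Finset.mem_sigma, Finset.mem_filter, Finset.mem_univ, true_and] at ha
    simp only [Set.Finite.mem_toFinset]
    refine ⟨ha.2.1, fun x hx => ?_⟩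
    rcases Sym2.mem_iff.1 hx with rfl | rfl
    · exact ha.1
    · exact ha.2.2
  · induction e with
    | _ a b =>
      refine (Finset.card_le_card (t := {⟨a, b⟩, ⟨b, a⟩}) fun c hc => ?_).trans Finset.card_le_two
      simp only [Finset.mem_filter, Sym2.eq_iff] at hc
      obtain ⟨c, d⟩ := c
      rcases hc.2 with ⟨h1, h2⟩ | ⟨h1, h2⟩ <;> simp_all

theorem inducedEdges_le_arboricity_mul (B : Finset (Fin n)) (hB : 2 ≤ B.card) :
    (G.inducedEdges B : ℝ≥0) ≤ G.arboricity * B.card := by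
  have h1 : (G.inducedEdges B : ℝ≥0) / ((B.card - 1 : ℕ) : ℝ≥0) ≤ G.arboricity :=
    Finset.le_sup (f := fun U : Finset (Fin n) =>
      (G.inducedEdges U : ℝ≥0) / ((U.card - 1 : ℕ) : ℝ≥0)) (by simpa using hB)
  have hpos : (0 : ℝ≥0) < ((B.card - 1 : ℕ) : ℝ≥0) := by
    have : 0 < B.card - 1 := by omega
    exact_mod_cast this
  rw [div_le_iff₀ hpos] at h1
  refine h1.trans ?_
  gcongr
  omega

/-- For the uniform rule the arboricity bounds the number of edges inside the ball, each of which is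
inserted at most twice; for the other rule the degrees in the ball are bounded by the copies. -/
theorem searchSize_le_density_mul (y : VNode R G → Bool) (u : Fin n) :
    (G.searchSize (G.searchRadius (selectedVertices y) u) u : ℝ≥0) ≤
      2 * R.density G * ((ballNodes y u).card : ℝ≥0) := by
  classical
  rw [card_ballNodes]
  have h0 := G.searchSize_le_sum (selectedVertices y) u
  set B := Finset.univ.filter fun x => G.dist u x < G.radius (selectedVertices y) u with hB
  cases R with
  | uniform =>
    have h1 : ∑ x ∈ B, Rule.uniform.copies G x = B.card := by simp [Rule.copies]
    rw [h1]
    have h2 : G.searchSize (G.searchRadius (selectedVertices y) u) u ≤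
        ∑ x ∈ B, (Finset.univ.filter fun y => G.graph.Adj x y ∧ y ∈ B).card := by
      refine h0.trans (le_of_eq ?_)
      refine Finset.sum_congr rfl fun x _ => ?_
      congr 1
      ext z
      simp [hB]
    by_cases hcard : 2 ≤ B.card
    · calc (G.searchSize (G.searchRadius (selectedVertices y) u) u : ℝ≥0)
          ≤ ((2 * G.inducedEdges B : ℕ) : ℝ≥0) := by exact_mod_cast h2.trans (sum_card_adj_le B)
        _ = 2 * (G.inducedEdges B : ℝ≥0) := by push_cast; ring
        _ ≤ 2 * (G.arboricity * B.card) := by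
          gcongr
          exact inducedEdges_le_arboricity_mul B hcard
        _ = _ := by rw [mul_assoc]; rfl
    -- The arboricity says nothing about sets with fewer than two vertices, but these contain no
    -- edges.
    · have h3 : ∑ x ∈ B, (Finset.univ.filter fun y => G.graph.Adj x y ∧ y ∈ B).card = 0 := by
        refine Finset.sum_eq_zero fun x hx => ?_
        rw [Finset.card_eq_zero, Finset.filter_eq_empty_iff]
        rintro z - ⟨hxz, hz⟩
        exact hxz.ne (Finset.card_le_one.1 (by omega) x hx z hz)
      rw [h3, Nat.le_zero] at h2
      rw [h2]
      simp
  | byDegree =>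
    have h2 : G.searchSize (G.searchRadius (selectedVertices y) u) u ≤ ∑ x ∈ B, G.deg x := by
      refine h0.trans (Finset.sum_le_sum fun x _ => ?_)
      rw [deg, Set.ncard_eq_toFinset_card _ (Set.toFinite _)]
      refine Finset.card_le_card fun z hz => ?_
      simp only [Finset.mem_filter, Finset.mem_univ, true_and] at hz
      simp [hz.1]
    calc (G.searchSize (G.searchRadius (selectedVertices y) u) u : ℝ≥0)
        ≤ ((∑ x ∈ B, G.deg x : ℕ) : ℝ≥0) := by exact_mod_cast h2
      _ = ∑ x ∈ B, (G.deg x : ℝ≥0) := by push_cast; rfl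
      _ ≤ ∑ x ∈ B, Rule.byDegree.density G * (Rule.byDegree.copies G x : ℝ≥0) :=
        Finset.sum_le_sum fun x _ => deg_le_density_mul_copies x
      _ = Rule.byDegree.density G * ((∑ x ∈ B, Rule.byDegree.copies G x : ℕ) : ℝ≥0) := by
        rw [← Finset.mul_sum]; push_cast; rfl
      _ ≤ _ := by
        gcongr
        exact le_mul_of_one_le_left zero_le (by norm_num)

/-! ### The time of a search -/

/-- The constant is kept apart from the logarithmic term because a search without insertions, as for
`λ = 0`, still takes constant time. The logarithm comes from `K + 2 ≤ n ^ 3`. -/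
theorem searchTime_le {n K : ℕ} (hn : 2 ≤ n) (hK : K ≤ n * n) :
    (searchTime K : ℝ) ≤ 6 + 40 * (K * Real.log n) := by
  have hlog : 0 ≤ Real.log n := Real.log_natCast_nonneg n
  rcases Nat.eq_zero_or_pos K with rfl | hpos
  · rw [show searchTime 0 = 6 by decide]
    norm_num
  set m := Nat.log 2 (K + 1 + 1) with hm
  have h1 : (m : ℝ) * Real.log 2 ≤ 3 * Real.log n := by
    have h2 : 2 ^ m ≤ n ^ 3 := by
      refine (Nat.pow_log_le_self 2 (by omega)).trans ?_
      have : 2 * (n * n) ≤ n ^ 3 := by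
        rw [pow_succ, pow_two, mul_comm (n * n)]
        exact Nat.mul_le_mul_right _ hn
      nlinarith
    have h3 : ((2 : ℝ) ^ m) ≤ (n : ℝ) ^ 3 := by exact_mod_cast h2
    have := Real.log_le_log (by positivity) h3
    rw [Real.log_pow, Real.log_pow] at this
    exact_mod_cast this
  have h2 : Real.log 2 ≤ Real.log n := Real.log_le_log (by norm_num) (by exact_mod_cast hn)
  have h3 := Real.log_two_gt_d9
  have hK1 : (1 : ℝ) ≤ K := by exact_mod_cast hpos
  have h4 : (searchTime K : ℝ) = (2 * m + 1) + 2 + K * (2 * (2 * m + 1) + 3) + 1 := by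
    simp [searchTime, Heap.mergeBound, hm]
  have hm0 : (0 : ℝ) ≤ m := Nat.cast_nonneg _
  have h5 : (searchTime K : ℝ) ≤ K * (6 * m + 9) := by
    rw [h4]
    nlinarith
  have h6 : (6 * m + 9 : ℝ) ≤ 40 * Real.log n := by nlinarith
  calc (searchTime K : ℝ) ≤ K * (6 * m + 9) := h5
    _ ≤ K * (40 * Real.log n) := by gcongr
    _ ≤ _ := by nlinarith

end WGraph

/-! ### The query time with high probability -/

theorem one_sub_pow_le_exp {p T : ℝ} (hp : p ≤ 1) {k : ℕ} (hk : T ≤ k) (hp0 : 0 ≤ p) :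
    (1 - p) ^ k ≤ Real.exp (-(p * T)) := by
  calc (1 - p) ^ k ≤ Real.exp (-p) ^ k := by
        refine pow_le_pow_left₀ (by linarith) ?_ k
        linarith [Real.add_one_le_exp (-p)]
    _ = Real.exp (-(p * k)) := by rw [← Real.exp_nat_mul]; ring_nf
    _ ≤ _ := by gcongr

theorem sampleProb_zero {n h : ℕ} (hn : 0 < n) (hh : 0 < h) :
    (sampleProb n h ⟨0, hh⟩ : ℝ) * (n : ℝ) ^ ((3 / 4 : ℝ) ^ h) = 1 := by
  have hn' : (0 : ℝ) < n := by exact_mod_cast hn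
  simp only [sampleProb, rho, Nat.sub_zero]
  rw [div_mul_eq_mul_div, ← Real.rpow_add hn']
  simp [hn'.ne']

/-- With high probability no first-level ball contains many virtual nodes. -/
theorem sampleMeasure_ballNodes_le {R : Rule} {n : ℕ} (G : WGraph n) {h : ℕ} (hh : 0 < h)
    (hn : 0 < n) (c : ℝ) :
    (sampleMeasure R G h).real {ω | ∃ u, (c + 1) * (n : ℝ) ^ ((3 / 4 : ℝ) ^ h) * Real.log n <
      ((ballNodes (ω ⟨0, hh⟩) u).card : ℝ)} ≤ (n : ℝ) ^ (-c) := by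
  have hn' : (0 : ℝ) < n := by exact_mod_cast hn
  set i : Fin h := ⟨0, hh⟩
  -- The first-level probability times `T` is `(c + 1) * log n`, so one ball fails with probability
  -- at most `n ^ (-(c + 1))`; the union over all vertices costs a factor `n`.
  set T := (c + 1) * (n : ℝ) ^ ((3 / 4 : ℝ) ^ h) * Real.log n with hT
  have hu : ∀ u : Fin n, (sampleMeasure R G h).real
      {ω | T < ((ballNodes (ω i) u).card : ℝ)} ≤ (n : ℝ) ^ (-(c + 1)) := by
    intro u
    have h1 : {ω : Sample R G h | T < ((ballNodes (ω i) u).card : ℝ)} ⊆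
        {ω | ω i ∈ {y | ⌈T⌉₊ ≤ (ballNodes y u).card}} := by
      intro ω hω
      exact Nat.ceil_le.2 (le_of_lt hω)
    have h2 : sampleMeasure R G h {ω | T < ((ballNodes (ω i) u).card : ℝ)} ≤
        ENNReal.ofReal ((n : ℝ) ^ (-(c + 1))) := by
      refine (measure_mono h1).trans ?_
      rw [sampleMeasure_level]
      refine (levelMeasure_ballNodes_le _ u _).trans ?_
      rw [← ENNReal.ofReal_pow (sub_nonneg.2 (sampleProb n h i).2.2)]
      apply ENNReal.ofReal_le_ofReal
      refine (one_sub_pow_le_exp (sampleProb n h i).2.2 (Nat.le_ceil T)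
        (sampleProb n h i).2.1).trans (le_of_eq ?_)
      rw [Real.rpow_def_of_pos hn']
      congr 1
      have := sampleProb_zero hn hh
      calc -((sampleProb n h i : ℝ) * T)
          = -(((sampleProb n h i : ℝ) * (n : ℝ) ^ ((3 / 4 : ℝ) ^ h)) * (c + 1) * Real.log n) := by
            rw [hT]; ring
        _ = _ := by rw [this]; ring
    exact ENNReal.toReal_le_of_le_ofReal (by positivity) h2
  calc (sampleMeasure R G h).real {ω | ∃ u, T < ((ballNodes (ω i) u).card : ℝ)}
      = (sampleMeasure R G h).real (⋃ u, {ω | T < ((ballNodes (ω i) u).card : ℝ)}) := by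
        congr 1; ext ω; simp
    _ ≤ ∑ u, (sampleMeasure R G h).real {ω | T < ((ballNodes (ω i) u).card : ℝ)} :=
        measureReal_iUnion_fintype_le _
    _ ≤ ∑ _u : Fin n, (n : ℝ) ^ (-(c + 1)) := Finset.sum_le_sum fun u _ => hu u
    _ = (n : ℝ) ^ (-c) := by
        rw [Finset.sum_const, Finset.card_univ, Fintype.card_fin, nsmul_eq_mul, neg_add,
          Real.rpow_add hn', Real.rpow_neg_one]
        field_simp

/-- Two searches give `160 * (c + 1)`; the summand `40` absorbs all additive constants, since `1 ≤
h`. -/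
theorem query_time_le {R : Rule} {n : ℕ} {G : WGraph n} {h : ℕ} (hh : 0 < h) (ω : Sample R G h)
    {c : ℝ} (hc : 0 ≤ c) (u v : Fin n)
    (hω : ∀ u, ((ballNodes (ω ⟨0, hh⟩) u).card : ℝ) ≤
      (c + 1) * (n : ℝ) ^ ((3 / 4 : ℝ) ^ h) * Real.log n) :
    ((query u v).time (Lambda ω) : ℝ) ≤
      (160 * (c + 1) + 40) * ((n : ℝ) ^ ((3 / 4 : ℝ) ^ h) * (R.density G : ℝ) * Real.log n ^ 2) +
        (160 * (c + 1) + 40) * ((hops ((query u v).eval (Lambda ω)) : ℝ) + h) := by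
  have hlog : 0 ≤ Real.log n := Real.log_natCast_nonneg n
  set X := (n : ℝ) ^ ((3 / 4 : ℝ) ^ h)
  have hX : 0 ≤ X := by positivity
  set A : ℝ := (R.density G : ℝ)
  have hA : 0 ≤ A := NNReal.coe_nonneg _
  have hsearch : ∀ x, (WGraph.searchTime (G.searchSize
      (G.searchRadius (landmarks ω ⟨0, hh⟩) x) x) : ℝ) ≤
        6 + 80 * (c + 1) * (X * A * Real.log n ^ 2) := by
    intro x
    set K := G.searchSize (G.searchRadius (landmarks ω ⟨0, hh⟩) x) x with hK
    have h1 : (K : ℝ) ≤ 2 * A * ((c + 1) * X * Real.log n) := by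
      have h2 : (K : ℝ) ≤ 2 * A * ((ballNodes (ω ⟨0, hh⟩) x).card : ℝ) := by
        exact_mod_cast WGraph.searchSize_le_density_mul (ω ⟨0, hh⟩) x
      exact h2.trans (by gcongr; exact hω x)
    have h3 : 0 ≤ 80 * (c + 1) * (X * A * Real.log n ^ 2) := by positivity
    rcases Nat.eq_zero_or_pos K with h0 | hpos
    · rw [h0]
      have : (WGraph.searchTime 0 : ℝ) = 6 := by
        rw [show WGraph.searchTime 0 = 6 by decide]
        norm_num
      linarith
    -- For `n = 1` the logarithm vanishes, so `h1` would force `K = 0`.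
    · have hn2 : 2 ≤ n := by
        by_contra hn
        have : n = 1 := by have := x.pos; omega
        subst this
        simp at h1
        omega
      calc (WGraph.searchTime K : ℝ) ≤ 6 + 40 * (K * Real.log n) :=
            WGraph.searchTime_le hn2 (G.searchSize_le _ _)
        _ ≤ 6 + 40 * (2 * A * ((c + 1) * X * Real.log n) * Real.log n) := by gcongr
        _ = _ := by ring
  have hq := (Nat.cast_le (α := ℝ)).2 (WGraph.query_spec (G := G) (landmarks ω) hh u v).2.2
  push_cast at hq
  change ((query u v).time (Lambda ω) : ℝ) ≤ _ at hq
  have hu := hsearch u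
  have hv := hsearch v
  have hh1 : (1 : ℝ) ≤ h := by exact_mod_cast hh
  have hhops : (0 : ℝ) ≤ hops ((query u v).eval (Lambda ω)) := Nat.cast_nonneg _
  have hY : 0 ≤ X * A * Real.log n ^ 2 := by positivity
  have e1 : (hops ((query u v).eval (Lambda ω)) : ℝ) =
    hops ((query u v).eval (G.oracle (landmarks ω))) := rfl
  rw [e1] at hhops ⊢
  nlinarith [mul_nonneg hc hhops, mul_nonneg hc (zero_le_one.trans hh1)]

theorem query_time_whp (c : ℝ) : ∃ C : ℝ, ∀ (R : Rule) (h : ℕ), 1 ≤ h → ∀ (n : ℕ) (G : WGraph n),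
    1 - (n : ℝ) ^ (-c) ≤ (sampleMeasure R G h).real {ω | ∀ u v : Fin n,
      ((query u v).time (Lambda ω) : ℝ) ≤
        C * ((n : ℝ) ^ ((3 / 4 : ℝ) ^ h) * (R.density G : ℝ) * Real.log n ^ 2) +
        C * ((hops ((query u v).eval (Lambda ω)) : ℝ) + h)} := by
  -- A negative `c` is replaced by `0`, which only strengthens the claim for `1 ≤ n`.
  refine ⟨160 * (max c 0 + 1) + 40, fun R h hh n G => ?_⟩
  rcases Nat.eq_zero_or_pos n with rfl | hn
  · rw [show {ω : Sample R G h | ∀ u v : Fin 0, _} = Set.univ from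
      Set.eq_univ_of_forall fun ω u => u.elim0]
    rw [probReal_univ]
    have : (0 : ℝ) ≤ ((0 : ℕ) : ℝ) ^ (-c) := by positivity
    linarith
  · have hn1 : (1 : ℝ) ≤ n := by exact_mod_cast hn
    have h1 := sampleMeasure_ballNodes_le (R := R) G hh hn (max c 0)
    have h2 : (n : ℝ) ^ (-(max c 0)) ≤ (n : ℝ) ^ (-c) :=
      Real.rpow_le_rpow_of_exponent_le hn1 (neg_le_neg (le_max_left _ _))
    set bad := {ω : Sample R G h | ∃ u, (max c 0 + 1) * (n : ℝ) ^ ((3 / 4 : ℝ) ^ h) * Real.log n <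
      ((ballNodes (ω ⟨0, hh⟩) u).card : ℝ)} with hbad
    have h3 : (sampleMeasure R G h).real badᶜ = 1 - (sampleMeasure R G h).real bad :=
      probReal_compl_eq_one_sub (measurableSet_of_sample _)
    refine le_trans (by linarith : _ ≤ (sampleMeasure R G h).real badᶜ) (measureReal_mono ?_)
    intro ω hω u v
    refine query_time_le hh ω (le_max_right _ _) u v fun x => ?_
    by_contra hc
    exact hω ⟨x, not_le.1 hc⟩

/-! ### Branching events, crossing pairs and quadruples of landmarks -/

section Lists

variable {n : ℕ} {l M A B : List (Fin n)} {a b z : Fin n}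

theorem predIn_succIn_of_infix (hl : l.Nodup) (h : A ++ a :: z :: b :: B <:+: l) :
    predIn l z = some a ∧ succIn l z = some b := by
  obtain ⟨S, T, rfl⟩ := h
  rw [predIn_eq_some_iff hl, succIn_eq_some_iff hl]
  exact ⟨⟨S ++ A, b :: B ++ T, by simp⟩, ⟨S ++ A ++ [a], B ++ T, by simp⟩⟩

theorem sym2_predIn_succIn_of_infix (hl : l.Nodup) (hM : M = A ++ a :: z :: b :: B)
    (h : M <:+: l ∨ M.reverse <:+: l) :
    s(predIn l z, succIn l z) = s(some a, some b) := by
  subst hM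
  rcases h with h | h
  · obtain ⟨h1, h2⟩ := predIn_succIn_of_infix hl h
    rw [h1, h2]
  · obtain ⟨h1, h2⟩ := predIn_succIn_of_infix (A := B.reverse) (B := A.reverse) (a := b) (b := a)
      (z := z) hl (by simpa using h)
    rw [h1, h2, Sym2.eq_swap]

theorem mem_of_infix_of_idxOf_le {x y : Fin n} (hl : l.Nodup) (h : M <:+: l) (hx : x ∈ M)
    (hy : y ∈ M) (hz : z ∈ l) (hxz : l.idxOf x ≤ l.idxOf z) (hzy : l.idxOf z ≤ l.idxOf y) :
    z ∈ M := by
  obtain ⟨S, T, rfl⟩ := h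
  have hd := List.nodup_append.1 hl
  have hd' := List.nodup_append.1 hd.1
  have hxS : x ∉ S := fun hc => hd'.2.2 x hc x hx rfl
  have hyS : y ∉ S := fun hc => hd'.2.2 y hc y hy rfl
  rw [List.mem_append, List.mem_append] at hz
  rcases hz with (hz | hz) | hz
  · have h1 := List.idxOf_lt_length_iff.2 hz
    rw [List.append_assoc, List.idxOf_append_of_notMem hxS, List.idxOf_append_of_mem hz] at hxz
    omega
  · exact hz
  · have hzn : z ∉ S ++ M := fun hc => hd.2.2 z hc z hz rfl
    have h1 := List.idxOf_lt_length_iff.2 hy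
    rw [List.idxOf_append_of_notMem hzn,
      List.idxOf_append_of_mem (List.mem_append_right _ hy), List.idxOf_append_of_notMem hyS,
      List.length_append] at hzy
    omega

end Lists

namespace WGraph

open SimpleGraph

variable {n h : ℕ} {G : WGraph n} {L : Fin h → Finset (Fin n)} {i : Fin h}

theorem reachable_of_mem_route {x y z : Fin n} (hz : z ∈ G.route x y) : G.graph.Reachable x y := by
  by_contra hc
  rw [route_eq_nil hc] at hz
  simp at hz

theorem route_infix_route {x y u v : Fin n} (hu : u ∈ G.route x y) (hv : v ∈ G.route x y) :
    G.route u v <:+: G.route x y ∨ (G.route u v).reverse <:+: G.route x y := by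
  obtain ⟨p, hp, hr⟩ := exists_route_eq (reachable_of_mem_route hu)
  rw [hr] at hu hv ⊢
  exact hp.route_infix hu hv

theorem reachable_of_mem_route_of_mem_route {x y u v : Fin n} (hu : u ∈ G.route x y)
    (hv : v ∈ G.route x y) : G.graph.Reachable u v := by
  obtain ⟨p, hp, hr⟩ := exists_route_eq (reachable_of_mem_route hu)
  rw [hr] at hu hv
  exact (p.takeUntil u hu).reachable.symm.trans (p.takeUntil v hv).reachable

theorem exists_route_split {x y z : Fin n} (hz : z ∈ G.route x y) (hx : z ≠ x) (hy : z ≠ y) :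
    ∃ A a b B, G.route x y = A ++ a :: z :: b :: B := by
  obtain ⟨p, hp, hr⟩ := exists_route_eq (reachable_of_mem_route hz)
  rw [hr] at hz ⊢
  obtain ⟨S, T, hST⟩ := List.append_of_mem hz
  rcases List.eq_nil_or_concat S with rfl | ⟨S, a, rfl⟩
  · have := congrArg List.head? hST
    rw [List.nil_append, List.head?_cons, List.head?_eq_some_head p.support_ne_nil,
      Walk.head_support] at this
    exact absurd (Option.some.inj this).symm hx
  cases T with
  | nil =>
    have := congrArg List.getLast? hST
    rw [List.getLast?_concat, List.getLast?_eq_some_getLast p.support_ne_nil,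
      Walk.getLast_support] at this
    exact absurd (Option.some.inj this).symm hy
  | cons b T => exact ⟨S, a, b, T, by rw [hST]; simp⟩

/-- Two chosen paths do not branch at a vertex between two other common vertices. -/
theorem not_isBranching_of_between {p q : Fin n × Fin n} {x y z : Fin n}
    (hx : x ∈ G.route p.1 p.2) (hx' : x ∈ G.route q.1 q.2)
    (hy : y ∈ G.route p.1 p.2) (hy' : y ∈ G.route q.1 q.2) (hzx : z ≠ x) (hzy : z ≠ y)
    (h1 : (G.route p.1 p.2).idxOf x ≤ (G.route p.1 p.2).idxOf z)
    (h2 : (G.route p.1 p.2).idxOf z ≤ (G.route p.1 p.2).idxOf y) : ¬ G.IsBranching p q z := by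
  rintro ⟨-, hz, -, hne⟩
  -- The route from `x` to `y` is a block of both routes, up to direction. As `z` is an inner vertex
  -- of this block, both routes have the same two neighbours at `z`.
  have hp := route_infix_route hx hy
  have hq := route_infix_route hx' hy'
  obtain ⟨w, -, hw⟩ := exists_route_eq (reachable_of_mem_route_of_mem_route hx hy)
  have hxM : x ∈ G.route x y := by rw [hw]; exact w.start_mem_support
  have hyM : y ∈ G.route x y := by rw [hw]; exact w.end_mem_support
  have hzM : z ∈ G.route x y := by
    rcases hp with hp | hp
    · exact mem_of_infix_of_idxOf_le nodup_route hp hxM hyM hz h1 h2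
    · exact List.mem_reverse.1 (mem_of_infix_of_idxOf_le nodup_route hp (List.mem_reverse.2 hxM)
        (List.mem_reverse.2 hyM) hz h1 h2)
  obtain ⟨A, a, b, B, hM⟩ := exists_route_split hzM hzx hzy
  exact hne ((sym2_predIn_succIn_of_infix nodup_route hM hp).trans
    (sym2_predIn_succIn_of_infix nodup_route hM hq).symm)

-- Apart from the first and the last branching vertex on the route of `p`, every other one would lie
-- between two common vertices.
open Classical in
theorem card_isBranching_le_two (p q : Fin n × Fin n) :
    (Finset.univ.filter fun z => G.IsBranching p q z).card ≤ 2 := by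
  set F := Finset.univ.filter fun z => G.IsBranching p q z with hF
  rcases F.eq_empty_or_nonempty with h0 | h0
  · simp [h0]
  obtain ⟨x, hx, hxmin⟩ := F.exists_min_image (fun z => (G.route p.1 p.2).idxOf z) h0
  obtain ⟨y, hy, hymax⟩ := F.exists_max_image (fun z => (G.route p.1 p.2).idxOf z) h0
  refine (Finset.card_le_card (t := {x, y}) fun z hz => ?_).trans Finset.card_le_two
  by_contra hc
  simp only [Finset.mem_insert, Finset.mem_singleton, not_or] at hc
  have h1 := hxmin z hz
  have h2 := hymax z hz
  simp only [hF, Finset.mem_filter, Finset.mem_univ, true_and] at hx hy hz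
  exact not_isBranching_of_between hx.2.1 hx.2.2.1 hy.2.1 hy.2.2.1 hc.1 hc.2 h1 h2 hz

/-- The vertex `x` lies in the ball of `a` with respect to the landmarks of the next level
(no condition on the top level). -/
def InNextBall (G : WGraph n) (L : Fin h → Finset (Fin n)) (i : Fin h) (a x : Fin n) : Prop :=
  ∀ hi : (i : ℕ) + 1 < h, G.dist a x < G.radius (L ⟨i + 1, hi⟩) a

open Classical in
/-- The quadruples of landmarks of which the last three are in the ball of the first one. -/
def quads (G : WGraph n) (L : Fin h → Finset (Fin n)) (i : Fin h) :
    Finset (Fin n × Fin n × Fin n × Fin n) :=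
  Finset.univ.filter fun t => (t.1 ∈ L i ∧ t.2.1 ∈ L i ∧ t.2.2.1 ∈ L i ∧ t.2.2.2 ∈ L i) ∧
    G.InNextBall L i t.1 t.2.1 ∧ G.InNextBall L i t.1 t.2.2.1 ∧ G.InNextBall L i t.1 t.2.2.2

theorem dist_le_of_mem_route {x y z : Fin n} (hz : z ∈ G.route x y) :
    G.dist x z ≤ G.dist x y ∧ G.dist z y ≤ G.dist x y := by
  obtain ⟨p, hp, hr⟩ := exists_route_eq (reachable_of_mem_route hz)
  rw [hr] at hz
  have h1 := congrArg G.len (p.take_spec hz)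
  rw [len_append] at h1
  rw [hp.dist_eq, ← h1, ENNReal.coe_add]
  exact ⟨(dist_le_len _).trans le_self_add, (dist_le_len _).trans le_add_self⟩

theorem three_mul_dist_lt_of_mem_fracBall {S : Finset (Fin n)} {u v : Fin n}
    (hv : v ∈ G.fracBall (1 / 3) S u) : 3 * G.dist u v < G.radius S u := by
  by_contra hc
  rw [not_lt] at hc
  refine absurd (show G.dist u v < 1 / 3 * G.radius S u from hv) (not_lt.2 ?_)
  calc 1 / 3 * G.radius S u ≤ 1 / 3 * (3 * G.dist u v) := by gcongr
    _ = G.dist u v := by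
      rw [← mul_assoc, one_div, ENNReal.inv_mul_cancel (by norm_num) (by norm_num), one_mul]

/-- One endpoint of a stored pair has everything within twice the distance of the pair in its
ball. -/
theorem exists_inNextBall_of_mem_pairs {p : Fin n × Fin n} (hp : p ∈ G.pairs L i) :
    ∃ a b, (p = (a, b) ∨ p = (b, a)) ∧ a ∈ L i ∧ b ∈ L i ∧
      ∀ x, G.dist a x ≤ 2 * G.dist p.1 p.2 → G.InNextBall L i a x := by
  obtain ⟨x, y⟩ := p
  obtain ⟨-, hx, hy, hxy⟩ := hp
  by_cases hi : (i : ℕ) + 1 < h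
  · rw [dif_pos hi] at hxy
    have key : ∀ a b : Fin n, b ∈ G.fracBall (1 / 3) (L ⟨i + 1, hi⟩) a →
        ∀ z, G.dist a z ≤ 2 * G.dist a b → G.InNextBall L i a z := by
      intro a b hab z hz _
      refine (hz.trans ?_).trans_lt (three_mul_dist_lt_of_mem_fracBall hab)
      gcongr
      norm_num
    rcases hxy with hxy | hxy
    · exact ⟨x, y, Or.inl rfl, hx, hy, key x y hxy⟩
    · refine ⟨y, x, Or.inr rfl, hy, hx, ?_⟩
      simp only [G.dist_comm x y]
      exact key y x hxy
  · exact ⟨x, y, Or.inl rfl, hx, hy, fun _ _ hi' => absurd hi' hi⟩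

theorem dist_eq_of_eq_or_swap {p : Fin n × Fin n} {a b : Fin n} (h : p = (a, b) ∨ p = (b, a)) :
    G.dist p.1 p.2 = G.dist a b := by
  rcases h with rfl | rfl
  · rfl
  · exact G.dist_comm _ _

-- A pair is encoded by the quadruple `(a, b, b, b)` and one bit for its orientation.
open Classical in
theorem card_pairs_le :
    (Finset.univ.filter fun p => p ∈ G.pairs L i).card ≤ 2 * (G.quads L i).card := by
  have hsub : (Finset.univ.filter fun p => p ∈ G.pairs L i) ⊆
      (G.quads L i ×ˢ (Finset.univ : Finset Bool)).image fun t =>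
        if t.2 then (t.1.1, t.1.2.1) else (t.1.2.1, t.1.1) := by
    intro p hp
    simp only [Finset.mem_filter, Finset.mem_univ, true_and] at hp
    obtain ⟨a, b, hab, ha, hb, hball⟩ := exists_inNextBall_of_mem_pairs hp
    have hbb := hball b (by
      rw [dist_eq_of_eq_or_swap hab]
      exact le_mul_of_one_le_left zero_le (by norm_num))
    have hq : (a, b, b, b) ∈ G.quads L i := by simp [quads, ha, hb, hbb]
    rw [Finset.mem_image]
    rcases hab with rfl | rfl
    · exact ⟨((a, b, b, b), true), by simp [hq], rfl⟩
    · exact ⟨((a, b, b, b), false), by simp [hq], rfl⟩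
  refine (Finset.card_le_card hsub).trans (Finset.card_image_le.trans ?_)
  rw [Finset.card_product]
  simp [mul_comm]

/-- From `a` to the crossing point `z` is at most the length of `p`, and from there to an endpoint
of `q` at most the length of `q`, which is no more than that of `p`. -/
theorem mem_quads_of_crossing {p q : Fin n × Fin n} {z : Fin n} (hp : p ∈ G.pairs L i)
    (hq : q ∈ G.pairs L i) (hzp : z ∈ G.route p.1 p.2) (hzq : z ∈ G.route q.1 q.2)
    (hle : G.dist q.1 q.2 ≤ G.dist p.1 p.2) :
    ∃ a b, (p = (a, b) ∨ p = (b, a)) ∧ (a, b, q.1, q.2) ∈ G.quads L i := by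
  obtain ⟨a, b, hab, ha, hb, hball⟩ := exists_inNextBall_of_mem_pairs hp
  refine ⟨a, b, hab, ?_⟩
  have haz : G.dist a z ≤ G.dist p.1 p.2 := by
    have := dist_le_of_mem_route hzp
    rcases hab with rfl | rfl
    · exact this.1
    · rw [G.dist_comm]; exact this.2
  have hz := dist_le_of_mem_route hzq
  have h2 : ∀ x, G.dist z x ≤ G.dist q.1 q.2 → G.InNextBall L i a x := by
    intro x hx
    apply hball
    calc G.dist a x ≤ G.dist a z + G.dist z x := G.dist_triangle _ _ _
      _ ≤ G.dist p.1 p.2 + G.dist p.1 p.2 := add_le_add haz (hx.trans hle)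
      _ = 2 * G.dist p.1 p.2 := (two_mul _).symm
  have hbb := hball b (by
    rw [dist_eq_of_eq_or_swap hab]
    exact le_mul_of_one_le_left zero_le (by norm_num))
  simp only [quads, Finset.mem_filter, Finset.mem_univ, true_and]
  exact ⟨⟨ha, hb, hq.2.1, hq.2.2.1⟩, hbb, h2 _ (by rw [G.dist_comm]; exact hz.1), h2 _ hz.2⟩

-- Besides the quadruple, two bits are needed: the orientation of the longer pair, and which of the
-- two pairs it is.
open Classical in
theorem card_crossing_le :
    (Finset.univ.filter fun t : (Fin n × Fin n) × (Fin n × Fin n) =>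
      t.1 ∈ G.pairs L i ∧ t.2 ∈ G.pairs L i ∧
        ∃ z, z ∈ G.route t.1.1 t.1.2 ∧ z ∈ G.route t.2.1 t.2.2).card ≤
      4 * (G.quads L i).card := by
  have hsub : (Finset.univ.filter fun t : (Fin n × Fin n) × (Fin n × Fin n) =>
      t.1 ∈ G.pairs L i ∧ t.2 ∈ G.pairs L i ∧
        ∃ z, z ∈ G.route t.1.1 t.1.2 ∧ z ∈ G.route t.2.1 t.2.2) ⊆
      (G.quads L i ×ˢ (Finset.univ : Finset (Bool × Bool))).image fun t =>
        let e := if t.2.1 then (t.1.1, t.1.2.1) else (t.1.2.1, t.1.1)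
        if t.2.2 then (e, t.1.2.2) else (t.1.2.2, e) := by
    rintro ⟨p, q⟩ ht
    simp only [Finset.mem_filter, Finset.mem_univ, true_and] at ht
    obtain ⟨hp, hq, z, hzp, hzq⟩ := ht
    rw [Finset.mem_image]
    rcases le_total (G.dist q.1 q.2) (G.dist p.1 p.2) with hle | hle
    · obtain ⟨a, b, hab, hm⟩ := mem_quads_of_crossing hp hq hzp hzq hle
      rcases hab with rfl | rfl
      · exact ⟨((a, b, q.1, q.2), true, true), by simp [hm], rfl⟩
      · exact ⟨((a, b, q.1, q.2), false, true), by simp [hm], rfl⟩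
    · obtain ⟨a, b, hab, hm⟩ := mem_quads_of_crossing hq hp hzq hzp hle
      rcases hab with rfl | rfl
      · exact ⟨((a, b, p.1, p.2), true, false), by simp [hm], rfl⟩
      · exact ⟨((a, b, p.1, p.2), false, false), by simp [hm], rfl⟩
  refine (Finset.card_le_card hsub).trans (Finset.card_image_le.trans ?_)
  rw [Finset.card_product]
  simp [mul_comm]

theorem wordsAt_le {M : Memory n h} (k : Key n h) : M.wordsAt k ≤ k.words := by
  unfold Memory.wordsAt
  split_ifs
  · exact le_rfl
  · exact Nat.zero_le _

theorem sum_wordsAt_pair_le :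
    ∑ x : Fin n, ∑ y : Fin n, (G.oracle L).wordsAt (.pair i x y) ≤
      12 * (G.quads L i).card := by
  classical
  have h1 : ∀ x y : Fin n, (G.oracle L).wordsAt (.pair i x y) ≤
      if (x, y) ∈ G.pairs L i then 6 else 0 := by
    intro x y
    split_ifs with hxy
    · exact wordsAt_le _
    · rw [Memory.wordsAt, oracle_pair_eq_none hxy]
      simp
  calc ∑ x : Fin n, ∑ y : Fin n, (G.oracle L).wordsAt (.pair i x y)
      ≤ ∑ x : Fin n, ∑ y : Fin n, if (x, y) ∈ G.pairs L i then 6 else 0 :=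
        Finset.sum_le_sum fun x _ => Finset.sum_le_sum fun y _ => h1 x y
    _ = ∑ p : Fin n × Fin n, if p ∈ G.pairs L i then 6 else 0 :=
        (Fintype.sum_prod_type (fun p : Fin n × Fin n => if p ∈ G.pairs L i then 6 else 0)).symm
    _ = (Finset.univ.filter fun p => p ∈ G.pairs L i).card * 6 := by
        rw [← Finset.sum_filter, Finset.sum_const, smul_eq_mul]
    _ ≤ (2 * (G.quads L i).card) * 6 := Nat.mul_le_mul_right _ card_pairs_le
    _ = 12 * (G.quads L i).card := by ring

/-- Only crossing pairs have branching records, at most two each, and a record has 11 words. -/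
theorem sum_wordsAt_branch_le :
    ∑ p : Fin n × Fin n, ∑ q : Fin n × Fin n, ∑ v : Fin n,
      (G.oracle L).wordsAt (.branch i p q v) ≤ 88 * (G.quads L i).card := by
  classical
  set crossing := fun t : (Fin n × Fin n) × (Fin n × Fin n) =>
      t.1 ∈ G.pairs L i ∧ t.2 ∈ G.pairs L i ∧
        ∃ z, z ∈ G.route t.1.1 t.1.2 ∧ z ∈ G.route t.2.1 t.2.2
  have hnone : ∀ p q v, ¬ (p ∈ G.pairs L i ∧ q ∈ G.pairs L i ∧ G.IsBranching p q v) →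
      (G.oracle L).wordsAt (.branch i p q v) = 0 := by
    intro p q v hc
    have : G.oracle L (.branch i p q v) = none := by
      simp only [oracle]
      rw [if_neg hc]
    rw [Memory.wordsAt, this]
    simp
  have h1 : ∀ p q : Fin n × Fin n, ∑ v : Fin n, (G.oracle L).wordsAt (.branch i p q v) ≤
      if crossing (p, q) then 22 else 0 := by
    intro p q
    split_ifs with hpq
    · calc ∑ v : Fin n, (G.oracle L).wordsAt (.branch i p q v)
          ≤ ∑ v : Fin n, if G.IsBranching p q v then 11 else 0 := by
            refine Finset.sum_le_sum fun v _ => ?_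
            split_ifs with hb
            · exact wordsAt_le _
            · rw [hnone p q v fun hc => hb hc.2.2]
        _ = (Finset.univ.filter fun v => G.IsBranching p q v).card * 11 := by
            rw [← Finset.sum_filter, Finset.sum_const, smul_eq_mul]
        _ ≤ 2 * 11 := Nat.mul_le_mul_right _ (card_isBranching_le_two p q)
    · rw [Nat.le_zero]
      exact Finset.sum_eq_zero fun v _ => hnone p q v fun hc =>
        hpq ⟨hc.1, hc.2.1, v, hc.2.2.2.1, hc.2.2.2.2.1⟩
  calc ∑ p : Fin n × Fin n, ∑ q : Fin n × Fin n, ∑ v : Fin n,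
        (G.oracle L).wordsAt (.branch i p q v)
      ≤ ∑ p : Fin n × Fin n, ∑ q : Fin n × Fin n, if crossing (p, q) then 22 else 0 :=
        Finset.sum_le_sum fun p _ => Finset.sum_le_sum fun q _ => h1 p q
    _ = ∑ t : (Fin n × Fin n) × (Fin n × Fin n), if crossing t then 22 else 0 :=
        (Fintype.sum_prod_type (fun t => if crossing t then 22 else 0)).symm
    _ = (Finset.univ.filter crossing).card * 22 := by
        rw [← Finset.sum_filter, Finset.sum_const, smul_eq_mul]
    _ ≤ (4 * (G.quads L i).card) * 22 := Nat.mul_le_mul_right _ card_crossing_le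
    _ = 88 * (G.quads L i).card := by ring

/-- The tables `near` and `home` account for `6 + 7` words per vertex, `pair` and `branch` for `12 +
88` per quadruple. -/
theorem space_oracle_le (L : Fin h → Finset (Fin n)) :
    (G.oracle L).space ≤ ∑ i : Fin h, (13 * n + 100 * (G.quads L i).card) := by
  unfold Memory.space
  refine Finset.sum_le_sum fun i _ => ?_
  have h1 : ∑ v : Fin n, (G.oracle L).wordsAt (.near i v) ≤ n * 6 :=
    (Finset.sum_le_sum fun v _ => wordsAt_le (.near i v)).trans (by simp [Key.words])
  have h2 : ∑ v : Fin n, (G.oracle L).wordsAt (.home i v) ≤ n * 7 :=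
    (Finset.sum_le_sum fun v _ => wordsAt_le (.home i v)).trans (by simp [Key.words])
  have h3 := sum_wordsAt_pair_le (G := G) (L := L) (i := i)
  have h4 := sum_wordsAt_branch_le (G := G) (L := L) (i := i)
  omega

end WGraph

/-! ### Moments of the number of nodes in a ball -/

section Moments

variable {ι : Type*} [DecidableEq ι]

/-- Selecting one more node costs a factor `P`, unless the node is already in `S`. -/
theorem sum_pow_card_insert_le {P : ℝ≥0∞} (B S : Finset ι) :
    ∑ d ∈ B, P ^ (insert d S).card ≤ P ^ S.card * (P * B.card + S.card) := by
  have h1 : ∀ d ∈ B, P ^ (insert d S).card ≤ P ^ S.card * (P + if d ∈ S then 1 else 0) := by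
    intro d _
    split_ifs with hd
    · rw [Finset.insert_eq_of_mem hd]
      exact le_mul_of_one_le_right zero_le le_add_self
    · rw [Finset.card_insert_of_notMem hd, pow_succ, add_zero]
  calc ∑ d ∈ B, P ^ (insert d S).card
      ≤ ∑ d ∈ B, P ^ S.card * (P + if d ∈ S then 1 else 0) := Finset.sum_le_sum h1
    _ = P ^ S.card * (P * B.card + (B.filter fun d => d ∈ S).card) := by
        rw [← Finset.mul_sum, Finset.sum_add_distrib, Finset.sum_const, nsmul_eq_mul, mul_comm P,
          Finset.sum_boole]
    _ ≤ _ := by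
        gcongr
        exact fun x hx => (Finset.mem_filter.1 hx).2

/-- Nodes may coincide, and then fewer independent selections are required. Adding the nodes one at
a time gives a factor `P * |B| + 3` each, as at most three are already present. -/
theorem sum_pow_card_quadruple_le {P : ℝ≥0∞} (a : ι) (B : Finset ι) :
    ∑ b ∈ B, ∑ c ∈ B, ∑ d ∈ B, P ^ ({d, c, b, a} : Finset ι).card ≤
      P * (P * B.card + 3) ^ 3 := by
  have hcard : ∀ (S : Finset ι), S.card ≤ 3 →
      ∑ d ∈ B, P ^ (insert d S).card ≤ P ^ S.card * (P * B.card + 3) := by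
    intro S hS
    refine (sum_pow_card_insert_le B S).trans ?_
    gcongr
    exact_mod_cast hS
  set Z := P * B.card + 3
  calc ∑ b ∈ B, ∑ c ∈ B, ∑ d ∈ B, P ^ ({d, c, b, a} : Finset ι).card
      ≤ ∑ b ∈ B, ∑ c ∈ B, P ^ ({c, b, a} : Finset ι).card * Z :=
        Finset.sum_le_sum fun b _ => Finset.sum_le_sum fun c _ => hcard _ Finset.card_le_three
    _ = ∑ b ∈ B, (∑ c ∈ B, P ^ ({c, b, a} : Finset ι).card) * Z := by
        simp only [Finset.sum_mul]
    _ ≤ ∑ b ∈ B, (P ^ ({b, a} : Finset ι).card * Z) * Z := by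
        gcongr with b hb
        exact hcard _ (Finset.card_le_two.trans (by norm_num))
    _ = (∑ b ∈ B, P ^ ({b, a} : Finset ι).card) * Z * Z := by
        simp only [Finset.sum_mul]
    _ ≤ (P ^ ({a} : Finset ι).card * Z) * Z * Z := by
        gcongr
        exact hcard _ (by simp)
    _ = P * Z ^ 3 := by rw [Finset.card_singleton]; ring

end Moments

/-- The right side is `N (N + 1) (N + 2)`. Binomial coefficients are used since `∑ (k + 2).choose 2
* (1 - q) ^ k` has the closed form `1 / q ^ 3`. -/
theorem pow_three_le_sum_choose (N : ℕ) :
    N ^ 3 ≤ 6 * ∑ k ∈ Finset.range N, (k + 2).choose 2 := by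
  induction N with
  | zero => simp
  | succ N ih =>
    rw [Finset.sum_range_succ, mul_add]
    have h1 : (N + 2).choose 2 * 2 = (N + 2) * (N + 1) := by
      rw [Nat.choose_two_right, Nat.div_mul_cancel]
      · rfl
      · exact (Nat.even_mul_pred_self (N + 2)).two_dvd
    nlinarith

theorem sum_choose_mul_pow_le {q : ℝ} (hq : 0 < q) (hq1 : q ≤ 1) (m : ℕ) :
    ∑ k ∈ Finset.range m, ((k + 2).choose 2 : ℝ) * (1 - q) ^ k ≤ 1 / q ^ 3 := by
  have hr : ‖(1 - q : ℝ)‖ < 1 := by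
    rw [Real.norm_eq_abs, abs_of_nonneg (by linarith)]
    linarith
  have h1 := tsum_choose_mul_geometric_of_norm_lt_one 2 hr
  have h2 := summable_choose_mul_geometric_of_norm_lt_one 2 hr
  rw [sub_sub_cancel] at h1
  rw [← h1]
  exact h2.sum_le_tsum _ fun k _ => by
    have : 0 ≤ 1 - q := by linarith
    positivity

section Level

variable {ι : Type*} [Fintype ι]

/-- Layer-cake summation: the cube becomes a weighted sum of the indicators of `k + 1 ≤ |B y|`, to
which the geometric tail applies. -/
theorem lintegral_card_pow_three_le {q : unitInterval} (hq : 0 < (q : ℝ))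
    (B : (ι → Bool) → Finset ι)
    (hB : ∀ k, levelMeasure ι q {y | k ≤ (B y).card} ≤ ENNReal.ofReal (1 - q) ^ k) :
    ∫⁻ y, ((B y).card : ℝ≥0∞) ^ 3 ∂(levelMeasure ι q) ≤ ENNReal.ofReal (6 / (q : ℝ) ^ 3) := by
  set m := Fintype.card ι
  have hq0 : 0 ≤ 1 - (q : ℝ) := sub_nonneg.2 q.2.2
  have h1 : ∀ y, ((B y).card : ℝ≥0∞) ^ 3 ≤ 6 * ∑ k ∈ Finset.range m,
      ((k + 2).choose 2 : ℝ≥0∞) * Set.indicator {y | k + 1 ≤ (B y).card} 1 y := by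
    intro y
    have h2 : ∑ k ∈ Finset.range m,
        ((k + 2).choose 2 : ℝ≥0∞) * Set.indicator {y | k + 1 ≤ (B y).card} 1 y =
          ∑ k ∈ Finset.range (B y).card, ((k + 2).choose 2 : ℝ≥0∞) := by
      rw [← Finset.sum_subset (Finset.range_mono (Finset.card_le_univ (B y)))]
      · refine Finset.sum_congr rfl fun k hk => ?_
        rw [Set.indicator_of_mem (show y ∈ {y | k + 1 ≤ (B y).card} from Finset.mem_range.1 hk)]
        simp
      · intro k _ hk
        rw [Set.indicator_of_notMem (by simpa using hk)]
        simp
    rw [h2]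
    exact_mod_cast pow_three_le_sum_choose (B y).card
  have hmeas : ∀ f : (ι → Bool) → ℝ≥0∞, Measurable f := fun f => measurable_of_countable f
  calc ∫⁻ y, ((B y).card : ℝ≥0∞) ^ 3 ∂(levelMeasure ι q)
      ≤ ∫⁻ y, 6 * ∑ k ∈ Finset.range m, ((k + 2).choose 2 : ℝ≥0∞) *
          Set.indicator {y | k + 1 ≤ (B y).card} 1 y ∂(levelMeasure ι q) := lintegral_mono h1
    _ = 6 * ∑ k ∈ Finset.range m, ((k + 2).choose 2 : ℝ≥0∞) *
          levelMeasure ι q {y | k + 1 ≤ (B y).card} := by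
        rw [lintegral_const_mul _ (hmeas _), lintegral_finsetSum _ fun k _ => hmeas _]
        congr 1
        refine Finset.sum_congr rfl fun k _ => ?_
        rw [lintegral_const_mul _ (hmeas _), lintegral_indicator_one (measurableSet_of_level _)]
    _ ≤ 6 * ∑ k ∈ Finset.range m, ((k + 2).choose 2 : ℝ≥0∞) * ENNReal.ofReal (1 - q) ^ k := by
        gcongr with k hk
        refine (hB (k + 1)).trans ?_
        rw [pow_succ]
        refine mul_le_of_le_one_right zero_le ?_
        rw [ENNReal.ofReal_le_one]
        linarith
    _ = ENNReal.ofReal (6 * ∑ k ∈ Finset.range m, ((k + 2).choose 2 : ℝ) * (1 - q) ^ k) := by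
        rw [ENNReal.ofReal_mul (by norm_num), ENNReal.ofReal_sum_of_nonneg]
        · congr 1
          · simp
          · refine Finset.sum_congr rfl fun k _ => ?_
            rw [ENNReal.ofReal_mul (by positivity), ENNReal.ofReal_natCast,
              ENNReal.ofReal_pow hq0]
        · intro k _
          positivity
    _ ≤ _ := by
        apply ENNReal.ofReal_le_ofReal
        have := sum_choose_mul_pow_le hq q.2.2 m
        calc _ ≤ 6 * (1 / (q : ℝ) ^ 3) := by gcongr
          _ = _ := by ring

/-- By convexity `(x + 3) ^ 3 ≤ 4 * (x ^ 3 + 27)`, which gives `4 * 6 + 4 * 27 = 132`; the constant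
term is absorbed because `q ≤ p`. -/
theorem lintegral_affine_pow_three_le {p q : unitInterval} (hq : 0 < (q : ℝ)) (hpq : (q : ℝ) ≤ p)
    (B : (ι → Bool) → Finset ι)
    (hB : ∀ k, levelMeasure ι q {y | k ≤ (B y).card} ≤ ENNReal.ofReal (1 - q) ^ k) :
    ∫⁻ y, ENNReal.ofReal p * (ENNReal.ofReal p * ((B y).card : ℝ≥0∞) + 3) ^ 3
      ∂(levelMeasure ι q) ≤ ENNReal.ofReal (132 * ((p : ℝ) ^ 4 / (q : ℝ) ^ 3)) := by
  have hp0 : 0 ≤ (p : ℝ) := p.2.1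
  have hmeas : ∀ f : (ι → Bool) → ℝ≥0∞, Measurable f := fun f => measurable_of_countable f
  have h1 : ∀ x : ℝ≥0∞, (x + 3) ^ 3 ≤ 4 * (x ^ 3 + 3 ^ 3) := by
    intro x
    have := ENNReal.rpow_add_le_mul_rpow_add_rpow x 3 (p := 3) (by norm_num)
    norm_num at this ⊢
    exact_mod_cast this
  have h2 := lintegral_card_pow_three_le hq B hB
  calc ∫⁻ y, ENNReal.ofReal p * (ENNReal.ofReal p * ((B y).card : ℝ≥0∞) + 3) ^ 3
        ∂(levelMeasure ι q)
      ≤ ∫⁻ y, ENNReal.ofReal p * (4 * (ENNReal.ofReal p ^ 3 * ((B y).card : ℝ≥0∞) ^ 3 + 3 ^ 3))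
        ∂(levelMeasure ι q) := by
        refine lintegral_mono fun y => ?_
        rw [← mul_pow]
        gcongr
        exact h1 _
    _ = ENNReal.ofReal p * (4 * (ENNReal.ofReal p ^ 3 *
          (∫⁻ y, ((B y).card : ℝ≥0∞) ^ 3 ∂(levelMeasure ι q)) + 3 ^ 3)) := by
        rw [lintegral_const_mul _ (hmeas _), lintegral_const_mul _ (hmeas _),
          lintegral_add_left (hmeas _), lintegral_const_mul _ (hmeas _), lintegral_const,
          measure_univ, mul_one]
    _ ≤ ENNReal.ofReal p * (4 * (ENNReal.ofReal p ^ 3 * ENNReal.ofReal (6 / (q : ℝ) ^ 3) +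
          3 ^ 3)) := by gcongr
    _ = ENNReal.ofReal ((p : ℝ) * (4 * ((p : ℝ) ^ 3 * (6 / (q : ℝ) ^ 3) + 3 ^ 3))) := by
        rw [ENNReal.ofReal_mul hp0, ENNReal.ofReal_mul (by norm_num),
          ENNReal.ofReal_add (by positivity) (by norm_num), ENNReal.ofReal_mul (by positivity),
          ENNReal.ofReal_pow hp0]
        norm_num
    _ ≤ _ := by
        apply ENNReal.ofReal_le_ofReal
        have h3 : (1 : ℝ) ≤ (p : ℝ) ^ 3 / (q : ℝ) ^ 3 := by
          rw [one_le_div (by positivity)]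
          gcongr
        calc (p : ℝ) * (4 * ((p : ℝ) ^ 3 * (6 / (q : ℝ) ^ 3) + 3 ^ 3))
            = p * (24 * ((p : ℝ) ^ 3 / (q : ℝ) ^ 3) + 108 * 1) := by ring
          _ ≤ p * (24 * ((p : ℝ) ^ 3 / (q : ℝ) ^ 3) + 108 * ((p : ℝ) ^ 3 / (q : ℝ) ^ 3)) := by
            gcongr
          _ = _ := by ring

end Level

/-! ### Sampling probabilities -/

section Probabilities

variable {n h : ℕ} {i : Fin h}

theorem sampleProb_eq (hn : 0 < n) :
    (sampleProb n h i : ℝ) = (n : ℝ) ^ (-(3 / 4 : ℝ) ^ (h - (i : ℕ))) := by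
  have hn' : (0 : ℝ) < n := by exact_mod_cast hn
  simp only [sampleProb, rho]
  nth_rewrite 2 [← Real.rpow_one (n : ℝ)]
  rw [← Real.rpow_sub hn']
  congr 1
  ring

theorem sampleProb_pos (hn : 0 < n) : 0 < (sampleProb n h i : ℝ) := by
  have hn' : (0 : ℝ) < n := by exact_mod_cast hn
  rw [sampleProb_eq hn]
  positivity

/-- If the next level has probability `n ^ (-e)`, this one has `n ^ (-(3/4) e)`. The ratio `3/4` of
the exponents is chosen for this balance. -/
theorem sampleProb_next (hn : 0 < n) (hi : (i : ℕ) + 1 < h) :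
    (sampleProb n h ⟨i + 1, hi⟩ : ℝ) ≤ sampleProb n h i ∧
      (sampleProb n h i : ℝ) ^ 4 / (sampleProb n h ⟨i + 1, hi⟩ : ℝ) ^ 3 = 1 := by
  have hn' : (0 : ℝ) < n := by exact_mod_cast hn
  have hn1 : (1 : ℝ) ≤ n := by exact_mod_cast hn
  have hk : h - (i : ℕ) = (h - ((i : ℕ) + 1)) + 1 := by omega
  rw [sampleProb_eq hn, sampleProb_eq hn]
  simp only [hk, pow_succ (3 / 4 : ℝ)]
  set e : ℝ := (3 / 4 : ℝ) ^ (h - ((i : ℕ) + 1))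
  have he : 0 < e := by positivity
  constructor
  · exact Real.rpow_le_rpow_of_exponent_le hn1 (by linarith)
  · rw [← Real.rpow_natCast, ← Real.rpow_natCast, ← Real.rpow_mul hn'.le, ← Real.rpow_mul hn'.le,
      ← Real.rpow_sub hn']
    norm_num
    ring_nf
    simp

theorem sampleProb_top (hn : 0 < n) (hi : ¬ (i : ℕ) + 1 < h) :
    (n : ℝ) * sampleProb n h i = (n : ℝ) ^ (1 / 4 : ℝ) := by
  have hn' : (0 : ℝ) < n := by exact_mod_cast hn
  have hk : h - (i : ℕ) = 1 := by have := i.2; omega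
  rw [sampleProb_eq hn, hk]
  nth_rewrite 1 [← Real.rpow_one (n : ℝ)]
  rw [← Real.rpow_add hn']
  norm_num

end Probabilities

/-! ### The expected number of quadruples -/

section Quads

variable {R : Rule} {n : ℕ} {G : WGraph n} {h : ℕ} {i : Fin h}

/-- For the rule by degree, rounding up adds at most one per vertex, and the degrees sum to at most
`2m`, where `2m / λ = 2n`. -/
theorem card_vnode_le (R : Rule) (G : WGraph n) : Fintype.card (VNode R G) ≤ 3 * n := by
  have hcard : Fintype.card (VNode R G) = ∑ v, R.copies G v := by simp [VNode]
  rw [hcard]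
  cases R with
  | uniform => simp [Rule.copies]; omega
  | byDegree =>
    classical
    set lam := Rule.byDegree.density G with hl
    by_cases h0 : lam = 0
    · have : ∀ v, Rule.byDegree.copies G v = 0 := by
        intro v
        simp [Rule.copies, ← hl, h0]
      simp [this]
    · have hdeg : ∑ v, G.deg v ≤ 2 * G.numEdges := by
        have h1 := WGraph.sum_card_adj_le (G := G) Finset.univ
        have h2 : G.inducedEdges Finset.univ = G.numEdges := by
          simp [WGraph.inducedEdges, WGraph.numEdges]
        rw [h2] at h1
        refine le_trans (Finset.sum_le_sum fun v _ => ?_) h1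
        rw [WGraph.deg, Set.ncard_eq_toFinset_card _ (Set.toFinite _)]
        refine Finset.card_le_card fun z hz => ?_
        simpa using hz
      have hn : (n : ℝ≥0) ≠ 0 := by
        intro hn
        exact h0 (by simp [hl, Rule.density, hn])
      have hm : (G.numEdges : ℝ≥0) ≠ 0 := by
        intro hm
        exact h0 (by simp [hl, Rule.density, hm])
      have h3 : ((∑ v, Rule.byDegree.copies G v : ℕ) : ℝ≥0) ≤ 3 * n := by
        calc ((∑ v, Rule.byDegree.copies G v : ℕ) : ℝ≥0)
            = ∑ v, (Rule.byDegree.copies G v : ℝ≥0) := by push_cast; rfl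
          _ ≤ ∑ v, ((G.deg v : ℝ≥0) / lam + 1) :=
            Finset.sum_le_sum fun v _ => (Nat.ceil_lt_add_one zero_le).le
          _ = ((∑ v, G.deg v : ℕ) : ℝ≥0) / lam + n := by
            rw [Finset.sum_add_distrib, ← Finset.sum_div]
            simp
          _ ≤ ((2 * G.numEdges : ℕ) : ℝ≥0) / lam + n := by gcongr
          _ = 3 * n := by
            rw [hl]
            simp only [Rule.density]
            push_cast
            field_simp
            ring
      exact_mod_cast h3

/-- The ball condition depends only on the selections of level `i + 1` and is thus independent of
level `i`. -/
theorem inNextBall_iff {ω : Sample R G h} (hi : (i : ℕ) + 1 < h) {a b : VNode R G} :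
    G.InNextBall (landmarks ω) i a.1 b.1 ↔ b ∈ ballNodes (ω ⟨i + 1, hi⟩) a.1 := by
  simp only [WGraph.InNextBall, ballNodes, Finset.mem_filter, Finset.mem_univ, true_and,
    landmarks_eq]
  exact ⟨fun h => h hi, fun h _ => h⟩

theorem exists_selected_of_mem_landmarks {ω : Sample R G h} {x : Fin n} (hx : x ∈ landmarks ω i) :
    ∃ a : VNode R G, a.1 = x ∧ ω i a = true := by
  simp only [landmarks, Finset.mem_filter, Finset.mem_univ, true_and] at hx
  obtain ⟨c, hc⟩ := hx
  exact ⟨⟨x, c⟩, rfl, hc⟩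

/-- The event that four virtual nodes give rise to a quadruple of landmarks. -/
def quadEvent (i : Fin h) (a b c d : VNode R G) : Set (Sample R G h) :=
  {ω | (ω i a = true ∧ ω i b = true ∧ ω i c = true ∧ ω i d = true) ∧
    G.InNextBall (landmarks ω) i a.1 b.1 ∧ G.InNextBall (landmarks ω) i a.1 c.1 ∧
    G.InNextBall (landmarks ω) i a.1 d.1}

/-- Every landmark has a selected virtual node, so quadruples of landmarks are images of quadruples
of selected nodes. -/
theorem card_quads_le (ω : Sample R G h) :
    ((G.quads (landmarks ω) i).card : ℝ≥0∞) ≤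
      ∑ a : VNode R G, ∑ b : VNode R G, ∑ c : VNode R G, ∑ d : VNode R G,
        (quadEvent i a b c d).indicator 1 ω := by
  classical
  set F := Finset.univ.filter fun t : VNode R G × VNode R G × VNode R G × VNode R G =>
    ω ∈ quadEvent i t.1 t.2.1 t.2.2.1 t.2.2.2 with hF
  have hsub : G.quads (landmarks ω) i ⊆
      F.image fun t => (t.1.1, t.2.1.1, t.2.2.1.1, t.2.2.2.1) := by
    rintro ⟨x, y, z, w⟩ ht
    simp only [WGraph.quads, Finset.mem_filter, Finset.mem_univ, true_and] at ht
    obtain ⟨⟨hx, hy, hz, hw⟩, hball⟩ := ht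
    obtain ⟨a, rfl, ha⟩ := exists_selected_of_mem_landmarks hx
    obtain ⟨b, rfl, hb⟩ := exists_selected_of_mem_landmarks hy
    obtain ⟨c, rfl, hc⟩ := exists_selected_of_mem_landmarks hz
    obtain ⟨d, rfl, hd⟩ := exists_selected_of_mem_landmarks hw
    rw [Finset.mem_image]
    exact ⟨(a, b, c, d), by
      rw [hF, Finset.mem_filter]
      exact ⟨Finset.mem_univ _, ⟨ha, hb, hc, hd⟩, hball⟩, rfl⟩
  have h1 : ((G.quads (landmarks ω) i).card : ℝ≥0∞) ≤ F.card := by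
    exact_mod_cast (Finset.card_le_card hsub).trans Finset.card_image_le
  refine h1.trans (le_of_eq ?_)
  rw [hF, Finset.card_filter]
  push_cast
  rw [Fintype.sum_prod_type]
  refine Finset.sum_congr rfl fun a _ => ?_
  rw [Fintype.sum_prod_type]
  refine Finset.sum_congr rfl fun b _ => ?_
  rw [Fintype.sum_prod_type]
  refine Finset.sum_congr rfl fun c _ => Finset.sum_congr rfl fun d _ => ?_
  rw [Set.indicator_apply]
  rfl

theorem lintegral_card_quads_le :
    ∫⁻ ω, ((G.quads (landmarks ω) i).card : ℝ≥0∞) ∂(sampleMeasure R G h) ≤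
      ∑ a : VNode R G, ∑ b : VNode R G, ∑ c : VNode R G, ∑ d : VNode R G,
        sampleMeasure R G h (quadEvent i a b c d) := by
  have hmeas : ∀ f : Sample R G h → ℝ≥0∞, Measurable f := fun f => measurable_of_countable f
  refine (lintegral_mono fun ω => card_quads_le ω).trans (le_of_eq ?_)
  rw [lintegral_finsetSum _ fun _ _ => hmeas _]
  refine Finset.sum_congr rfl fun a _ => ?_
  rw [lintegral_finsetSum _ fun _ _ => hmeas _]
  refine Finset.sum_congr rfl fun b _ => ?_
  rw [lintegral_finsetSum _ fun _ _ => hmeas _]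
  refine Finset.sum_congr rfl fun c _ => ?_
  rw [lintegral_finsetSum _ fun _ _ => hmeas _]
  refine Finset.sum_congr rfl fun d _ => ?_
  exact lintegral_indicator_one (measurableSet_of_sample _)

theorem sampleMeasure_two_levels {i j : Fin h} (hij : i ≠ j) (A B : Set (VNode R G → Bool)) :
    sampleMeasure R G h {ω | ω i ∈ A ∧ ω j ∈ B} =
      levelMeasure (VNode R G) (sampleProb n h i) A *
        levelMeasure (VNode R G) (sampleProb n h j) B := by
  have h1 : {ω : Sample R G h | ω i ∈ A ∧ ω j ∈ B} =
      (({i, j} : Finset (Fin h)) : Set (Fin h)).pi fun k => if k = i then A else B := by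
    ext ω
    simp [hij.symm]
  rw [h1, sampleMeasure_eq, Measure.pi_pi_finset, Finset.prod_pair hij]
  simp [hij.symm]

open Classical in
theorem setOf_forall_quadruple (a b c d : VNode R G) :
    {y : VNode R G → Bool | ∀ x ∈ ({d, c, b, a} : Finset (VNode R G)), y x = true} =
      {y | y a = true ∧ y b = true ∧ y c = true ∧ y d = true} := by
  ext y
  simp only [Finset.mem_insert, Finset.mem_singleton, forall_eq_or_imp, forall_eq]
  change (y d = true ∧ y c = true ∧ y b = true ∧ y a = true) ↔
    (y a = true ∧ y b = true ∧ y c = true ∧ y d = true)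
  tauto

open Classical in
theorem sampleMeasure_quadEvent (hi : (i : ℕ) + 1 < h) (a b c d : VNode R G) :
    sampleMeasure R G h (quadEvent i a b c d) =
      ENNReal.ofReal (sampleProb n h i) ^ ({d, c, b, a} : Finset (VNode R G)).card *
        levelMeasure (VNode R G) (sampleProb n h ⟨i + 1, hi⟩)
          {y | b ∈ ballNodes y a.1 ∧ c ∈ ballNodes y a.1 ∧ d ∈ ballNodes y a.1} := by
  rw [← levelMeasure_forall_true, setOf_forall_quadruple, ← sampleMeasure_two_levels]
  · congr 1
    ext ω
    simp only [quadEvent, inNextBall_iff hi]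
    rfl
  · intro hc
    have := congrArg Fin.val hc
    simp at this

open Classical in
theorem sampleMeasure_quadEvent_le (a b c d : VNode R G) :
    sampleMeasure R G h (quadEvent i a b c d) ≤
      ENNReal.ofReal (sampleProb n h i) ^ ({d, c, b, a} : Finset (VNode R G)).card := by
  rw [← levelMeasure_forall_true, setOf_forall_quadruple, ← sampleMeasure_level]
  exact measure_mono fun ω hω => hω.1

/-- For fixed `a`, level `i` is averaged first, with the ball of `a` held fixed; the sum over `b`,
`c`, `d` in the ball is then integrated over level `i + 1`. This gives `132 * 3 = 396` per vertex,
rounded up to the constant of the top level. -/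
theorem lintegral_card_quads_next_le (hn : 0 < n) (hi : (i : ℕ) + 1 < h) :
    ∫⁻ ω, ((G.quads (landmarks ω) i).card : ℝ≥0∞) ∂(sampleMeasure R G h) ≤ 648 * n := by
  classical
  refine lintegral_card_quads_le.trans ?_
  set p := sampleProb n h i
  set q := sampleProb n h ⟨i + 1, hi⟩
  have hmeas : ∀ f : (VNode R G → Bool) → ℝ≥0∞, Measurable f := fun f => measurable_of_countable f
  have ha : ∀ a : VNode R G, ∑ b : VNode R G, ∑ c : VNode R G, ∑ d : VNode R G,
      sampleMeasure R G h (quadEvent i a b c d) ≤ 132 := by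
    intro a
    set B := fun y : VNode R G → Bool => ballNodes y a.1
    calc ∑ b : VNode R G, ∑ c : VNode R G, ∑ d : VNode R G,
          sampleMeasure R G h (quadEvent i a b c d)
        = ∑ b : VNode R G, ∑ c : VNode R G, ∑ d : VNode R G,
            ∫⁻ y, ENNReal.ofReal p ^ ({d, c, b, a} : Finset (VNode R G)).card *
              Set.indicator {y | b ∈ B y ∧ c ∈ B y ∧ d ∈ B y} 1 y
                ∂(levelMeasure (VNode R G) q) := by
          refine Finset.sum_congr rfl fun b _ => Finset.sum_congr rfl fun c _ =>
            Finset.sum_congr rfl fun d _ => ?_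
          rw [lintegral_const_mul _ (hmeas _), lintegral_indicator_one (measurableSet_of_level _),
            sampleMeasure_quadEvent hi]
      _ = ∫⁻ y, ∑ b : VNode R G, ∑ c : VNode R G, ∑ d : VNode R G,
            ENNReal.ofReal p ^ ({d, c, b, a} : Finset (VNode R G)).card *
              Set.indicator {y | b ∈ B y ∧ c ∈ B y ∧ d ∈ B y} 1 y
                ∂(levelMeasure (VNode R G) q) := by
          simp_rw [lintegral_finsetSum _ fun _ _ => hmeas _]
      _ ≤ ∫⁻ y, ENNReal.ofReal p * (ENNReal.ofReal p * ((B y).card : ℝ≥0∞) + 3) ^ 3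
            ∂(levelMeasure (VNode R G) q) := by
          refine lintegral_mono fun y => le_trans (le_of_eq ?_)
            (sum_pow_card_quadruple_le a (B y))
          -- The indicator restricts each of the three sums to the ball.
          rw [← Finset.sum_subset (Finset.subset_univ (B y))]
          · refine Finset.sum_congr rfl fun b hb => ?_
            rw [← Finset.sum_subset (Finset.subset_univ (B y))]
            · refine Finset.sum_congr rfl fun c hc => ?_
              rw [← Finset.sum_subset (Finset.subset_univ (B y))]
              · refine Finset.sum_congr rfl fun d hd => ?_
                rw [Set.indicator_of_mem (show y ∈ {y | b ∈ B y ∧ c ∈ B y ∧ d ∈ B y} from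
                  ⟨hb, hc, hd⟩)]
                simp
              · intro d _ hd
                rw [Set.indicator_of_notMem fun hy => hd hy.2.2, mul_zero]
            · intro c _ hc
              refine Finset.sum_eq_zero fun d _ => ?_
              rw [Set.indicator_of_notMem fun hy => hc hy.2.1, mul_zero]
          · intro b _ hb
            refine Finset.sum_eq_zero fun c _ => Finset.sum_eq_zero fun d _ => ?_
            rw [Set.indicator_of_notMem fun hy => hb hy.1, mul_zero]
      _ ≤ ENNReal.ofReal (132 * ((p : ℝ) ^ 4 / (q : ℝ) ^ 3)) :=
          lintegral_affine_pow_three_le (sampleProb_pos hn) (sampleProb_next hn hi).1 B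
            fun k => levelMeasure_ballNodes_le q a.1 k
      _ = 132 := by
          rw [(sampleProb_next hn hi).2, mul_one]
          simp
  calc ∑ a : VNode R G, ∑ b : VNode R G, ∑ c : VNode R G, ∑ d : VNode R G,
        sampleMeasure R G h (quadEvent i a b c d)
      ≤ ∑ _a : VNode R G, (132 : ℝ≥0∞) := Finset.sum_le_sum fun a _ => ha a
    _ = (Fintype.card (VNode R G) : ℝ≥0∞) * 132 := by
        rw [Finset.sum_const, Finset.card_univ, nsmul_eq_mul]
    _ ≤ ((3 * n : ℕ) : ℝ≥0∞) * 132 := by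
        gcongr
        exact card_vnode_le R G
    _ = 396 * n := by push_cast; ring
    _ ≤ 648 * n := by gcongr; norm_num

/-- There is no ball condition, so all virtual nodes take the place of the ball. With `X = n * p = n
^ (1/4)` the count is at most `3X (3X + 3) ^ 3 ≤ 648 X ^ 4 = 648 n`. -/
theorem lintegral_card_quads_top_le (hn : 0 < n) (hi : ¬ (i : ℕ) + 1 < h) :
    ∫⁻ ω, ((G.quads (landmarks ω) i).card : ℝ≥0∞) ∂(sampleMeasure R G h) ≤ 648 * n := by
  classical
  have hn' : (0 : ℝ) < n := by exact_mod_cast hn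
  have hn1 : (1 : ℝ) ≤ n := by exact_mod_cast hn
  refine lintegral_card_quads_le.trans ?_
  set p := sampleProb n h i
  have hp0 : 0 ≤ (p : ℝ) := p.2.1
  have htop : (n : ℝ) * p = (n : ℝ) ^ (1 / 4 : ℝ) := sampleProb_top hn hi
  set X := (n : ℝ) ^ (1 / 4 : ℝ) with hX
  have hX1 : 1 ≤ X := Real.one_le_rpow hn1 (by norm_num)
  have hX4 : X ^ 4 = n := by
    rw [hX, ← Real.rpow_natCast, ← Real.rpow_mul hn'.le]
    norm_num
  have hcard : ((Fintype.card (VNode R G) : ℕ) : ℝ≥0∞) ≤ ENNReal.ofReal (3 * n) := by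
    rw [ENNReal.ofReal_mul (by norm_num), ENNReal.ofReal_natCast]
    have := card_vnode_le R G
    calc ((Fintype.card (VNode R G) : ℕ) : ℝ≥0∞) ≤ ((3 * n : ℕ) : ℝ≥0∞) := by exact_mod_cast this
      _ = _ := by push_cast; simp
  calc ∑ a : VNode R G, ∑ b : VNode R G, ∑ c : VNode R G, ∑ d : VNode R G,
        sampleMeasure R G h (quadEvent i a b c d)
      ≤ ∑ a : VNode R G, ∑ b : VNode R G, ∑ c : VNode R G, ∑ d : VNode R G,
          ENNReal.ofReal p ^ ({d, c, b, a} : Finset (VNode R G)).card :=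
        Finset.sum_le_sum fun a _ => Finset.sum_le_sum fun b _ => Finset.sum_le_sum fun c _ =>
          Finset.sum_le_sum fun d _ => sampleMeasure_quadEvent_le a b c d
    _ ≤ ∑ _a : VNode R G, ENNReal.ofReal p *
          (ENNReal.ofReal p * (Finset.univ : Finset (VNode R G)).card + 3) ^ 3 :=
        Finset.sum_le_sum fun a _ => sum_pow_card_quadruple_le a Finset.univ
    _ = (Fintype.card (VNode R G) : ℝ≥0∞) * (ENNReal.ofReal p *
          (ENNReal.ofReal p * Fintype.card (VNode R G) + 3) ^ 3) := by
        rw [Finset.sum_const, Finset.card_univ, nsmul_eq_mul]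
    _ ≤ ENNReal.ofReal (3 * n) * (ENNReal.ofReal p *
          (ENNReal.ofReal p * ENNReal.ofReal (3 * n) + 3) ^ 3) := by gcongr
    _ = ENNReal.ofReal (3 * n * (p * (p * (3 * n) + 3) ^ 3)) := by
        rw [ENNReal.ofReal_mul (p := 3 * (n : ℝ)) (by positivity), ENNReal.ofReal_mul hp0,
          ENNReal.ofReal_pow (by positivity), ENNReal.ofReal_add (by positivity) (by norm_num),
          ENNReal.ofReal_mul hp0]
        simp
    _ ≤ ENNReal.ofReal (648 * n) := by
        apply ENNReal.ofReal_le_ofReal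
        calc 3 * (n : ℝ) * (p * (p * (3 * n) + 3) ^ 3)
            = 3 * (n * p) * (3 * (n * p) + 3) ^ 3 := by ring
          _ = 3 * X * (3 * X + 3) ^ 3 := by rw [htop]
          _ ≤ 3 * X * (3 * X + 3 * X) ^ 3 := by gcongr; linarith
          _ = 648 * X ^ 4 := by ring
          _ = 648 * n := by rw [hX4]
    _ = 648 * n := by
        rw [ENNReal.ofReal_mul (by norm_num), ENNReal.ofReal_natCast]
        simp

/-- The constant is `13 + 100 * 648`. -/
theorem lintegral_space_le (R : Rule) (h n : ℕ) (G : WGraph n) :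
    ∫⁻ ω, ((Lambda ω).space : ℝ≥0∞) ∂(sampleMeasure R G h) ≤ ((64813 : ℝ≥0) : ℝ≥0∞) * n * h := by
  have hmeas : ∀ f : Sample R G h → ℝ≥0∞, Measurable f := fun f => measurable_of_countable f
  have hquads : ∀ i : Fin h,
      ∫⁻ ω, ((G.quads (landmarks ω) i).card : ℝ≥0∞) ∂(sampleMeasure R G h) ≤ 648 * n := by
    intro i
    rcases Nat.eq_zero_or_pos n with rfl | hn
    · have : ∀ ω : Sample R G h, (G.quads (landmarks ω) i).card = 0 := fun ω => by
        rw [Finset.card_eq_zero, Finset.eq_empty_iff_forall_notMem]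
        exact fun t => t.1.elim0
      simp [this]
    · by_cases hi : (i : ℕ) + 1 < h
      · exact lintegral_card_quads_next_le hn hi
      · exact lintegral_card_quads_top_le hn hi
  calc ∫⁻ ω, ((Lambda ω).space : ℝ≥0∞) ∂(sampleMeasure R G h)
      ≤ ∫⁻ ω, ∑ i : Fin h, (13 * (n : ℝ≥0∞) + 100 * ((G.quads (landmarks ω) i).card : ℝ≥0∞))
          ∂(sampleMeasure R G h) := by
        refine lintegral_mono fun ω => ?_
        have : (Lambda ω).space ≤ _ := WGraph.space_oracle_le (G := G) (landmarks ω)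
        refine (Nat.cast_le (α := ℝ≥0∞).2 this).trans (le_of_eq ?_)
        push_cast
        rfl
    _ = ∑ i : Fin h, (13 * (n : ℝ≥0∞) + 100 *
          ∫⁻ ω, ((G.quads (landmarks ω) i).card : ℝ≥0∞) ∂(sampleMeasure R G h)) := by
        rw [lintegral_finsetSum _ fun _ _ => hmeas _]
        refine Finset.sum_congr rfl fun i _ => ?_
        rw [lintegral_add_left (hmeas _), lintegral_const, measure_univ, mul_one,
          lintegral_const_mul _ (hmeas _)]
    _ ≤ ∑ _i : Fin h, (13 * (n : ℝ≥0∞) + 100 * (648 * n)) := by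
        gcongr with i _
        exact hquads i
    _ = _ := by
        rw [Finset.sum_const, Finset.card_univ, Fintype.card_fin, nsmul_eq_mul]
        push_cast
        ring

end Quads

end

theorem theorem3 :
    -- expected space `O(n * h)`, in addition to the space for the graph
    (∃ C : ℝ≥0, ∀ (R : Rule) (h : ℕ), 1 ≤ h → ∀ (n : ℕ) (G : WGraph n),
      ∫⁻ ω, ((Lambda ω).space : ℝ≥0∞) ∂(sampleMeasure R G h) ≤ (C : ℝ≥0∞) * n * h) ∧
    -- stretch `6 * 7 ^ (h - 1) - 1`
    (∀ (R : Rule) (h : ℕ), 1 ≤ h → ∀ (n : ℕ) (G : WGraph n) (ω : Sample R G h) (u v : Fin n),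
      (G.graph.Reachable u v → ∃ p : G.graph.Walk u v,
        (query u v).eval (Lambda ω) = some p.support ∧
        (G.len p : ℝ≥0∞) ≤ ((6 * 7 ^ (h - 1) - 1 : ℕ) : ℝ≥0∞) * G.dist u v) ∧
      (¬ G.graph.Reachable u v → (query u v).eval (Lambda ω) = none)) ∧
    -- query time, with high probability for all queries simultaneously
    (∀ c : ℝ, ∃ C : ℝ, ∀ (R : Rule) (h : ℕ), 1 ≤ h → ∀ (n : ℕ) (G : WGraph n),
      1 - (n : ℝ) ^ (-c) ≤ (sampleMeasure R G h).real {ω | ∀ u v : Fin n,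
        ((query u v).time (Lambda ω) : ℝ) ≤
          C * ((n : ℝ) ^ ((3 / 4 : ℝ) ^ h) * (R.density G : ℝ) * Real.log n ^ 2) +
          C * ((hops ((query u v).eval (Lambda ω)) : ℝ) + h)}) := by
  refine ⟨⟨64813, fun R h _ n G => lintegral_space_le R h n G⟩, fun R h hh n G ω u v => ?_,
    query_time_whp⟩
  obtain ⟨h1, h2, -⟩ := WGraph.query_spec (G := G) (landmarks ω) hh u v
  exact ⟨h1, h2⟩
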